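/- Let $V$ be a finite-dimensional complex vector space and $W\subset GL(V)$ a finite group generated by reflections (elements whose fixed space is a hyperplane). Let $\mathcal A$ be the set of reflecting hyperplanes of $W$, and for $H\in\mathcal A$ let $W_H$ be the pointwise stabilizer of $H$ in $W$, $m_H=|W_H|$, $\alpha_H\in V^*$ a linear form with kernel $H$, and $v_H\in V$ a vector with $\mathbb C v_H\oplus H=V$ and $\mathbb C v_H$ stable under $W_H$. Let $k_{H,j}\in\mathbb C$ ($H\in\mathcal A$, $j\in\mathbb Z/m_H$) satisfy $k_{w(H),j}=k_{H,j}$ for $w\in W$, and put in $\mathbb CW$ $$\varepsilon_{H,j}=\frac1{m_H}\sum_{w\in W_H}\det(w)^jw,\qquad a_H=\sum_{j=0}^{m_H-1}m_Hk_{H,j}\varepsilon_{H,j},\qquad \gamma_H=\sum_{j=0}^{m_H-1}m_H(k_{H,j+1}-k_{H,j})\varepsilon_{H,j}.$$ Let $\mathcal L$ be the lattice (under inclusion) of full reflection subgroups of $W$, i.e. subgroups generated by reflections which contain, with a reflection, all reflections of $W$ with the same hyperplane. Let $\mathbb C\mathcal L$ be its Möbius algebra, with basis $(e_\lambda)_{\lambda\in\mathcal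 L}$ and product $e_\lambda e_\mu=e_{\lambda\vee\mu}$ (so that $e_{\{1\}}=1$); $W$ acts on it by conjugation of subgroups. Write $e_H=e_{W_H}$. Let $\delta=\prod_{H\in\mathcal A}\alpha_H\in\mathbb C[V]$, let $X=V\setminus\bigcup_{H\in\mathcal A}H$, so that $\mathbb C[X]=\mathbb C[V][\delta^{-1}]$, and let $\mathcal D(X)$ be the algebra of differential operators on $X$. Let $A(\mathcal L,W)$ be the $\mathbb C$-algebra generated by the vector spaces $V^*$ and $V$, the algebra $\mathbb C\mathcal L$ and the group $W$, with relations $[x,x']=0$, $[y,y']=0$, $[e_\lambda,x]=0$, $[e_\lambda,y]=0$, $wx=w(x)w$, $wy=w(y)w$, $we_\lambda=e_{w\lambda w^{-1}}w$, and $$[y,x]=x(y)+\sum_{H\in\mathcal A}\frac{\alpha_H(y)\,x(v_H)}{\alpha_H(v_H)}\,\gamma_He_H$$ for $x,x'\in V^*$, $y,y'\in V$, $\lambda\in\mathcal L$, $w\in W$. Let $A(\mathcal L,W)_{reg}=A(\mathcal L,W)[\delta^{-1}]$ be the localization at the powers of $\delta$. For $y\in V$ put $$\widetilde{T_y}=\partial_y+\sum_{H\in\mathcal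 A}\frac{\alpha_H(y)}{\alpha_H}\,a_He_H\in(\mathcal D(X)\otimes\mathbb C\mathcal L)\rtimes W.$$ **Theorem.** (i) The multiplication map $\mathbb C[V]\otimes\mathbb C\mathcal L\otimes\mathbb CW\otimes\mathbb C[V^*]\to A(\mathcal L,W)$ is an isomorphism of vector spaces, and the localization morphism $A(\mathcal L,W)\to A(\mathcal L,W)_{reg}$ is the localization of the left $\mathbb C[V]$-module $A(\mathcal L,W)$ at the powers of $\delta$, i.e. $A(\mathcal L,W)_{reg}=\mathbb C[X]\otimes_{\mathbb C[V]}A(\mathcal L,W)$. (ii) There is a morphism of $\mathbb C$-algebras $\Phi\colon A(\mathcal L,W)\to(\mathcal D(X)\otimes\mathbb C\mathcal L)\rtimes W$ with $\Phi(x)=x$ for $x\in V^*$, $\Phi(y)=\widetilde{T_y}$ for $y\in V$, $\Phi(w)=w$ for $w\in W$ and $\Phi(e_\lambda)=e_\lambda$ for $\lambda\in\mathcal L$, and $\Phi$ is injective. (iii) $\Phi$ extends to an isomorphism of $\mathbb C$-algebras $\Phi_{reg}\colon A(\mathcal L,W)_{reg}\to(\mathcal D(X)\otimes\mathbb C\mathcal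 L)\rtimes W$, i.e. the composite of $\Phi_{reg}$ with the localization morphism is $\Phi$. -/

import Mathlib

open scoped TensorProduct

noncomputable section

namespace LatticeCherednik

section Reflections

variable {V : Type*} [AddCommGroup V] [Module ℂ V]

/-- The space of vectors fixed by `g`, that is `Ker (g - 1)`. -/
def fixedSpace (g : V ≃ₗ[ℂ] V) : Submodule ℂ V :=
  LinearMap.ker ((g : V →ₗ[ℂ] V) - LinearMap.id)

theorem mem_fixedSpace {g : V ≃ₗ[ℂ] V} {v : V} : v ∈ fixedSpace g ↔ g v = v := by
  simp [fixedSpace, sub_eq_zero]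

/-- A (complex, or pseudo-) reflection: its fixed space is a hyperplane, that is, a maximal
proper subspace. -/
def IsReflection (g : V ≃ₗ[ℂ] V) : Prop := IsCoatom (fixedSpace g)

theorem fixedSpace_conj (g s : V ≃ₗ[ℂ] V) :
    fixedSpace (g * s * g⁻¹) = Submodule.orderIsoMapComap g (fixedSpace s) := by
  ext v
  simp only [mem_fixedSpace, Submodule.orderIsoMapComap_apply', LinearEquiv.mul_apply]
  rw [Submodule.mem_comap, mem_fixedSpace]
  exact ⟨fun h => g.injective (h.trans (g.apply_symm_apply v).symm),
    fun h => (congrArg g h).trans (g.apply_symm_apply v)⟩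

theorem isReflection_conj (g : V ≃ₗ[ℂ] V) {s : V ≃ₗ[ℂ] V} (hs : IsReflection s) :
    IsReflection (g * s * g⁻¹) := by
  unfold IsReflection
  rw [fixedSpace_conj]
  exact (OrderIso.isCoatom_iff _ _).2 hs

/-- `W` is a complex reflection group: it is generated by the reflections it contains
(finiteness of `W` is a separate assumption). -/
def IsReflectionGroup (W : Subgroup (V ≃ₗ[ℂ] V)) : Prop :=
  Subgroup.closure {s | s ∈ W ∧ IsReflection s} = W

variable (W : Subgroup (V ≃ₗ[ℂ] V))

/-- The arrangement of reflecting hyperplanes of `W`. -/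
structure Arrangement where
  hyperplane : Submodule ℂ V
  exists_reflection : ∃ s ∈ W, IsReflection s ∧ fixedSpace s = hyperplane

instance [Finite W] : Finite (Arrangement W) := by
  refine Finite.of_surjective
    (fun s : {s : W // IsReflection (s : V ≃ₗ[ℂ] V)} =>
      (⟨fixedSpace (s.1 : V ≃ₗ[ℂ] V), s.1, s.1.2, s.2, rfl⟩ : Arrangement W)) ?_
  rintro ⟨H, s, hs, hr, rfl⟩
  exact ⟨⟨⟨s, hs⟩, hr⟩, rfl⟩

instance [Finite W] : Fintype (Arrangement W) := Fintype.ofFinite _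

variable {W} in
/-- The hyperplane `w(H)`. -/
def Arrangement.move (w : W) (H : Arrangement W) : Arrangement W :=
  ⟨H.hyperplane.map ((w : V ≃ₗ[ℂ] V) : V →ₗ[ℂ] V), by
    obtain ⟨s, hs, hr, h⟩ := H.exists_reflection
    refine ⟨(w : V ≃ₗ[ℂ] V) * s * (w : V ≃ₗ[ℂ] V)⁻¹, W.mul_mem (W.mul_mem w.2 hs) (W.inv_mem w.2), isReflection_conj _ hr, ?_⟩
    rw [fixedSpace_conj, h]
    rfl⟩

variable {W} in
theorem Arrangement.isCoatom (H : Arrangement W) : IsCoatom H.hyperplane := by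
  obtain ⟨s, -, hr, h⟩ := H.exists_reflection
  exact h ▸ hr

/-- The pointwise stabilizer `W_H` of `H` in `W`. -/
def fixer (H : Submodule ℂ V) : Subgroup (V ≃ₗ[ℂ] V) where
  carrier := {g | g ∈ W ∧ ∀ v ∈ H, g v = v}
  mul_mem' := by
    rintro a b ⟨ha, ha'⟩ ⟨hb, hb'⟩
    exact ⟨W.mul_mem ha hb, fun v hv => by rw [LinearEquiv.mul_apply, hb' v hv, ha' v hv]⟩
  one_mem' := ⟨W.one_mem, fun _ _ => rfl⟩
  inv_mem' := by
    rintro a ⟨ha, ha'⟩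
    exact ⟨W.inv_mem ha, fun v hv => (LinearEquiv.symm_apply_eq a).2 (ha' v hv).symm⟩

/-- The full reflection subgroups of `W`: subgroups generated by reflections which contain,
with a reflection, all the reflections of `W` that have the same reflecting hyperplane. -/
@[ext] structure FullReflectionSubgroup where
  toSubgroup : Subgroup (V ≃ₗ[ℂ] V)
  le : toSubgroup ≤ W
  generated : IsReflectionGroup toSubgroup
  full : ∀ s ∈ toSubgroup, IsReflection s →
    ∀ s' ∈ W, IsReflection s' → fixedSpace s' = fixedSpace s → s' ∈ toSubgroup

namespace FullReflectionSubgroup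

variable {W}

/-- The lattice order: inclusion of subgroups. -/
instance : PartialOrder (FullReflectionSubgroup W) :=
  PartialOrder.lift toSubgroup fun _ _ h => FullReflectionSubgroup.ext h

/-- The smallest full reflection subgroup containing `a` and `b`. -/
def join (a b : FullReflectionSubgroup W) : FullReflectionSubgroup W where
  toSubgroup := Subgroup.closure {s | s ∈ W ∧ IsReflection s ∧
    ∀ c : FullReflectionSubgroup W, a ≤ c → b ≤ c → s ∈ c.toSubgroup}
  le := (Subgroup.closure_le _).2 fun _ hs => hs.1
  generated := by
    refine le_antisymm ((Subgroup.closure_le _).2 fun s hs => hs.1) ?_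
    exact Subgroup.closure_mono fun s hs => ⟨Subgroup.subset_closure hs, hs.2.1⟩
  full := by
    intro s hs hr s' hs' hr' hss
    refine Subgroup.subset_closure ⟨hs', hr', fun c hac hbc => ?_⟩
    refine c.full s ?_ hr s' hs' hr' hss
    exact (Subgroup.closure_le c.toSubgroup).2 (fun t ht => ht.2.2 c hac hbc) hs

/-- The trivial subgroup. -/
def trivial : FullReflectionSubgroup W where
  toSubgroup := ⊥
  le := bot_le
  generated := bot_unique ((Subgroup.closure_le _).2 fun _ hs => hs.1)
  full := by
    intro s hs hr
    rw [Subgroup.mem_bot] at hs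
    subst hs
    exact (hr.1 (eq_top_iff.2 fun v _ => mem_fixedSpace.2 rfl)).elim

theorem le_join_aux (a b c : FullReflectionSubgroup W)
    (h : ∀ d : FullReflectionSubgroup W, a ≤ d → b ≤ d → c ≤ d) : c ≤ join a b := by
  change c.toSubgroup ≤ _
  rw [← c.generated]
  exact Subgroup.closure_mono fun s hs => ⟨c.le hs.1, hs.2, fun d ha hb => h d ha hb hs.1⟩

instance : SemilatticeSup (FullReflectionSubgroup W) where
  sup := join
  le_sup_left a b := le_join_aux a b a fun _ h _ => h
  le_sup_right a b := le_join_aux a b b fun _ _ h => h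
  sup_le _ _ c ha hb := (Subgroup.closure_le c.toSubgroup).2 fun _ hs => hs.2.2 c ha hb

instance : OrderBot (FullReflectionSubgroup W) where
  bot := trivial
  bot_le a := (bot_le : (⊥ : Subgroup (V ≃ₗ[ℂ] V)) ≤ a.toSubgroup)

/-- The join as a monoid law, with the trivial subgroup as unit. -/
instance : CommMonoid (FullReflectionSubgroup W) where
  mul a b := a ⊔ b
  one := ⊥
  mul_assoc := sup_assoc
  one_mul := bot_sup_eq
  mul_one := sup_bot_eq
  mul_comm := sup_comm

theorem mul_eq_sup (a b : FullReflectionSubgroup W) : a * b = a ⊔ b := rfl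

theorem one_eq_bot : (1 : FullReflectionSubgroup W) = ⊥ := rfl

/-- The conjugate `w a w⁻¹`. -/
def conj (w : W) (a : FullReflectionSubgroup W) : FullReflectionSubgroup W where
  toSubgroup := a.toSubgroup.map (MulAut.conj (w : V ≃ₗ[ℂ] V)).toMonoidHom
  le := by
    rintro _ ⟨s, hs, rfl⟩
    exact W.mul_mem (W.mul_mem w.2 (a.le hs)) (W.inv_mem w.2)
  generated := by
    refine le_antisymm ((Subgroup.closure_le _).2 fun s hs => hs.1) ?_
    have h := a.generated
    unfold IsReflectionGroup at h
    conv_lhs => rw [← h]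
    rw [MonoidHom.map_closure]
    refine Subgroup.closure_mono ?_
    rintro _ ⟨s, ⟨hs, hr⟩, rfl⟩
    exact ⟨⟨s, hs, rfl⟩, isReflection_conj _ hr⟩
  full := by
    rintro _ ⟨s, hs, rfl⟩ hr s' hs' hr' hss
    have key : ∀ t : V ≃ₗ[ℂ] V, (w : V ≃ₗ[ℂ] V)⁻¹ * ((w : V ≃ₗ[ℂ] V) * t * (w : V ≃ₗ[ℂ] V)⁻¹) *
      ((w : V ≃ₗ[ℂ] V)⁻¹)⁻¹ = t := fun t => by group
    refine ⟨(w : V ≃ₗ[ℂ] V)⁻¹ * s' * ((w : V ≃ₗ[ℂ] V)⁻¹)⁻¹, ?_, ?_⟩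
    · have hr0 : IsReflection s := by
        have := isReflection_conj (w : V ≃ₗ[ℂ] V)⁻¹ hr
        change IsReflection ((w : V ≃ₗ[ℂ] V)⁻¹ * ((w : V ≃ₗ[ℂ] V) * s * (w : V ≃ₗ[ℂ] V)⁻¹) * _) at this
        rwa [key] at this
      refine a.full s hs hr0 _ (W.mul_mem (W.mul_mem (W.inv_mem w.2) hs')
        (W.inv_mem (W.inv_mem w.2))) (isReflection_conj _ hr') ?_
      conv_rhs => rw [← key s]
      rw [fixedSpace_conj, hss, fixedSpace_conj _ (_ * s * _)]
      rfl
    · change (w : V ≃ₗ[ℂ] V) * _ * (w : V ≃ₗ[ℂ] V)⁻¹ = s'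
      group

theorem conj_mono (w : W) {a b : FullReflectionSubgroup W} (h : a ≤ b) : conj w a ≤ conj w b :=
  Subgroup.map_mono h

theorem conj_one (a : FullReflectionSubgroup W) : conj 1 a = a := by
  ext s
  simp [conj]

theorem conj_mul (w w' : W) (a : FullReflectionSubgroup W) :
    conj (w * w') a = conj w (conj w' a) := by
  apply FullReflectionSubgroup.ext
  simp only [conj, Subgroup.map_map]
  congr 1

/-- Conjugation by `w`, an automorphism of the lattice. -/
def conjIso (w : W) : FullReflectionSubgroup W ≃o FullReflectionSubgroup W where
  toFun := conj w
  invFun := conj w⁻¹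
  left_inv a := by rw [← conj_mul, inv_mul_cancel, conj_one]
  right_inv a := by rw [← conj_mul, mul_inv_cancel, conj_one]
  map_rel_iff' {a b} := by
    refine ⟨fun h => ?_, conj_mono w⟩
    have := conj_mono w⁻¹ h
    simpa only [Equiv.coe_fn_mk, ← conj_mul, inv_mul_cancel, conj_one] using this

/-- The action of `W` on its lattice of full reflection subgroups. -/
def conjAut : W →* MulAut (FullReflectionSubgroup W) where
  toFun w := { (conjIso w).toEquiv with map_mul' := fun a b => (conjIso w).map_sup a b }
  map_one' := by ext1 a; exact conj_one a
  map_mul' w w' := by ext1 a; exact conj_mul w w' a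

end FullReflectionSubgroup

variable {W} in
/-- `W_H` as a full reflection subgroup: the index of the basis element `e_H`. -/
def parabolic (H : Arrangement W) : FullReflectionSubgroup W where
  toSubgroup := fixer W H.hyperplane
  le _ h := h.1
  generated := by
    refine le_antisymm ((Subgroup.closure_le _).2 fun s hs => hs.1) fun g hg => ?_
    by_cases h1 : g = 1
    · exact h1 ▸ Subgroup.one_mem _
    · refine Subgroup.subset_closure ⟨hg, ?_⟩
      have hle : H.hyperplane ≤ fixedSpace g := fun v hv => mem_fixedSpace.2 (hg.2 v hv)
      rcases H.isCoatom.le_iff.1 hle with h | h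
      · refine (h1 (LinearEquiv.ext fun v => mem_fixedSpace.1 ?_)).elim
        rw [h]
        exact Submodule.mem_top
      · unfold IsReflection
        rw [h]
        exact H.isCoatom
  full := by
    intro s hs hr s' hs' _ hss
    refine ⟨hs', fun v hv => mem_fixedSpace.1 ?_⟩
    rw [hss]
    exact mem_fixedSpace.2 (hs.2 v hv)

/-- The Möbius algebra `ℂ𝓛` of the lattice: it has the basis `e_a`, with `e_a e_b = e_{a ∨ b}`. -/
abbrev MobiusAlgebra : Type _ := MonoidAlgebra ℂ (FullReflectionSubgroup W)

end Reflections

section Mobius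

variable {V : Type*} [AddCommGroup V] [Module ℂ V] {W : Subgroup (V ≃ₗ[ℂ] V)}

/-- The action of `W` on `ℂ𝓛`, `e_a ↦ e_{w a w⁻¹}`. -/
def mobiusAut : W →* (MobiusAlgebra W ≃ₐ[ℂ] MobiusAlgebra W) where
  toFun w := MonoidAlgebra.domCongr ℂ ℂ (FullReflectionSubgroup.conjAut w)
  map_one' := by
    rw [map_one]
    exact MonoidAlgebra.domCongr_refl
  map_mul' w w' := by
    rw [map_mul]
    exact (MonoidAlgebra.trans_domCongr_domCongr _ _).symm

end Mobius

section DifferentialOperators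

variable (k R : Type*) [CommRing k] [CommRing R] [Algebra k R]

/-- Multiplication by `f`, as a `k`-linear endomorphism of `R`. -/
abbrev mulOp : R →ₐ[k] Module.End k R := Algebra.lmul k R

variable {k R}

/-- `k`-linear differential operators of order at most `n` on the commutative algebra `R`. -/
def IsDiffOp : ℕ → Module.End k R → Prop
  | 0, P => ∀ f : R, P * mulOp k R f - mulOp k R f * P = 0
  | n + 1, P => ∀ f : R, IsDiffOp n (P * mulOp k R f - mulOp k R f * P)

theorem isDiffOp_zero (n : ℕ) : IsDiffOp n (0 : Module.End k R) := by
  induction n with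
  | zero => intro f; simp
  | succ n ih => intro f; simpa using ih

theorem IsDiffOp.add {n : ℕ} : ∀ {P Q : Module.End k R}, IsDiffOp n P → IsDiffOp n Q →
    IsDiffOp n (P + Q) := by
  induction n with
  | zero =>
    intro P Q hP hQ f
    have h : (P + Q) * mulOp k R f - mulOp k R f * (P + Q) =
      (P * mulOp k R f - mulOp k R f * P) + (Q * mulOp k R f - mulOp k R f * Q) := by noncomm_ring
    rw [h, hP f, hQ f, add_zero]
  | succ n ih =>
    intro P Q hP hQ f
    have h : (P + Q) * mulOp k R f - mulOp k R f * (P + Q) =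
      (P * mulOp k R f - mulOp k R f * P) + (Q * mulOp k R f - mulOp k R f * Q) := by noncomm_ring
    rw [h]
    exact ih (hP f) (hQ f)

theorem IsDiffOp.succ {n : ℕ} : ∀ {P : Module.End k R}, IsDiffOp n P → IsDiffOp (n + 1) P := by
  induction n with
  | zero => intro P hP f; rw [hP f]; exact isDiffOp_zero 0
  | succ n ih => intro P hP f; exact ih (hP f)

theorem IsDiffOp.mono {m n : ℕ} (h : m ≤ n) {P : Module.End k R} (hP : IsDiffOp m P) :
    IsDiffOp n P := by
  induction h with
  | refl => exact hP
  | step _ ih => exact ih.succ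

theorem comm_mul_aux (P Q F : Module.End k R) :
    (P * Q) * F - F * (P * Q) = P * (Q * F - F * Q) + (P * F - F * P) * Q := by
  simp only [mul_sub, sub_mul, mul_assoc]
  abel

theorem IsDiffOp.mul : ∀ {m n : ℕ} {P Q : Module.End k R}, IsDiffOp m P → IsDiffOp n Q →
    IsDiffOp (m + n) (P * Q)
  | 0, 0, P, Q, hP, hQ => fun f => by rw [comm_mul_aux, hP f, hQ f]; simp
  | 0, n + 1, P, Q, hP, hQ => fun f => by
    rw [comm_mul_aux, hP f, zero_mul, add_zero]
    exact IsDiffOp.mul hP (hQ f)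
  | m + 1, 0, P, Q, hP, hQ => fun f => by
    rw [comm_mul_aux, hQ f, mul_zero, zero_add]
    exact IsDiffOp.mul (hP f) hQ
  | m + 1, n + 1, P, Q, hP, hQ => fun f => by
    change IsDiffOp (m + 1 + n) _
    rw [comm_mul_aux]
    refine IsDiffOp.add (IsDiffOp.mul hP (hQ f)) ?_
    have := IsDiffOp.mul (hP f) hQ
    exact this.mono (by omega)

theorem isDiffOp_mulOp (f : R) : IsDiffOp 0 (mulOp k R f) := fun g => by
  rw [← map_mul, ← map_mul, mul_comm, sub_self]

theorem isDiffOp_algebraMap (c : k) : IsDiffOp 0 (algebraMap k (Module.End k R) c) := fun g => by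
  rw [Algebra.commutes, sub_self]

theorem isDiffOp_one_of_leibniz (P : Module.End k R)
    (h : ∀ f g, P (f * g) = f * P g + P f * g) : IsDiffOp 1 P := by
  intro f
  have : P * mulOp k R f - mulOp k R f * P = mulOp k R (P f) := by
    ext g
    simp [h]
  rw [this]
  exact isDiffOp_mulOp _

variable (k R) in
/-- The algebra of (Grothendieck) differential operators on the commutative algebra `R`. -/
def DiffOp : Subalgebra k (Module.End k R) where
  carrier := {P | ∃ n, IsDiffOp n P}
  mul_mem' := by
    rintro P Q ⟨m, hP⟩ ⟨n, hQ⟩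
    exact ⟨m + n, hP.mul hQ⟩
  add_mem' := by
    rintro P Q ⟨m, hP⟩ ⟨n, hQ⟩
    exact ⟨max m n, (hP.mono (le_max_left _ _)).add (hQ.mono (le_max_right _ _))⟩
  algebraMap_mem' c := ⟨0, isDiffOp_algebraMap c⟩

variable (k R) in
/-- Functions, as differential operators of order zero. -/
def DiffOp.ofFun : R →ₐ[k] DiffOp k R :=
  (mulOp k R).codRestrict _ fun f => ⟨0, isDiffOp_mulOp f⟩

theorem IsDiffOp.conj (φ : R ≃ₐ[k] R) {n : ℕ} : ∀ {P : Module.End k R}, IsDiffOp n P →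
    IsDiffOp n (φ.toLinearEquiv.conjAlgEquiv k P) := by
  have key : ∀ (P : Module.End k R) (f : R),
      φ.toLinearEquiv.conjAlgEquiv k P * mulOp k R f -
        mulOp k R f * φ.toLinearEquiv.conjAlgEquiv k P =
      φ.toLinearEquiv.conjAlgEquiv k
        (P * mulOp k R (φ.symm f) - mulOp k R (φ.symm f) * P) := by
    intro P f
    ext g
    simp [LinearEquiv.conjAlgEquiv]
  induction n with
  | zero => intro P hP f; rw [key, hP, map_zero]
  | succ n ih => intro P hP f; rw [key]; exact ih (hP _)

/-- Transport of differential operators by an automorphism `φ` of `R`: `P ↦ φ ∘ P ∘ φ⁻¹`. -/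
def DiffOp.conj (φ : R ≃ₐ[k] R) : DiffOp k R →ₐ[k] DiffOp k R :=
  (((φ.toLinearEquiv.conjAlgEquiv k).toAlgHom).comp (DiffOp k R).val).codRestrict _
    fun P => ⟨P.2.choose, P.2.choose_spec.conj φ⟩

theorem DiffOp.conj_apply (φ : R ≃ₐ[k] R) (P : DiffOp k R) (f : R) :
    (DiffOp.conj φ P : Module.End k R) f = φ ((P : Module.End k R) (φ.symm f)) := rfl

/-- The resulting action of the automorphisms of `R`. -/
def DiffOp.conjAut : (R ≃ₐ[k] R) →* (DiffOp k R ≃ₐ[k] DiffOp k R) where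
  toFun φ := AlgEquiv.ofAlgHom (DiffOp.conj φ) (DiffOp.conj φ⁻¹)
    (by
      ext P f
      simp only [AlgHom.comp_apply, conj_apply, AlgHom.id_apply]
      exact (φ.apply_symm_apply _).trans (congrArg _ (φ.apply_symm_apply f)))
    (by
      ext P f
      simp only [AlgHom.comp_apply, conj_apply, AlgHom.id_apply]
      exact (φ.symm_apply_apply _).trans (congrArg _ (φ.symm_apply_apply f)))
  map_one' := by ext P f; rfl
  map_mul' φ ψ := by ext P f; rfl

end DifferentialOperators

section Tensor

variable {G A B : Type*} [Monoid G] [Semiring A] [Algebra ℂ A] [Semiring B] [Algebra ℂ B]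

/-- The diagonal action on a tensor product of algebras. -/
def tensorAut (f : G →* (A ≃ₐ[ℂ] A)) (g : G →* (B ≃ₐ[ℂ] B)) :
    G →* (A ⊗[ℂ] B ≃ₐ[ℂ] A ⊗[ℂ] B) where
  toFun w := Algebra.TensorProduct.congr (f w) (g w)
  map_one' := by
    rw [map_one, map_one]
    exact AlgEquiv.ext fun t => by
      induction t with
      | zero => simp
      | tmul a b => rfl
      | add a b ha hb => rw [map_add, ha, hb, map_add]
  map_mul' w w' := by
    rw [map_mul, map_mul]
    exact AlgEquiv.ext fun t => by
      induction t with
      | zero => simp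
      | tmul a b => rfl
      | add a b ha hb => rw [map_add, ha, hb, map_add]

end Tensor

section SymLift

variable {M A : Type*} [AddCommGroup M] [Module ℂ M] [Ring A] [Algebra ℂ A]

/-- The morphism from the symmetric algebra of `M` to a possibly noncommutative algebra `A`
induced by a linear map with commuting values. -/
def symLift (f : M →ₗ[ℂ] A) (hf : ∀ a b, f a * f b = f b * f a) :
    SymmetricAlgebra ℂ M →ₐ[ℂ] A :=
  RingCon.liftₐ _ (TensorAlgebra.lift ℂ f) (RingCon.ringConGen_le.2 (by
    rintro _ _ ⟨a, b⟩
    rw [RingCon.ker_apply]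
    change TensorAlgebra.lift ℂ f _ = TensorAlgebra.lift ℂ f _
    simp only [map_mul, TensorAlgebra.lift_ι_apply]
    exact hf a b))

theorem symLift_ι (f : M →ₗ[ℂ] A) (hf : ∀ a b, f a * f b = f b * f a) (a : M) :
    symLift f hf (SymmetricAlgebra.ι ℂ M a) = f a :=
  TensorAlgebra.lift_ι_apply f a

end SymLift

section Data

variable {V : Type*} [AddCommGroup V] [Module ℂ V] (W : Subgroup (V ≃ₗ[ℂ] V))

/-- The choices that enter the definition of the Cherednik algebra of `(𝓛, W)`: linear forms
`α_H` with kernel `H`, vectors `v_H` spanning a `W_H`-stable complement of `H`, and parameters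
`k_{H,j}` for `0 ≤ j < m_H = |W_H|`, invariant under `W` (values at other `j` play no role). -/
structure Data where
  α : Arrangement W → Module.Dual ℂ V
  ker_α : ∀ H, LinearMap.ker (α H) = H.hyperplane
  v : Arrangement W → V
  isCompl_v : ∀ H, IsCompl (Submodule.span ℂ {v H}) H.hyperplane
  stable_v : ∀ H, ∀ g ∈ fixer W H.hyperplane, g (v H) ∈ Submodule.span ℂ {v H}
  k : Arrangement W → ℕ → ℂ
  k_move : ∀ (w : W) (H : Arrangement W), ∀ j < Nat.card (fixer W H.hyperplane),
    k (H.move w) j = k H j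

variable {W}

/-- `m_H`, the order of `W_H`. -/
def ord (H : Arrangement W) : ℕ := Nat.card (fixer W H.hyperplane)

open Classical in
/-- The idempotent `ε_{H,j} = (1 / m_H) ∑_{w ∈ W_H} det(w)^j w` of `ℂW`. -/
def eps [Finite W] (H : Arrangement W) (j : ℕ) : MonoidAlgebra ℂ W :=
  letI := Fintype.ofFinite W
  (1 / (ord H : ℂ)) • ∑ w ∈ Finset.univ.filter (fun w : W => (w : V ≃ₗ[ℂ] V) ∈ fixer W H.hyperplane),
    MonoidAlgebra.single w (LinearMap.det ((w : V ≃ₗ[ℂ] V) : V →ₗ[ℂ] V) ^ j)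

/-- The polynomial functions `ℂ[V]`, that is, the symmetric algebra of `V*`. -/
abbrev Poly (V : Type*) [AddCommGroup V] [Module ℂ V] : Type _ :=
  SymmetricAlgebra ℂ (Module.Dual ℂ V)

/-- The contragredient action on `V*`: `(g x)(v) = x(g⁻¹ v)`. -/
def dualMove (g : V ≃ₗ[ℂ] V) : Module.Dual ℂ V →ₗ[ℂ] Module.Dual ℂ V :=
  (g.symm : V →ₗ[ℂ] V).dualMap

theorem dualMove_apply (g : V ≃ₗ[ℂ] V) (x : Module.Dual ℂ V) (v : V) :
    dualMove g x v = x (g.symm v) := rfl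

/-- The action on `ℂ[V]`. -/
def polyMove (g : V ≃ₗ[ℂ] V) : Poly V →ₐ[ℂ] Poly V :=
  SymmetricAlgebra.lift (SymmetricAlgebra.ι ℂ _ ∘ₗ dualMove g)

theorem polyMove_ι (g : V ≃ₗ[ℂ] V) (x : Module.Dual ℂ V) :
    polyMove g (SymmetricAlgebra.ι ℂ _ x) = SymmetricAlgebra.ι ℂ _ (dualMove g x) :=
  SymmetricAlgebra.lift_ι_apply _ _

namespace Data

variable (P : Data W)

/-- `a_H = ∑_j m_H k_{H,j} ε_{H,j}`. -/
def a [Finite W] (H : Arrangement W) : MonoidAlgebra ℂ W :=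
  ∑ j ∈ Finset.range (ord H), ((ord H : ℂ) * P.k H j) • eps H j

/-- `γ_H = ∑_j m_H (k_{H,j+1} - k_{H,j}) ε_{H,j}`, the index `j` being read modulo `m_H`. -/
def γ [Finite W] (H : Arrangement W) : MonoidAlgebra ℂ W :=
  ∑ j ∈ Finset.range (ord H),
    ((ord H : ℂ) * (P.k H ((j + 1) % ord H) - P.k H j)) • eps H j

theorem exists_dualMove_α (w : W) (H : Arrangement W) :
    ∃ c : ℂ, c ≠ 0 ∧ dualMove (w : V ≃ₗ[ℂ] V) (P.α H) = c • P.α (H.move w) := by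
  set H' := H.move w with hH'
  set x := dualMove (w : V ≃ₗ[ℂ] V) (P.α H) with hx
  have hker : LinearMap.ker x = H'.hyperplane := by
    ext u
    rw [LinearMap.mem_ker, hx, dualMove_apply, ← LinearMap.mem_ker, P.ker_α]
    exact (Submodule.mem_map_equiv H.hyperplane (e := (w : V ≃ₗ[ℂ] V)) (x := u)).symm
  have hv : P.v H' ∉ H'.hyperplane := fun hmem => by
    have h1 : Submodule.span ℂ {P.v H'} ≤ H'.hyperplane := by
      rwa [Submodule.span_singleton_le_iff_mem]
    have h2 := (P.isCompl_v H').codisjoint.eq_top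
    rw [sup_eq_right.2 h1] at h2
    exact H'.isCoatom.1 h2
  have hα : P.α H' (P.v H') ≠ 0 := fun h0 => hv (by rw [← P.ker_α]; exact h0)
  have hxv : x (P.v H') ≠ 0 := fun h0 => hv (by rw [← hker]; exact h0)
  refine ⟨x (P.v H') / P.α H' (P.v H'), div_ne_zero hxv hα, ?_⟩
  rw [← sub_eq_zero, ← LinearMap.ker_eq_top, eq_top_iff,
    ← (P.isCompl_v H').codisjoint.eq_top, sup_le_iff, Submodule.span_singleton_le_iff_mem]
  refine ⟨?_, fun u hu => ?_⟩
  · simp [hα]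
  · have h1 : x u = 0 := by rw [← LinearMap.mem_ker, hker]; exact hu
    have h2 : P.α H' u = 0 := by rw [← LinearMap.mem_ker, P.ker_α]; exact hu
    simp [h1, h2]

variable [Finite W]

/-- `δ = ∏_H α_H`. -/
def δ : Poly V := ∏ H : Arrangement W, SymmetricAlgebra.ι ℂ _ (P.α H)

/-- The algebra `ℂ[X] = ℂ[V][1/δ]` of regular functions on the complement `X` of the
arrangement. -/
def RegFun : Type _ := Localization.Away P.δ

instance : CommRing P.RegFun := inferInstanceAs (CommRing (Localization.Away P.δ))

instance : Algebra (Poly V) P.RegFun := inferInstanceAs (Algebra (Poly V) (Localization.Away P.δ))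

instance : Algebra ℂ P.RegFun := inferInstanceAs (Algebra ℂ (Localization.Away P.δ))

instance : IsScalarTower ℂ (Poly V) P.RegFun :=
  inferInstanceAs (IsScalarTower ℂ (Poly V) (Localization.Away P.δ))

instance : IsLocalization.Away P.δ P.RegFun :=
  inferInstanceAs (IsLocalization.Away P.δ (Localization.Away P.δ))

/-- A linear form, as a regular function on `X`. -/
def lin : Module.Dual ℂ V →ₗ[ℂ] P.RegFun :=
  (IsScalarTower.toAlgHom ℂ (Poly V) P.RegFun).toLinearMap ∘ₗ SymmetricAlgebra.ι ℂ _

theorem isUnit_lin_α (H : Arrangement W) : IsUnit (P.lin (P.α H)) := by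
  have h : IsUnit (algebraMap (Poly V) P.RegFun P.δ) :=
    IsLocalization.Away.algebraMap_isUnit P.δ
  refine isUnit_of_dvd_unit ?_ h
  exact map_dvd (algebraMap (Poly V) P.RegFun) (Finset.dvd_prod_of_mem _ (Finset.mem_univ H))

theorem isUnit_move_δ (w : W) :
    IsUnit (algebraMap (Poly V) P.RegFun (polyMove (w : V ≃ₗ[ℂ] V) P.δ)) := by
  have h0 : polyMove (w : V ≃ₗ[ℂ] V) P.δ =
      ∏ H : Arrangement W, SymmetricAlgebra.ι ℂ _ (dualMove (w : V ≃ₗ[ℂ] V) (P.α H)) := by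
    rw [δ, map_prod]
    exact Finset.prod_congr rfl fun H _ => polyMove_ι _ _
  rw [h0, map_prod]
  refine IsUnit.prod_univ_iff.2 fun H => ?_
  obtain ⟨c, hc, h⟩ := P.exists_dualMove_α w H
  rw [h]
  have h2 : algebraMap (Poly V) P.RegFun (SymmetricAlgebra.ι ℂ _ (c • P.α (H.move w))) =
      c • P.lin (P.α (H.move w)) := (P.lin).map_smul c _
  rw [h2]
  exact (isUnit_smul_iff (Units.mk0 c hc) (P.lin (P.α (H.move w)))).2 (P.isUnit_lin_α _)

/-- The action of `w` on `ℂ[X]`. -/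
def regMove (w : W) : P.RegFun →ₐ[ℂ] P.RegFun :=
  IsLocalization.liftAlgHom (M := Submonoid.powers P.δ)
    (f := (IsScalarTower.toAlgHom ℂ (Poly V) P.RegFun).comp (polyMove (w : V ≃ₗ[ℂ] V))) (by
      rintro ⟨_, n, rfl⟩
      rw [map_pow]
      exact (P.isUnit_move_δ w).pow n)

theorem regMove_algebraMap (w : W) (f : Poly V) :
    P.regMove w (algebraMap (Poly V) P.RegFun f) =
      algebraMap (Poly V) P.RegFun (polyMove (w : V ≃ₗ[ℂ] V) f) :=
  IsLocalization.lift_eq _ _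

theorem regHom_ext {f g : P.RegFun →ₐ[ℂ] P.RegFun} (h : ∀ x, f (P.lin x) = g (P.lin x)) :
    f = g := by
  have h1 : f.comp (IsScalarTower.toAlgHom ℂ (Poly V) P.RegFun) =
      g.comp (IsScalarTower.toAlgHom ℂ (Poly V) P.RegFun) :=
    SymmetricAlgebra.algHom_ext (LinearMap.ext h)
  have h2 : (f : P.RegFun →+* P.RegFun) = g :=
    IsLocalization.ringHom_ext (Submonoid.powers P.δ) (RingHom.ext fun p => DFunLike.congr_fun h1 p)
  exact AlgHom.ext fun p => DFunLike.congr_fun h2 p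

theorem regMove_lin (w : W) (x : Module.Dual ℂ V) :
    P.regMove w (P.lin x) = P.lin (dualMove (w : V ≃ₗ[ℂ] V) x) :=
  (P.regMove_algebraMap w _).trans (congrArg _ (polyMove_ι _ x))

/-- The action of `W` on `ℂ[X]` by algebra automorphisms. -/
def regAut : W →* (P.RegFun ≃ₐ[ℂ] P.RegFun) :=
  (AlgEquiv.algHomUnitsEquiv ℂ P.RegFun).toMonoidHom.comp (MonoidHom.toHomUnits
    { toFun := P.regMove
      map_one' := P.regHom_ext fun x => P.regMove_lin 1 x
      map_mul' := fun w w' => P.regHom_ext fun x => by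
        rw [AlgHom.mul_apply, regMove_lin, regMove_lin, regMove_lin]
        rfl })

theorem regAut_apply (w : W) (f : P.RegFun) : P.regAut w f = P.regMove w f := rfl

/-- The map `x ↦ x + ε x(y)` from `ℂ[V]` to the dual numbers over `ℂ[X]`. -/
def taylorPoly (y : V) : Poly V →ₐ[ℂ] TrivSqZeroExt P.RegFun P.RegFun :=
  SymmetricAlgebra.lift
    ((TrivSqZeroExt.inlAlgHom ℂ P.RegFun P.RegFun).toLinearMap ∘ₗ P.lin +
      (TrivSqZeroExt.inrHom P.RegFun P.RegFun).restrictScalars ℂ ∘ₗ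
        Algebra.linearMap ℂ P.RegFun ∘ₗ Module.Dual.eval ℂ V y)

theorem fst_taylorPoly (y : V) (f : Poly V) :
    (P.taylorPoly y f).fst = algebraMap (Poly V) P.RegFun f := by
  have h : (TrivSqZeroExt.fstHom ℂ P.RegFun P.RegFun).comp (P.taylorPoly y) =
      IsScalarTower.toAlgHom ℂ (Poly V) P.RegFun := by
    refine SymmetricAlgebra.algHom_ext (LinearMap.ext fun x => ?_)
    simp [taylorPoly, lin]
  exact DFunLike.congr_fun h f

/-- The map `f ↦ f + ε ∂_y f` from `ℂ[X]` to the dual numbers over `ℂ[X]`, extending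
`x ↦ x + ε x(y)`. -/
def taylor (y : V) : P.RegFun →ₐ[ℂ] TrivSqZeroExt P.RegFun P.RegFun :=
  IsLocalization.liftAlgHom (M := Submonoid.powers P.δ) (f := P.taylorPoly y) (by
    rintro ⟨_, n, rfl⟩
    rw [map_pow]
    refine IsUnit.pow n (TrivSqZeroExt.isUnit_iff_isUnit_fst.2 ?_)
    rw [fst_taylorPoly]
    exact IsLocalization.Away.algebraMap_isUnit P.δ)

theorem taylor_algebraMap (y : V) (f : Poly V) :
    P.taylor y (algebraMap (Poly V) P.RegFun f) = P.taylorPoly y f :=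
  IsLocalization.lift_eq _ _

theorem fst_taylor (y : V) (f : P.RegFun) : (P.taylor y f).fst = f := by
  have h : (TrivSqZeroExt.fstHom ℂ P.RegFun P.RegFun).comp (P.taylor y) = AlgHom.id ℂ _ :=
    P.regHom_ext fun x => by
      change (P.taylor y (algebraMap (Poly V) P.RegFun _)).fst = _
      rw [taylor_algebraMap, fst_taylorPoly]
      rfl
  exact DFunLike.congr_fun h f

/-- The derivative `∂_y` on `ℂ[X]`. -/
def deriv (y : V) : Module.End ℂ P.RegFun :=
  (TrivSqZeroExt.sndHom P.RegFun P.RegFun).restrictScalars ℂ ∘ₗ (P.taylor y).toLinearMap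

theorem deriv_lin (y : V) (x : Module.Dual ℂ V) :
    P.deriv y (P.lin x) = algebraMap ℂ P.RegFun (x y) := by
  change (P.taylor y (algebraMap (Poly V) P.RegFun _)).snd = _
  rw [taylor_algebraMap]
  simp [taylorPoly, Algebra.algebraMap_eq_smul_one]

theorem deriv_mul (y : V) (f g : P.RegFun) :
    P.deriv y (f * g) = f * P.deriv y g + P.deriv y f * g := by
  change (P.taylor y (f * g)).snd = f * (P.taylor y g).snd + (P.taylor y f).snd * g
  rw [map_mul, TrivSqZeroExt.snd_mul, fst_taylor, fst_taylor]
  simp [mul_comm]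

/-- The algebra `𝒟(X)` of differential operators on `X`. -/
abbrev DX : Type _ := DiffOp ℂ P.RegFun

/-- `∂_y` as an element of `𝒟(X)`. -/
def partialD (y : V) : P.DX := ⟨P.deriv y, 1, isDiffOp_one_of_leibniz _ (P.deriv_mul y)⟩

/-- The coefficient algebra `𝒟(X) ⊗ ℂ𝓛`. -/
abbrev Coeff : Type _ := P.DX ⊗[ℂ] MobiusAlgebra W

/-- The diagonal action of `W` on `𝒟(X) ⊗ ℂ𝓛`. -/
def coeffAut : W →* (P.Coeff ≃ₐ[ℂ] P.Coeff) :=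
  tensorAut (DiffOp.conjAut.comp P.regAut) mobiusAut

instance : MulSemiringAction W P.Coeff := MulSemiringAction.compHom _ P.coeffAut

instance : SMulCommClass W ℂ P.Coeff := ⟨fun w c t => map_smul (P.coeffAut w) c t⟩

/-- The crossed product `(𝒟(X) ⊗ ℂ𝓛) ⋊ W`. -/
abbrev Crossed : Type _ := SkewMonoidAlgebra P.Coeff W

/-- `𝒟(X) → (𝒟(X) ⊗ ℂ𝓛) ⋊ W`. -/
def ofDX (D : P.DX) : P.Crossed := SkewMonoidAlgebra.single 1 (D ⊗ₜ[ℂ] 1)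

/-- The element `e_b` of the crossed product, for `b` in the lattice `𝓛`. -/
def ofLattice (b : FullReflectionSubgroup W) : P.Crossed :=
  SkewMonoidAlgebra.single 1 (1 ⊗ₜ[ℂ] MonoidAlgebra.single b 1)

/-- The element `w` of the crossed product. -/
def ofGroup : W →* P.Crossed := SkewMonoidAlgebra.of P.Coeff W

/-- A linear form `x`, as an element of the crossed product. -/
def ofLin (x : Module.Dual ℂ V) : P.Crossed := P.ofDX (DiffOp.ofFun ℂ P.RegFun (P.lin x))

/-- The regular function `α_H(y) / α_H` on `X`. -/
def quot (y : V) (H : Arrangement W) : P.RegFun :=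
  P.α H y • ((P.isUnit_lin_α H).unit⁻¹ : P.RegFunˣ)

/-- The Dunkl operator `T_y = ∂_y + ∑_H (α_H(y) / α_H) a_H e_H`. -/
def dunkl (y : V) : P.Crossed :=
  P.ofDX (P.partialD y) + ∑ H : Arrangement W,
    P.ofDX (DiffOp.ofFun ℂ P.RegFun (P.quot y H)) *
      MonoidAlgebra.lift ℂ P.Crossed W P.ofGroup (P.a H) * P.ofLattice (parabolic H)

end Data

end Data

section CherednikAlgebra

variable {V : Type*} [AddCommGroup V] [Module ℂ V] {W : Subgroup (V ≃ₗ[ℂ] V)}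

/-- The generators of the Cherednik algebra: `V*`, `V`, the lattice `𝓛` and the group `W`. -/
inductive Gen (W : Subgroup (V ≃ₗ[ℂ] V)) : Type _
  | x (x : Module.Dual ℂ V)
  | y (y : V)
  | e (b : FullReflectionSubgroup W)
  | w (w : W)

/-- A generator, in the free algebra. -/
abbrev gen (g : Gen W) : FreeAlgebra ℂ (Gen W) := FreeAlgebra.ι ℂ g

/-- The lift to the free algebra of an element of `ℂW`. -/
def groupLift (u : MonoidAlgebra ℂ W) : FreeAlgebra ℂ (Gen W) :=
  u.coeff.sum fun w c => c • gen (.w w)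

/-- The relations of the Cherednik algebra of `(𝓛, W)`: those of `ℂ[V]`, `ℂ[V*]`, of
`ℂ𝓛 ⋊ W`, the relations by which `W` acts on `V*` and `V`, the commutation of `𝓛` with
`V*` and `V`, and the formula for `[y, x]`. -/
inductive Rel [Finite W] (P : Data W) : FreeAlgebra ℂ (Gen W) → FreeAlgebra ℂ (Gen W) → Prop
  | x_add (x x') : Rel P (gen (.x (x + x'))) (gen (.x x) + gen (.x x'))
  | x_smul (c : ℂ) (x) : Rel P (gen (.x (c • x))) (c • gen (.x x))
  | x_comm (x x') : Rel P (gen (.x x) * gen (.x x')) (gen (.x x') * gen (.x x))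
  | y_add (y y') : Rel P (gen (.y (y + y'))) (gen (.y y) + gen (.y y'))
  | y_smul (c : ℂ) (y) : Rel P (gen (.y (c • y))) (c • gen (.y y))
  | y_comm (y y') : Rel P (gen (.y y) * gen (.y y')) (gen (.y y') * gen (.y y))
  | e_bot : Rel P (gen (.e ⊥)) 1
  | e_mul (b b') : Rel P (gen (.e b) * gen (.e b')) (gen (.e (b ⊔ b')))
  | w_one : Rel P (gen (.w 1)) 1
  | w_mul (w w') : Rel P (gen (.w w) * gen (.w w')) (gen (.w (w * w')))
  | w_e (w : W) (b) : Rel P (gen (.w w) * gen (.e b)) (gen (.e (b.conj w)) * gen (.w w))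
  | w_x (w : W) (x) :
      Rel P (gen (.w w) * gen (.x x)) (gen (.x (dualMove (w : V ≃ₗ[ℂ] V) x)) * gen (.w w))
  | w_y (w : W) (y) : Rel P (gen (.w w) * gen (.y y)) (gen (.y ((w : V ≃ₗ[ℂ] V) y)) * gen (.w w))
  | e_x (b x) : Rel P (gen (.e b) * gen (.x x)) (gen (.x x) * gen (.e b))
  | e_y (b y) : Rel P (gen (.e b) * gen (.y y)) (gen (.y y) * gen (.e b))
  | y_x (y : V) (x : Module.Dual ℂ V) :
      Rel P (gen (.y y) * gen (.x x) - gen (.x x) * gen (.y y))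
        (algebraMap ℂ _ (x y) + ∑ H : Arrangement W,
          (P.α H y * x (P.v H) / P.α H (P.v H)) • (groupLift (P.γ H) * gen (.e (parabolic H))))

variable [Finite W]

/-- The Cherednik algebra `A(𝓛, W)` (with `t = 1`). -/
def Cherednik (P : Data W) : Type _ := RingQuot (Rel P)

namespace Cherednik

variable (P : Data W)

instance : Ring (Cherednik P) := inferInstanceAs (Ring (RingQuot (Rel P)))

instance : Algebra ℂ (Cherednik P) := inferInstanceAs (Algebra ℂ (RingQuot (Rel P)))

/-- The quotient map from the free algebra. -/
def mk : FreeAlgebra ℂ (Gen W) →ₐ[ℂ] Cherednik P := RingQuot.mkAlgHom ℂ (Rel P)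

theorem mk_rel {a b : FreeAlgebra ℂ (Gen W)} (h : Rel P a b) : mk P a = mk P b :=
  RingQuot.mkAlgHom_rel ℂ h

/-- The generators `x ∈ V*`. -/
def x : Module.Dual ℂ V →ₗ[ℂ] Cherednik P where
  toFun x := mk P (gen (.x x))
  map_add' x x' := by rw [mk_rel P (Rel.x_add x x'), map_add]
  map_smul' c x := by rw [mk_rel P (Rel.x_smul c x), map_smul, RingHom.id_apply]

/-- The generators `y ∈ V`. -/
def y : V →ₗ[ℂ] Cherednik P where
  toFun y := mk P (gen (.y y))
  map_add' y y' := by rw [mk_rel P (Rel.y_add y y'), map_add]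
  map_smul' c y := by rw [mk_rel P (Rel.y_smul c y), map_smul, RingHom.id_apply]

/-- The generators `e_b`, `b ∈ 𝓛`. -/
def e (b : FullReflectionSubgroup W) : Cherednik P := mk P (gen (.e b))

/-- The generators `w ∈ W`. -/
def w (w : W) : Cherednik P := mk P (gen (.w w))

theorem x_comm (a b : Module.Dual ℂ V) : x P a * x P b = x P b * x P a :=
  (map_mul (mk P) _ _).symm.trans ((mk_rel P (Rel.x_comm a b)).trans (map_mul (mk P) _ _))

theorem y_comm (a b : V) : y P a * y P b = y P b * y P a :=
  (map_mul (mk P) _ _).symm.trans ((mk_rel P (Rel.y_comm a b)).trans (map_mul (mk P) _ _))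

/-- The morphism `ℂ[V] → A(𝓛, W)`. -/
def ofPoly : Poly V →ₐ[ℂ] Cherednik P := symLift (x P) (x_comm P)

/-- The morphism `ℂ[V*] → A(𝓛, W)`. -/
def ofPolyDual : SymmetricAlgebra ℂ V →ₐ[ℂ] Cherednik P := symLift (y P) (y_comm P)

/-- The morphism `ℂ𝓛 → A(𝓛, W)`. -/
def ofMobius : MobiusAlgebra W →ₐ[ℂ] Cherednik P :=
  MonoidAlgebra.lift ℂ (Cherednik P) (FullReflectionSubgroup W)
    { toFun := e P
      map_one' := (mk_rel P Rel.e_bot).trans (map_one _)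
      map_mul' := fun b b' => (mk_rel P (Rel.e_mul b b')).symm.trans (map_mul (mk P) _ _) }

/-- The morphism `ℂW → A(𝓛, W)`. -/
def ofGroupAlgebra : MonoidAlgebra ℂ W →ₐ[ℂ] Cherednik P :=
  MonoidAlgebra.lift ℂ (Cherednik P) W
    { toFun := w P
      map_one' := (mk_rel P Rel.w_one).trans (map_one _)
      map_mul' := fun b b' => (mk_rel P (Rel.w_mul b b')).symm.trans (map_mul (mk P) _ _) }

/-- The multiplication map `ℂ[V] ⊗ ℂ𝓛 ⊗ ℂW ⊗ ℂ[V*] → A(𝓛, W)`. -/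
def triangular : Poly V ⊗[ℂ] (MobiusAlgebra W ⊗[ℂ] (MonoidAlgebra ℂ W ⊗[ℂ] SymmetricAlgebra ℂ V))
    →ₗ[ℂ] Cherednik P :=
  LinearMap.mul' ℂ _ ∘ₗ TensorProduct.map (ofPoly P).toLinearMap
    (LinearMap.mul' ℂ _ ∘ₗ TensorProduct.map (ofMobius P).toLinearMap
      (LinearMap.mul' ℂ _ ∘ₗ TensorProduct.map (ofGroupAlgebra P).toLinearMap
        (ofPolyDual P).toLinearMap))

instance : Module (Poly V) (Cherednik P) := Module.compHom _ (ofPoly P).toRingHom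

theorem poly_smul_def (p : Poly V) (a : Cherednik P) : p • a = ofPoly P p * a := rfl

end Cherednik

end CherednikAlgebra

section Localization

variable (A : Type*) [Ring A] [Algebra ℂ A] (d : A)

/-- The relations of the algebra obtained from `A` by adjoining an inverse (`none`) of `d`. -/
inductive InvRel : FreeAlgebra ℂ (Option A) → FreeAlgebra ℂ (Option A) → Prop
  | add (a b : A) : InvRel (FreeAlgebra.ι ℂ (some (a + b)))
      (FreeAlgebra.ι ℂ (some a) + FreeAlgebra.ι ℂ (some b))
  | mul (a b : A) : InvRel (FreeAlgebra.ι ℂ (some (a * b)))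
      (FreeAlgebra.ι ℂ (some a) * FreeAlgebra.ι ℂ (some b))
  | algebraMap (c : ℂ) : InvRel (FreeAlgebra.ι ℂ (some (algebraMap ℂ A c))) (algebraMap ℂ _ c)
  | mul_inv : InvRel (FreeAlgebra.ι ℂ (some d) * FreeAlgebra.ι ℂ none) 1
  | inv_mul : InvRel (FreeAlgebra.ι ℂ none * FreeAlgebra.ι ℂ (some d)) 1

/-- The (universal) localization `A[d⁻¹]` of the possibly noncommutative algebra `A`. -/
def AdjoinInv : Type _ := RingQuot (InvRel A d)

instance : Ring (AdjoinInv A d) := inferInstanceAs (Ring (RingQuot (InvRel A d)))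

instance : Algebra ℂ (AdjoinInv A d) := inferInstanceAs (Algebra ℂ (RingQuot (InvRel A d)))

/-- The localization morphism `A → A[d⁻¹]`. -/
def AdjoinInv.of : A →ₐ[ℂ] AdjoinInv A d where
  toFun a := RingQuot.mkAlgHom ℂ (InvRel A d) (FreeAlgebra.ι ℂ (some a))
  map_one' := by
    have h := RingQuot.mkAlgHom_rel ℂ (InvRel.algebraMap (A := A) (d := d) 1)
    rw [map_one, map_one, map_one] at h
    exact h
  map_mul' a b :=
    (RingQuot.mkAlgHom_rel ℂ (InvRel.mul (d := d) a b)).trans (map_mul _ _ _)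
  map_zero' := by
    have h := RingQuot.mkAlgHom_rel ℂ (InvRel.algebraMap (A := A) (d := d) 0)
    rw [map_zero, map_zero, map_zero] at h
    exact h
  map_add' a b :=
    (RingQuot.mkAlgHom_rel ℂ (InvRel.add (d := d) a b)).trans (map_add _ _ _)
  commutes' c :=
    (RingQuot.mkAlgHom_rel ℂ (InvRel.algebraMap (d := d) c)).trans (AlgHom.commutes _ _)

end Localization

section Reg

variable {V : Type*} [AddCommGroup V] [Module ℂ V] {W : Subgroup (V ≃ₗ[ℂ] V)} [Finite W]
  (P : Data W)

/-- The localization `A(𝓛, W)_reg` of the Cherednik algebra at the powers of `δ`. -/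
abbrev CherednikReg : Type _ := AdjoinInv (Cherednik P) (Cherednik.ofPoly P P.δ)

/-- The localization morphism `A(𝓛, W) → A(𝓛, W)_reg`. -/
def CherednikReg.loc : Cherednik P →ₐ[ℂ] CherednikReg P := AdjoinInv.of _ _

instance : Module (Poly V) (CherednikReg P) :=
  Module.compHom _ ((CherednikReg.loc P).comp (Cherednik.ofPoly P)).toRingHom

/-- The localization morphism, as a morphism of `ℂ[V]`-modules. -/
def CherednikReg.locLin : Cherednik P →ₗ[Poly V] CherednikReg P where
  toFun := CherednikReg.loc P
  map_add' := map_add _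
  map_smul' _ a := map_mul (CherednikReg.loc P) _ a

end Reg

end LatticeCherednik

end

/-! The Dunkl operators satisfy the relations of `A(𝓛, W)`, and modulo operators of lower order they
are the plain derivatives. The first fact gives Φ; the second yields both its injectivity and the
PBW isomorphism; inverting δ then brings back the derivatives themselves.

Relations. For w ∈ W_H one has w(α_H) = det(w)⁻¹ α_H, so ε_{H,j+1} α_H = α_H ε_{H,j}: moving x
across a_H shifts the parameters and produces γ_H, which is the formula for [y, x] (`dk_mul_lin`).
The factor e_H makes T_y commute with every e_λ, because W_H normalizes λ ∨ W_H
(`lat_mul_localSpan`). That T_y and T_y' commute (`dk_comm`) needs no rank two computation. The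
double commutator [T_y, [T_y', x]] is symmetric in y and y' (`dk_bracket_symm`), so [T_y, T_y']
commutes with V*. A nonzero differential operator on a domain cannot intertwine two different
functions, hence [T_y, T_y'] has no component at w ≠ 1 (`coef_eq_zero_of_commute`). The component at
1 vanishes by direct computation (`coef_one_commutator_dk`), since W_H ∩ W_H' = 1 for H ≠ H'.

PBW. Ordered products span, because [y, p] involves no y when p ∈ ℂ[V] (`multipliers_eq_top`).
Independence is tested after applying Φ. There T^α and ∂^α differ by terms of order less than |α|
(`dunklPoly_monomial`), and the top coefficients of ∑ f_α ∂^α are detected by commutators with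
coordinates (`coeff_eq_zero_of_orderLT`). So Φ composed with the multiplication map is injective; as
the multiplication map is surjective, it is bijective and Φ is injective.

Localization. The powers of δ satisfy an Ore condition (`exists_δ_pow_mul`), so every element of the
universal localization is a left fraction; this identifies it with the localized module and keeps
the extension of Φ injective. It is surjective because functions and derivatives generate 𝒟(X)
(`DX_subalgebra_eq_top`) and T_y − ∂_y has coefficients in ℂ[X]. -/

noncomputable section
namespace LatticeCherednik

/-! ### Generation of algebras with locally nilpotent commutators -/

section GeneralAlgebra

/-- If `[d, x] = 1`, an element killed by a power of `[·, x]` is a polynomial in `d`, with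
coefficients that commute with `x`. -/
theorem mem_span_mul_pow_of_iterate {A : Type*} [Ring A] [Algebra ℂ A] (C : Subalgebra ℂ A)
    {x d : A} (hx : x ∈ C) (hd : d ∈ C) (h : d * x - x * d = 1) (N : ℕ) :
    ∀ P ∈ C, (fun Q => Q * x - x * Q)^[N] P = 0 →
      P ∈ Submodule.span ℂ {R | ∃ q ∈ C, q * x = x * q ∧ ∃ n : ℕ, R = q * d ^ n} := by
  have hpow : ∀ n : ℕ, d ^ (n + 1) * x - x * d ^ (n + 1) = ((n : ℂ) + 1) • d ^ n := by
    intro n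
    induction n with
    | zero => simp [h]
    | succ n ih =>
      have e : d ^ (n + 1 + 1) * x - x * d ^ (n + 1 + 1) =
          (d ^ (n + 1) * x - x * d ^ (n + 1)) * d + d ^ (n + 1) * (d * x - x * d) := by
        rw [pow_succ d (n + 1)]
        noncomm_ring
      rw [e, ih, h, smul_mul_assoc, ← pow_succ, mul_one]
      push_cast
      module
  set S := Submodule.span ℂ {R | ∃ q ∈ C, q * x = x * q ∧ ∃ n : ℕ, R = q * d ^ n}
  have hSC : ∀ P ∈ S, P ∈ C := fun P hP => by
    have : S ≤ Subalgebra.toSubmodule C := Submodule.span_le.2 (by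
      rintro _ ⟨q, hq, -, n, rfl⟩
      exact C.mul_mem hq (C.pow_mem hd n))
    exact this hP
  -- The commutator with x acts as differentiation in d, so it can be integrated term by term: q
  -- dⁿ⁺¹/(n+1) is an antiderivative of q dⁿ.
  have hint : ∀ P ∈ S, ∃ Q ∈ S, Q * x - x * Q = P := by
    intro P hP
    induction hP using Submodule.span_induction with
    | mem P hP =>
      obtain ⟨q, hq, hqx, n, rfl⟩ := hP
      refine ⟨((n : ℂ) + 1)⁻¹ • (q * d ^ (n + 1)),
        S.smul_mem _ (Submodule.subset_span ⟨q, hq, hqx, n + 1, rfl⟩), ?_⟩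
      rw [smul_mul_assoc, mul_smul_comm, ← smul_sub, mul_assoc, ← mul_assoc x, ← hqx, mul_assoc,
        ← mul_sub, hpow, mul_smul_comm, inv_smul_smul₀ (Nat.cast_add_one_ne_zero n)]
    | zero => exact ⟨0, S.zero_mem, by simp⟩
    | add P P' _ _ h h' =>
      obtain ⟨Q, hQ, rfl⟩ := h
      obtain ⟨Q', hQ', rfl⟩ := h'
      exact ⟨Q + Q', S.add_mem hQ hQ', by noncomm_ring⟩
    | smul c P _ h =>
      obtain ⟨Q, hQ, rfl⟩ := h
      exact ⟨c • Q, S.smul_mem c hQ, by rw [smul_mul_assoc, mul_smul_comm, smul_sub]⟩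
  induction N with
  | zero => intro P _ hP; exact (show P = 0 from hP) ▸ S.zero_mem
  | succ N ih =>
    intro P hPC hP
    obtain ⟨Q, hQ, hQP⟩ := hint _
      (ih (P * x - x * P) (C.sub_mem (C.mul_mem hPC hx) (C.mul_mem hx hPC)) hP)
    -- Q is an antiderivative of [P, x], so P − Q commutes with x and is a term with exponent 0.
    have h1 : P - Q ∈ S := Submodule.subset_span ⟨P - Q, C.sub_mem hPC (hSC Q hQ), by
      rw [← sub_eq_zero] at hQP ⊢
      rw [← neg_eq_zero, ← hQP]
      noncomm_ring, 0, by simp⟩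
    simpa using S.add_mem h1 hQ

/-- An algebra on which all `[·, x_i]` are locally nilpotent is generated by the `d_i`, if
`[d_i, x_j] = δ_ij`, and the common centralizer of the `x_i`. -/
theorem subalgebra_eq_top_of_commutators {A ι : Type*} [Ring A] [Algebra ℂ A] [Finite ι]
    (x d : ι → A) (hxx : ∀ i j, x i * x j = x j * x i) (hd : ∀ i, d i * x i - x i * d i = 1)
    (hdx : ∀ i j, i ≠ j → d i * x j = x j * d i)
    (hnil : ∀ i P, ∃ N : ℕ, (fun Q => Q * x i - x i * Q)^[N] P = 0)
    (S : Subalgebra ℂ A) (hS : ∀ P, (∀ i, P * x i = x i * P) → P ∈ S) (hSd : ∀ i, d i ∈ S) :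
    S = ⊤ := by
  classical
  have := Fintype.ofFinite ι
  -- J holds the indices whose x_i may fail to commute with P. To remove i from J, expand P in
  -- powers of d_i and pass to the coefficients.
  have key : ∀ J : Finset ι, ∀ P, (∀ i ∉ J, P * x i = x i * P) → P ∈ S := by
    intro J
    induction J using Finset.induction_on with
    | empty => intro P hP; exact hS P fun i => hP i (Finset.notMem_empty i)
    | insert i J hi ih =>
      intro P hP
      -- Expanding inside this centralizer keeps the coefficients commuting with the x_j already
      -- dealt with.
      let C : Subalgebra ℂ A := Subalgebra.centralizer ℂ {z | ∃ j ∉ insert i J, z = x j}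
      have hC : ∀ Q, Q ∈ C ↔ ∀ j ∉ insert i J, Q * x j = x j * Q := fun Q => by
        simp only [C, Subalgebra.mem_centralizer_iff]
        exact ⟨fun h j hj => (h _ ⟨j, hj, rfl⟩).symm, by
          rintro h _ ⟨j, hj, rfl⟩
          exact (h j hj).symm⟩
      obtain ⟨N, hN⟩ := hnil i P
      have h := mem_span_mul_pow_of_iterate C (x := x i) (d := d i)
        ((hC _).2 fun j _ => hxx i j)
        ((hC _).2 fun j hj => hdx i j fun hij => hj (hij ▸ Finset.mem_insert_self i J))
        (hd i) N P ((hC P).2 hP) hN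
      refine (Submodule.span_le (p := Subalgebra.toSubmodule S)).2 ?_ h
      rintro _ ⟨q, hq, hqi, n, rfl⟩
      refine S.mul_mem (ih q fun j hj => ?_) (S.pow_mem (hSd i) n)
      by_cases hji : j = i
      · exact hji ▸ hqi
      · exact (hC q).1 hq j (by simp [hji, hj])
  exact eq_top_iff.2 fun P _ => key Finset.univ P fun i hi => (hi (Finset.mem_univ i)).elim

end GeneralAlgebra

/-! ### Differential operators on a commutative algebra -/

section DiffOp

variable {k R : Type*} [CommRing k] [CommRing R] [Algebra k R]

theorem IsDiffOp.eq_mulOp {P : Module.End k R} (hP : IsDiffOp 0 P) : P = mulOp k R (P 1) := by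
  ext f
  have h := LinearMap.congr_fun (hP f) 1
  simp only [LinearMap.sub_apply, Module.End.mul_apply, LinearMap.zero_apply, sub_eq_zero] at h
  simpa [mul_comm] using h

/-- The commutators [P, f] intertwine the same two functions and have lower order, so they vanish by
induction. Then P is multiplication by a function h with h x = h g, and R is a domain. -/
theorem IsDiffOp.eq_zero_of_intertwining [IsDomain R] {x g : R} (hxg : x ≠ g) {n : ℕ} :
    ∀ {P : Module.End k R}, IsDiffOp n P → mulOp k R x * P = P * mulOp k R g → P = 0 := by
  have base : ∀ {P : Module.End k R}, IsDiffOp 0 P → mulOp k R x * P = P * mulOp k R g →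
      P = 0 := by
    intro P hP h
    rw [hP.eq_mulOp] at h ⊢
    have h1 := LinearMap.congr_fun h 1
    simp only [Module.End.mul_apply, Algebra.coe_lmul_eq_mul, LinearMap.mul_apply', mul_one] at h1
    rw [mul_comm] at h1
    have h2 : P 1 = 0 := by
      by_contra h0
      exact hxg (mul_left_cancel₀ h0 h1)
    rw [h2, map_zero]
  induction n with
  | zero => exact base
  | succ n ih =>
    intro P hP h
    refine base (fun f => ih (hP f) ?_) h
    have e1 : mulOp k R x * mulOp k R f = mulOp k R f * mulOp k R x := by
      rw [← map_mul, ← map_mul, mul_comm]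
    have e2 : mulOp k R g * mulOp k R f = mulOp k R f * mulOp k R g := by
      rw [← map_mul, ← map_mul, mul_comm]
    rw [mul_sub, sub_mul, ← mul_assoc, h, mul_assoc, e2, ← mul_assoc, ← mul_assoc, e1, mul_assoc (mulOp k R f), h]
    simp only [mul_assoc]

theorem IsDiffOp.iterate_commutator_eq_zero (x : R) {n : ℕ} :
    ∀ {P : Module.End k R}, IsDiffOp n P →
      (fun Q => Q * mulOp k R x - mulOp k R x * Q)^[n + 1] P = 0 := by
  induction n with
  | zero => intro P hP; exact hP x
  | succ n ih => intro P hP; exact ih (hP x)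

theorem IsDiffOp.smul {n : ℕ} (c : k) {P : Module.End k R} (hP : IsDiffOp n P) :
    IsDiffOp n (c • P) := by
  have h := (isDiffOp_algebraMap (R := R) c).mul hP
  rwa [zero_add, ← Algebra.smul_def] at h

theorem DiffOp.coe_ofFun (f : R) : ((DiffOp.ofFun k R f : DiffOp k R) : Module.End k R) =
    mulOp k R f := rfl

theorem DiffOp.eq_ofFun {P : DiffOp k R}
    (h : ∀ f, P * DiffOp.ofFun k R f = DiffOp.ofFun k R f * P) :
    P = DiffOp.ofFun k R ((P : Module.End k R) 1) := by
  refine Subtype.ext (IsDiffOp.eq_mulOp fun f => sub_eq_zero.2 ?_)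
  exact congrArg Subtype.val (h f)

theorem DiffOp.conj_ofFun (φ : R ≃ₐ[k] R) (f : R) :
    DiffOp.conj φ (DiffOp.ofFun k R f) = DiffOp.ofFun k R (φ f) := by
  ext g
  rw [DiffOp.conj_apply]
  simp [DiffOp.coe_ofFun]

end DiffOp

/-! ### Functions, derivatives and generators of 𝒟(X) -/

namespace Data

variable {V : Type*} [AddCommGroup V] [Module ℂ V] {W : Subgroup (V ≃ₗ[ℂ] V)} [Finite W]
  (P : Data W)

theorem α_v_ne_zero (H : Arrangement W) : P.α H (P.v H) ≠ 0 := fun h0 => by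
  have hmem : P.v H ∈ H.hyperplane := by rw [← P.ker_α]; exact h0
  have h1 : Submodule.span ℂ {P.v H} ≤ H.hyperplane := by
    rwa [Submodule.span_singleton_le_iff_mem]
  have h2 := (P.isCompl_v H).codisjoint.eq_top
  rw [sup_eq_right.2 h1] at h2
  exact H.isCoatom.1 h2

/-- In a polynomial ring on a basis of M, the image of m is the linear form whose coefficients are
the coordinates of m. -/
theorem ι_injective {M : Type*} [AddCommGroup M] [Module ℂ M] :
    Function.Injective (SymmetricAlgebra.ι ℂ M) := by
  refine (injective_iff_map_eq_zero _).2 fun x hx => ?_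
  let b := Module.Free.chooseBasis ℂ M
  have h := congrArg (SymmetricAlgebra.equivMvPolynomial b) hx
  have h1 : ∀ m : M, SymmetricAlgebra.equivMvPolynomial b (SymmetricAlgebra.ι ℂ M m) =
      b.constr ℂ (MvPolynomial.X : _ → MvPolynomial _ ℂ) m :=
    fun m => SymmetricAlgebra.lift_ι_apply _ m
  rw [h1, map_zero, Module.Basis.constr_apply] at h
  refine b.repr.map_eq_zero_iff.1 (Finsupp.ext fun i => ?_)
  have h2 := congrArg (MvPolynomial.coeff (Finsupp.single i 1)) h
  classical
  simpa [Finsupp.sum, MvPolynomial.coeff_sum, MvPolynomial.coeff_X, Finsupp.single_left_inj,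
    MvPolynomial.coeff_smul] using h2

theorem δ_ne_zero : P.δ ≠ 0 := by
  refine Finset.prod_ne_zero_iff.2 fun H _ h => P.α_v_ne_zero H ?_
  rw [ι_injective (h.trans (map_zero _).symm), LinearMap.zero_apply]

theorem powers_le_nonZeroDivisors :
    Submonoid.powers P.δ ≤ nonZeroDivisors (Poly V) :=
  powers_le_nonZeroDivisors_of_noZeroDivisors P.δ_ne_zero

instance : IsDomain P.RegFun :=
  IsLocalization.isDomain_of_le_nonZeroDivisors _ P.powers_le_nonZeroDivisors

theorem algebraMap_injective : Function.Injective (algebraMap (Poly V) P.RegFun) :=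
  IsLocalization.injective _ P.powers_le_nonZeroDivisors

theorem lin_injective : Function.Injective P.lin :=
  P.algebraMap_injective.comp ι_injective

/-- The ring `𝒟(X)`. -/
def DiffRing : Type _ := P.DX

instance : Ring P.DiffRing := inferInstanceAs (Ring P.DX)

instance : Algebra ℂ P.DiffRing := inferInstanceAs (Algebra ℂ P.DX)

/-- The action of differential operators on functions. -/
def toEnd : P.DiffRing →ₐ[ℂ] Module.End ℂ P.RegFun := (DiffOp ℂ P.RegFun).val

theorem toEnd_injective : Function.Injective P.toEnd := Subtype.val_injective

/-- Functions, as differential operators on `X`. -/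
def fnD : P.RegFun →ₐ[ℂ] P.DiffRing := DiffOp.ofFun ℂ P.RegFun

theorem toEnd_fnD (f : P.RegFun) : P.toEnd (P.fnD f) = mulOp ℂ P.RegFun f := rfl

theorem isDiffOp_toEnd (D : P.DiffRing) : ∃ n, IsDiffOp n (P.toEnd D) := D.2

theorem fnD_comm (f g : P.RegFun) : P.fnD f * P.fnD g = P.fnD g * P.fnD f := by
  rw [← map_mul, ← map_mul, mul_comm]

/-- The derivative `∂_y`. -/
def pd (y : V) : P.DiffRing := P.partialD y

/-- The action of `W` on `𝒟(X)`. -/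
def conjD (w : W) : P.DiffRing →ₐ[ℂ] P.DiffRing := DiffOp.conj (P.regAut w)

/-- Linear forms generate ℂ[V], and an element that commutes with a power of δ commutes with its
inverse. -/
theorem commute_fnD {D : P.DiffRing} (h : ∀ x, D * P.fnD (P.lin x) = P.fnD (P.lin x) * D)
    (f : P.RegFun) : D * P.fnD f = P.fnD f * D := by
  have h1 : ∀ p : Poly V, Commute D (P.fnD (algebraMap (Poly V) P.RegFun p)) := by
    intro p
    induction p using SymmetricAlgebra.induction with
    | algebraMap c =>
      rw [← IsScalarTower.algebraMap_apply, AlgHom.commutes]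
      exact (Algebra.commutes c D).symm
    | ι x => exact h x
    | mul a b ha hb => rw [map_mul, map_mul]; exact ha.mul_right hb
    | add a b ha hb => rw [map_add, map_add]; exact ha.add_right hb
  obtain ⟨a, s, rfl⟩ := IsLocalization.exists_mk'_eq (Submonoid.powers P.δ) f
  have hu : IsUnit (P.fnD (algebraMap (Poly V) P.RegFun s)) :=
    (IsLocalization.map_units P.RegFun s).map P.fnD
  obtain ⟨u, hu⟩ := hu
  have h2 : P.fnD (IsLocalization.mk' P.RegFun a s) =
      P.fnD (algebraMap (Poly V) P.RegFun a) * ((u⁻¹ : P.DiffRingˣ) : P.DiffRing) := by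
    rw [Units.eq_mul_inv_iff_mul_eq, hu, ← map_mul, IsLocalization.mk'_spec]
  rw [h2]
  exact (h1 a).mul_right (Commute.units_inv_right (by rw [hu]; exact h1 s))

theorem eq_fnD {D : P.DiffRing} (h : ∀ x, D * P.fnD (P.lin x) = P.fnD (P.lin x) * D) :
    D = P.fnD (P.toEnd D 1) :=
  DiffOp.eq_ofFun (P.commute_fnD h)

/-- An operator that commutes with V* is multiplication by its value at 1. Linearity, commutation
and W-equivariance of the derivatives are all checked this way: compare commutators with linear
forms, then values at 1. -/
theorem DX_ext_zero {D : P.DiffRing} (h : ∀ x, D * P.fnD (P.lin x) = P.fnD (P.lin x) * D)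
    (h1 : P.toEnd D 1 = 0) : D = 0 := by
  rw [P.eq_fnD h, h1, map_zero]

theorem pd_fnD (y : V) (f : P.RegFun) :
    P.pd y * P.fnD f = P.fnD f * P.pd y + P.fnD (P.deriv y f) := by
  refine P.toEnd_injective (LinearMap.ext fun g => ?_)
  exact P.deriv_mul y f g

theorem pd_lin (y : V) (x : Module.Dual ℂ V) :
    P.pd y * P.fnD (P.lin x) = P.fnD (P.lin x) * P.pd y + algebraMap ℂ P.DiffRing (x y) := by
  rw [pd_fnD, deriv_lin, AlgHom.commutes]

theorem deriv_one (y : V) : P.deriv y 1 = 0 := by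
  have h := P.deriv_mul y 1 1
  simpa using h

theorem pd_one (y : V) : P.toEnd (P.pd y) 1 = 0 := P.deriv_one y

theorem pd_add (y y' : V) : P.pd (y + y') = P.pd y + P.pd y' := by
  rw [← sub_eq_zero]
  refine P.DX_ext_zero (fun x => ?_) ?_
  · simp only [sub_mul, add_mul, mul_sub, mul_add, pd_lin, map_add]
    abel
  · change P.deriv (y + y') 1 - (P.deriv y 1 + P.deriv y' 1) = 0
    simp [deriv_one]

theorem pd_smul (c : ℂ) (y : V) : P.pd (c • y) = c • P.pd y := by
  rw [← sub_eq_zero]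
  refine P.DX_ext_zero (fun x => ?_) ?_
  · simp only [sub_mul, mul_sub, smul_mul_assoc, mul_smul_comm, pd_lin, smul_add, map_smul,
      Algebra.algebraMap_eq_smul_one, smul_eq_mul, mul_smul]
    abel
  · change P.deriv (c • y) 1 - c • P.deriv y 1 = 0
    simp [deriv_one]

theorem pd_comm (y y' : V) :
    P.pd y * P.pd y' = P.pd y' * P.pd y := by
  rw [← sub_eq_zero]
  refine P.DX_ext_zero (fun x => ?_) ?_
  · have e : ∀ a b : V, P.pd a * P.pd b * P.fnD (P.lin x) =
        P.fnD (P.lin x) * (P.pd a * P.pd b) + (x a • P.pd b + x b • P.pd a) := by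
      intro a b
      rw [mul_assoc, pd_lin, mul_add, ← mul_assoc, pd_lin]
      simp only [Algebra.algebraMap_eq_smul_one, add_mul, smul_mul_assoc, mul_smul_comm, one_mul,
        mul_one, mul_assoc]
      abel
    rw [sub_mul, e, e, mul_sub]
    abel
  · change P.deriv y (P.deriv y' 1) - P.deriv y' (P.deriv y 1) = 0
    simp [deriv_one]

theorem conj_fnD (w : W) (f : P.RegFun) :
    P.conjD w (P.fnD f) = P.fnD (P.regMove w f) :=
  DiffOp.conj_ofFun _ f

theorem conj_pd (w : W) (y : V) :
    P.conjD w (P.pd y) = P.pd ((w : V ≃ₗ[ℂ] V) y) := by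
  rw [← sub_eq_zero]
  refine P.DX_ext_zero (fun x => ?_) ?_
  -- Every linear form is w(x') for some x', so it suffices to transport [∂_y, x'] = x'(y) by w.
  · obtain ⟨x, rfl⟩ : ∃ x', dualMove (w : V ≃ₗ[ℂ] V) x' = x :=
      ⟨dualMove (w : V ≃ₗ[ℂ] V)⁻¹ x, LinearMap.ext fun v =>
        congrArg x ((w : V ≃ₗ[ℂ] V).apply_symm_apply v)⟩
    have h := congrArg (P.conjD w) (P.pd_lin y x)
    rw [map_mul, map_add, map_mul, conj_fnD, regMove_lin, AlgHom.commutes] at h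
    rw [sub_mul, mul_sub, h, pd_lin, dualMove_apply, LinearEquiv.symm_apply_apply]
    abel
  · change P.regAut w (P.deriv y ((P.regAut w).symm 1)) - P.deriv _ 1 = 0
    simp [deriv_one]

/-- The algebra `𝒟(X)` is generated by functions and derivatives. -/
theorem DX_subalgebra_eq_top [FiniteDimensional ℂ V] (S : Subalgebra ℂ P.DiffRing)
    (hf : ∀ f, P.fnD f ∈ S) (hd : ∀ y, P.pd y ∈ S) : S = ⊤ := by
  let b := Module.finBasis ℂ V
  refine subalgebra_eq_top_of_commutators (fun i => P.fnD (P.lin (b.coord i)))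
    (fun i => P.pd (b i)) (fun i j => P.fnD_comm _ _) (fun i => ?_)
    (fun i j hij => ?_) (fun i D => ?_) S (fun D hD => ?_) fun i => hd (b i)
  · rw [pd_lin]
    simp
  · rw [pd_lin]
    simp [hij]
  · obtain ⟨n, hn⟩ := P.isDiffOp_toEnd D
    refine ⟨n + 1, P.toEnd_injective ?_⟩
    rw [map_zero, ← hn.iterate_commutator_eq_zero (P.lin (b.coord i))]
    generalize n + 1 = m
    clear hn
    induction m generalizing D with
    | zero => rfl
    | succ m ih =>
      rw [Function.iterate_succ_apply, ih, Function.iterate_succ_apply, map_sub, map_mul, map_mul,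
        toEnd_fnD]
  · rw [P.eq_fnD (D := D) fun x => ?_]
    · exact hf _
    · rw [← b.sum_dual_apply_smul_coord x]
      simp only [map_sum, map_smul, Finset.mul_sum, Finset.sum_mul, mul_smul_comm, smul_mul_assoc,
        hD]

end Data
end LatticeCherednik
end

/-! ### Monomials and coefficients in the crossed product -/

noncomputable section
namespace LatticeCherednik
namespace Data

variable {V : Type*} [AddCommGroup V] [Module ℂ V] {W : Subgroup (V ≃ₗ[ℂ] V)} [Finite W]
  (P : Data W)

theorem ofDX_add (a b : P.DX) : P.ofDX (a + b) = P.ofDX a + P.ofDX b := by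
  unfold ofDX
  rw [← SkewMonoidAlgebra.single_add, ← TensorProduct.add_tmul]

theorem ofDX_smul (c : ℂ) (a : P.DX) : P.ofDX (c • a) = c • P.ofDX a := by
  unfold ofDX
  rw [SkewMonoidAlgebra.smul_single, TensorProduct.smul_tmul']

theorem ofDX_mul (a b : P.DX) : P.ofDX (a * b) = P.ofDX a * P.ofDX b := by
  unfold ofDX
  rw [SkewMonoidAlgebra.single_mul_single, one_smul, mul_one,
    Algebra.TensorProduct.tmul_mul_tmul, mul_one]

/-- Fixes the normal form in which coefficients are read off: differential operator, lattice
element, group element, in this order. -/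
theorem ofDX_mul_ofLattice_mul_ofGroup (D : P.DX) (b : FullReflectionSubgroup W) (w : W) :
    P.ofDX D * P.ofLattice b * P.ofGroup w =
      SkewMonoidAlgebra.single w (D ⊗ₜ[ℂ] (MonoidAlgebra.single b 1 : MobiusAlgebra W)) := by
  unfold ofDX ofLattice ofGroup
  rw [SkewMonoidAlgebra.of_apply, SkewMonoidAlgebra.single_mul_single,
    SkewMonoidAlgebra.single_mul_single, one_smul, mul_one,
    one_mul, one_smul, mul_one, Algebra.TensorProduct.tmul_mul_tmul, mul_one, one_mul]

theorem smul_tmul_eq (w : W) (D : P.DX) (m : MobiusAlgebra W) :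
    w • (D ⊗ₜ[ℂ] m : P.Coeff) = DiffOp.conj (P.regAut w) D ⊗ₜ[ℂ] mobiusAut w m := rfl

theorem ofGroup_mul_ofDX (w : W) (D : P.DX) :
    P.ofGroup w * P.ofDX D = P.ofDX (DiffOp.conj (P.regAut w) D) * P.ofGroup w := by
  unfold ofDX ofGroup
  rw [SkewMonoidAlgebra.of_apply, SkewMonoidAlgebra.single_mul_single,
    SkewMonoidAlgebra.single_mul_single, one_smul, mul_one,
    one_mul, one_mul, mul_one, smul_tmul_eq, map_one]

theorem ofGroup_mul_ofLattice (w : W) (b : FullReflectionSubgroup W) :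
    P.ofGroup w * P.ofLattice b = P.ofLattice (b.conj w) * P.ofGroup w := by
  unfold ofLattice ofGroup
  rw [SkewMonoidAlgebra.of_apply, SkewMonoidAlgebra.single_mul_single,
    SkewMonoidAlgebra.single_mul_single, one_smul, mul_one,
    one_mul, one_mul, mul_one, smul_tmul_eq, map_one]
  congr 2
  exact MonoidAlgebra.domCongr_single _ _ _

theorem ofLattice_mul_ofDX (b : FullReflectionSubgroup W) (D : P.DX) :
    P.ofLattice b * P.ofDX D = P.ofDX D * P.ofLattice b := by
  unfold ofDX ofLattice
  rw [SkewMonoidAlgebra.single_mul_single, SkewMonoidAlgebra.single_mul_single, one_smul,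
    one_smul, Algebra.TensorProduct.tmul_mul_tmul, Algebra.TensorProduct.tmul_mul_tmul]
  simp only [one_mul, mul_one]

theorem ofLattice_mul_ofLattice (b b' : FullReflectionSubgroup W) :
    P.ofLattice b * P.ofLattice b' = P.ofLattice (b ⊔ b') := by
  unfold ofLattice
  rw [SkewMonoidAlgebra.single_mul_single, one_smul, Algebra.TensorProduct.tmul_mul_tmul,
    one_mul, one_mul, MonoidAlgebra.single_mul_single, one_mul, FullReflectionSubgroup.mul_eq_sup]

/-- Induction on elements of the crossed product. -/
theorem crossed_induction' {p : P.Crossed → Prop} (z : P.Crossed)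
    (h0 : p 0) (hadd : ∀ a b, p a → p b → p (a + b))
    (hmon : ∀ D b w, p (P.ofDX D * P.ofLattice b * P.ofGroup w)) : p z := by
  refine SkewMonoidAlgebra.induction_on (p := p) z h0 (fun w t => ?_) hadd
  induction t using TensorProduct.induction_on with
  | zero => rw [SkewMonoidAlgebra.single_zero]; exact h0
  | add a b ha hb => rw [SkewMonoidAlgebra.single_add]; exact hadd _ _ ha hb
  | tmul D m =>
    induction m using MonoidAlgebra.induction_linear with
    | zero => rw [TensorProduct.tmul_zero, SkewMonoidAlgebra.single_zero]; exact h0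
    | add a b ha hb =>
      rw [TensorProduct.tmul_add, SkewMonoidAlgebra.single_add]; exact hadd _ _ ha hb
    | single b c =>
      have h := hmon (c • D) b w
      rw [ofDX_mul_ofLattice_mul_ofGroup] at h
      have e : (MonoidAlgebra.single b c : MobiusAlgebra W) = c • MonoidAlgebra.single b 1 := by
        simp
      rw [e, ← TensorProduct.smul_tmul]
      exact h

/-- The coefficient of `e_b` in an element of `𝒟(X) ⊗ ℂ𝓛`. -/
def coefMobius (b : FullReflectionSubgroup W) : P.Coeff →ₗ[ℂ] P.DX :=
  TensorProduct.lift (LinearMap.flip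
    (LinearMap.toSpanSingleton ℂ _ LinearMap.id ∘ₗ Finsupp.lapply b ∘ₗ
      (MonoidAlgebra.coeffLinearEquiv ℂ).toLinearMap))

theorem coefMobius_tmul (b : FullReflectionSubgroup W) (D : P.DX) (m : MobiusAlgebra W) :
    P.coefMobius b (D ⊗ₜ m) = m.coeff b • D := by
  simp [coefMobius]

/-- The coefficient of `e_b w`. -/
def coef' (w : W) (b : FullReflectionSubgroup W) : P.Crossed →ₗ[ℂ] P.DX :=
  P.coefMobius b ∘ₗ Finsupp.lapply w ∘ₗ
    (SkewMonoidAlgebra.coeffLinearEquiv (k := P.Coeff) (G := W) (S := ℂ)).toLinearMap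

open Classical in
theorem coef'_mon (w w' : W) (b b' : FullReflectionSubgroup W) (D : P.DX) :
    P.coef' w b (P.ofDX D * P.ofLattice b' * P.ofGroup w') = if w' = w ∧ b' = b then D else 0 := by
  rw [ofDX_mul_ofLattice_mul_ofGroup]
  change P.coefMobius b ((SkewMonoidAlgebra.single w' _).coeff w) = _
  rw [SkewMonoidAlgebra.coeff_single, Finsupp.single_apply]
  by_cases hw : w' = w
  · rw [if_pos hw, coefMobius_tmul, MonoidAlgebra.coeff_single, Finsupp.single_apply]
    by_cases hb : b' = b
    · rw [if_pos hb, if_pos ⟨hw, hb⟩, one_smul]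
    · rw [if_neg hb, if_neg fun h => hb h.2, zero_smul]
  · rw [if_neg hw, if_neg fun h => hw h.1, map_zero]

/-- The ring `(𝒟(X) ⊗ ℂ𝓛) ⋊ W`. -/
def CrossedRing : Type _ := P.Crossed

/-- The ring structure of the crossed product. -/
def crossedRing : Ring P.CrossedRing := (Algebra.semiringToRing ℂ : Ring P.Crossed)

instance : Ring P.CrossedRing := P.crossedRing

/-- The algebra structure of the crossed product. -/
def crossedAlgebra : Algebra ℂ P.CrossedRing := (inferInstance : Algebra ℂ P.Crossed)

instance : Algebra ℂ P.CrossedRing := P.crossedAlgebra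

/-- The embedding of `𝒟(X)`. -/
def ofD : P.DiffRing →ₐ[ℂ] P.CrossedRing :=
  AlgHom.ofLinearMap
    ({ toFun := P.ofDX
       map_add' := P.ofDX_add
       map_smul' := P.ofDX_smul } : P.DiffRing →ₗ[ℂ] P.CrossedRing)
    rfl P.ofDX_mul

/-- The lattice elements. -/
def lat (b : FullReflectionSubgroup W) : P.CrossedRing := P.ofLattice b

/-- The group elements. -/
def grp : W →* P.CrossedRing := P.ofGroup

theorem grp_mul_ofD (w : W) (D : P.DiffRing) :
    P.grp w * P.ofD D = P.ofD (P.conjD w D) * P.grp w := P.ofGroup_mul_ofDX w D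

theorem grp_mul_lat (w : W) (b : FullReflectionSubgroup W) :
    P.grp w * P.lat b = P.lat (b.conj w) * P.grp w := P.ofGroup_mul_ofLattice w b

theorem lat_mul_ofD (b : FullReflectionSubgroup W) (D : P.DiffRing) :
    P.lat b * P.ofD D = P.ofD D * P.lat b := P.ofLattice_mul_ofDX b D

theorem lat_mul_lat (b b' : FullReflectionSubgroup W) :
    P.lat b * P.lat b' = P.lat (b ⊔ b') := P.ofLattice_mul_ofLattice b b'

theorem lat_bot : P.lat ⊥ = 1 := rfl

/-- Induction on elements of the crossed product. -/
theorem crossed_induction {p : P.CrossedRing → Prop} (z : P.CrossedRing)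
    (h0 : p 0) (hadd : ∀ a b, p a → p b → p (a + b))
    (hmon : ∀ D b w, p (P.ofD D * P.lat b * P.grp w)) : p z :=
  P.crossed_induction' z h0 hadd hmon

/-- The coefficient of `e_b w`. -/
def coef (w : W) (b : FullReflectionSubgroup W) : P.CrossedRing →ₗ[ℂ] P.DiffRing := P.coef' w b

open Classical in
theorem coef_mon (w w' : W) (b b' : FullReflectionSubgroup W) (D : P.DiffRing) :
    P.coef w b (P.ofD D * P.lat b' * P.grp w') = if w' = w ∧ b' = b then D else 0 :=
  P.coef'_mon w w' b b' D

/-- Both W and its lattice of subgroups are finite, so z is the finite sum of its coefficients times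
the e_b w; by linearity this expansion is checked on monomials. -/
theorem crossed_ext {z : P.CrossedRing} (h : ∀ w b, P.coef w b z = 0) : z = 0 := by
  classical
  have := Fintype.ofFinite W
  have hfin : Finite (FullReflectionSubgroup W) := by
    refine Finite.of_injective (fun a => {w : W | (w : V ≃ₗ[ℂ] V) ∈ a.toSubgroup}) ?_
    intro a a' haa
    refine FullReflectionSubgroup.ext (Subgroup.ext fun g => ?_)
    have h1 : ∀ w : W, (w : V ≃ₗ[ℂ] V) ∈ a.toSubgroup ↔ (w : V ≃ₗ[ℂ] V) ∈ a'.toSubgroup :=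
      fun w => Set.ext_iff.1 haa w
    exact ⟨fun hg => (h1 ⟨g, a.le hg⟩).1 hg, fun hg => (h1 ⟨g, a'.le hg⟩).2 hg⟩
  have := Fintype.ofFinite (FullReflectionSubgroup W)
  have key : z = ∑ w : W, ∑ b : FullReflectionSubgroup W,
      P.ofD (P.coef w b z) * P.lat b * P.grp w := by
    refine P.crossed_induction (p := fun z => z = ∑ w : W, ∑ b : FullReflectionSubgroup W,
      P.ofD (P.coef w b z) * P.lat b * P.grp w) z ?_ (fun a b ha hb => ?_) (fun D b w => ?_)
    · simp only [map_zero, zero_mul, Finset.sum_const_zero]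
    · conv_lhs => rw [ha, hb]
      simp only [map_add, add_mul, Finset.sum_add_distrib]
    · rw [Finset.sum_eq_single w, Finset.sum_eq_single b]
      · rw [coef_mon, if_pos ⟨rfl, rfl⟩]
      · intro b' _ hb
        rw [coef_mon, if_neg fun h => hb h.2.symm]
        simp
      · simp
      · intro w' _ hw
        refine Finset.sum_eq_zero fun b' _ => ?_
        rw [coef_mon, if_neg fun h => hw h.1.symm]
        simp
      · simp
  rw [key]
  simp [h]

end Data
end LatticeCherednik
end

/-! ### Pointwise stabilizers of reflecting hyperplanes -/

noncomputable section
namespace LatticeCherednik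

section Fixer

variable {V : Type*} [AddCommGroup V] [Module ℂ V] {W : Subgroup (V ≃ₗ[ℂ] V)}

/-- The determinant of an element of `W`. -/
def detW (w : W) : ℂ := LinearMap.det ((w : V ≃ₗ[ℂ] V) : V →ₗ[ℂ] V)

theorem detW_mul (w w' : W) : detW (w * w') = detW w * detW w' :=
  LinearMap.det_comp ((w : V ≃ₗ[ℂ] V) : V →ₗ[ℂ] V) _

theorem detW_one : detW (1 : W) = 1 := LinearMap.det_id

theorem detW_ne_zero (w : W) : detW w ≠ 0 := fun h => by
  have h1 := detW_mul w w⁻¹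
  rw [mul_inv_cancel, detW_one, h, zero_mul] at h1
  exact one_ne_zero h1

theorem detW_conj (w u : W) : detW (w * u * w⁻¹) = detW u := by
  have h1 := detW_mul w w⁻¹
  rw [mul_inv_cancel, detW_one] at h1
  rw [detW_mul, detW_mul, mul_right_comm, ← h1, one_mul]

theorem detW_pow (w : W) (n : ℕ) : detW (w ^ n) = detW w ^ n := by
  induction n with
  | zero => rw [pow_zero, pow_zero, detW_one]
  | succ n ih => rw [pow_succ, pow_succ, detW_mul, ih]

/-- The elements of `W` that fix `H` pointwise. -/
def fixSet (H : Arrangement W) : Subgroup W := (fixer W H.hyperplane).subgroupOf W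

theorem mem_fixSet {H : Arrangement W} {w : W} :
    w ∈ fixSet H ↔ (w : V ≃ₗ[ℂ] V) ∈ fixer W H.hyperplane := Subgroup.mem_subgroupOf

theorem card_fixSet (H : Arrangement W) : Nat.card (fixSet H) = ord H :=
  Nat.card_congr (Subgroup.subgroupOfEquivOfLe (H := fixer W H.hyperplane) fun _ h => h.1).toEquiv

theorem detW_pow_ord {H : Arrangement W} {w : W} (hw : w ∈ fixSet H) : detW w ^ ord H = 1 := by
  have h : (⟨w, hw⟩ : fixSet H) ^ Nat.card (fixSet H) = 1 := pow_card_eq_one'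
  have h1 : w ^ ord H = 1 := by
    rw [← card_fixSet]
    exact congrArg Subtype.val h
  rw [← detW_pow, h1, detW_one]

theorem mem_fixSet_move {H : Arrangement W} {w u : W} :
    w * u * w⁻¹ ∈ fixSet (H.move w) ↔ u ∈ fixSet H := by
  rw [mem_fixSet, mem_fixSet]
  constructor
  · rintro ⟨-, h⟩
    refine ⟨u.2, fun v hv => ?_⟩
    have h1 := h ((w : V ≃ₗ[ℂ] V) v) ⟨v, hv, rfl⟩
    change (w : V ≃ₗ[ℂ] V) ((u : V ≃ₗ[ℂ] V) ((w : V ≃ₗ[ℂ] V).symm ((w : V ≃ₗ[ℂ] V) v))) = _ at h1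
    rw [LinearEquiv.symm_apply_apply] at h1
    exact (w : V ≃ₗ[ℂ] V).injective h1
  · rintro ⟨-, h⟩
    refine ⟨Subtype.mem _, ?_⟩
    rintro _ ⟨v, hv, rfl⟩
    change (w : V ≃ₗ[ℂ] V) ((u : V ≃ₗ[ℂ] V) ((w : V ≃ₗ[ℂ] V).symm ((w : V ≃ₗ[ℂ] V) v))) =
      (w : V ≃ₗ[ℂ] V) v
    rw [LinearEquiv.symm_apply_apply, h v hv]

theorem move_mul (w w' : W) (H : Arrangement W) : H.move (w * w') = (H.move w').move w := by
  have h : ∀ A B : Arrangement W, A.hyperplane = B.hyperplane → A = B := by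
    rintro ⟨A, _⟩ ⟨B, _⟩ rfl
    rfl
  exact h _ _ (Submodule.map_comp _ _ _)

theorem move_one (H : Arrangement W) : H.move 1 = H := by
  have h : ∀ A B : Arrangement W, A.hyperplane = B.hyperplane → A = B := by
    rintro ⟨A, _⟩ ⟨B, _⟩ rfl
    rfl
  exact h _ _ (Submodule.map_id _)

/-- The permutation of the hyperplanes by an element of `W`. -/
def moveEquiv (w : W) : Arrangement W ≃ Arrangement W where
  toFun := Arrangement.move w
  invFun := Arrangement.move w⁻¹
  left_inv H := by rw [← move_mul, inv_mul_cancel, move_one]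
  right_inv H := by rw [← move_mul, mul_inv_cancel, move_one]

theorem conj_eq_self {b : FullReflectionSubgroup W} {w : W}
    (hw : (w : V ≃ₗ[ℂ] V) ∈ b.toSubgroup) : b.conj w = b := by
  have h : ∀ w : W, (w : V ≃ₗ[ℂ] V) ∈ b.toSubgroup → b.conj w ≤ b := by
    rintro w hw _ ⟨s, hs, rfl⟩
    exact b.toSubgroup.mul_mem (b.toSubgroup.mul_mem hw hs) (b.toSubgroup.inv_mem hw)
  refine le_antisymm (h w hw) ?_
  have h1 := FullReflectionSubgroup.conj_mono w (h w⁻¹ (b.toSubgroup.inv_mem hw))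
  rwa [← FullReflectionSubgroup.conj_mul, mul_inv_cancel, FullReflectionSubgroup.conj_one] at h1

theorem parabolic_move (w : W) (H : Arrangement W) :
    parabolic (H.move w) = (parabolic H).conj w := by
  refine FullReflectionSubgroup.ext (Subgroup.ext fun g => ?_)
  constructor
  · intro hg
    refine ⟨(w : V ≃ₗ[ℂ] V)⁻¹ * g * w, ?_, ?_⟩
    · have h1 : w * (w⁻¹ * ⟨g, hg.1⟩ * w) * w⁻¹ = ⟨g, hg.1⟩ := by group
      have h2 := (mem_fixSet_move (H := H) (w := w) (u := w⁻¹ * ⟨g, hg.1⟩ * w)).1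
        (by rw [h1]; exact mem_fixSet.2 hg)
      exact mem_fixSet.1 h2
    · change (w : V ≃ₗ[ℂ] V) * ((w : V ≃ₗ[ℂ] V)⁻¹ * g * w) * (w : V ≃ₗ[ℂ] V)⁻¹ = g
      group
  · rintro ⟨s, hs, rfl⟩
    exact mem_fixSet.1 ((mem_fixSet_move (w := w) (u := ⟨s, hs.1⟩)).2 (mem_fixSet.2 hs))

/-- Two distinct hyperplanes span V, and w fixes both pointwise. -/
theorem eq_one_of_mem_fixSet {H H' : Arrangement W} (hne : H ≠ H') {w : W}
    (h : w ∈ fixSet H) (h' : w ∈ fixSet H') : w = 1 := by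
  have h0 : ∀ A B : Arrangement W, A.hyperplane = B.hyperplane → A = B := by
    rintro ⟨A, _⟩ ⟨B, _⟩ rfl
    rfl
  have htop : H.hyperplane ⊔ H'.hyperplane = ⊤ := by
    refine H.isCoatom.2 _ (lt_of_le_of_ne le_sup_left fun he => ?_)
    have hle : H'.hyperplane ≤ H.hyperplane := he ▸ le_sup_right
    rcases H'.isCoatom.le_iff.1 hle with h1 | h1
    · exact H.isCoatom.1 h1
    · exact hne (h0 _ _ h1)
  refine Subtype.ext (LinearEquiv.ext fun v => ?_)
  have hle : H.hyperplane ⊔ H'.hyperplane ≤ fixedSpace (w : V ≃ₗ[ℂ] V) :=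
    sup_le (fun v hv => mem_fixedSpace.2 ((mem_fixSet.1 h).2 v hv))
      fun v hv => mem_fixedSpace.2 ((mem_fixSet.1 h').2 v hv)
  exact mem_fixedSpace.1 (hle (htop ▸ Submodule.mem_top))

end Fixer

/-! ### Commutation rules for a_H and γ_H -/

namespace Data

variable {V : Type*} [AddCommGroup V] [Module ℂ V] {W : Subgroup (V ≃ₗ[ℂ] V)} [Finite W]
  (P : Data W)

/-- Decompose u along ℂ v_H ⊕ H: w fixes the part in H and multiplies v_H by a scalar d. So w has
the form u ↦ u + f(u) v_H with f(v_H) = d − 1, and its determinant is 1 + f(v_H) = d. -/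
theorem fixSet_apply [FiniteDimensional ℂ V] {H : Arrangement W} {w : W} (hw : w ∈ fixSet H)
    (u : V) : (w : V ≃ₗ[ℂ] V) u = u + ((detW w - 1) / P.α H (P.v H) * P.α H u) • P.v H := by
  have hw' := mem_fixSet.1 hw
  have hv := P.α_v_ne_zero H
  obtain ⟨d, hd⟩ := Submodule.mem_span_singleton.1 (P.stable_v H _ hw')
  have key : ∀ u, (w : V ≃ₗ[ℂ] V) u = u + ((d - 1) / P.α H (P.v H) * P.α H u) • P.v H := by
    intro u
    have hu : u - (P.α H u / P.α H (P.v H)) • P.v H ∈ H.hyperplane := by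
      rw [← P.ker_α, LinearMap.mem_ker, map_sub, map_smul, smul_eq_mul, div_mul_cancel₀ _ hv,
        sub_self]
    have h1 := hw'.2 _ hu
    rw [map_sub, map_smul, ← hd, sub_eq_iff_eq_add] at h1
    rw [h1, div_mul_eq_mul_div, mul_div_assoc]
    module
  have hdet : detW w = d := by
    have h2 : ((w : V ≃ₗ[ℂ] V) : V →ₗ[ℂ] V) =
        LinearMap.transvection (((d - 1) / P.α H (P.v H)) • P.α H) (P.v H) :=
      LinearMap.ext fun u => by
        rw [LinearMap.transvection.apply]
        exact key u
    unfold detW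
    rw [h2, LinearMap.transvection.det, LinearMap.smul_apply, smul_eq_mul, div_mul_cancel₀ _ hv]
    ring
  rw [hdet]
  exact key u

theorem dualMove_eq_self [FiniteDimensional ℂ V] {H : Arrangement W} {w : W} (hw : w ∈ fixSet H)
    {x : Module.Dual ℂ V} (hx : x (P.v H) = 0) : dualMove (w : V ≃ₗ[ℂ] V) x = x := by
  ext u
  obtain ⟨u, rfl⟩ := (w : V ≃ₗ[ℂ] V).surjective u
  rw [dualMove_apply, LinearEquiv.symm_apply_apply, P.fixSet_apply hw u]
  simp [hx]

theorem dualMove_α [FiniteDimensional ℂ V] {H : Arrangement W} {w : W} (hw : w ∈ fixSet H) :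
    dualMove (w : V ≃ₗ[ℂ] V) (P.α H) = (detW w)⁻¹ • P.α H := by
  have hv := P.α_v_ne_zero H
  have hd := detW_ne_zero w
  ext u
  obtain ⟨u, rfl⟩ := (w : V ≃ₗ[ℂ] V).surjective u
  rw [dualMove_apply, LinearEquiv.symm_apply_apply, P.fixSet_apply hw u]
  simp only [LinearMap.smul_apply, map_add, map_smul, smul_eq_mul]
  field_simp
  ring

/-- Functions on `X`, in the crossed product. -/
def fn : P.RegFun →ₐ[ℂ] P.CrossedRing := P.ofD.comp P.fnD

/-- The morphism from the group algebra. -/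
def gAlg : MonoidAlgebra ℂ W →ₐ[ℂ] P.CrossedRing := MonoidAlgebra.lift ℂ P.CrossedRing W P.grp

theorem fn_comm (f g : P.RegFun) : P.fn f * P.fn g = P.fn g * P.fn f := by
  rw [← map_mul, ← map_mul, mul_comm]

theorem grp_mul_fn (w : W) (f : P.RegFun) :
    P.grp w * P.fn f = P.fn (P.regMove w f) * P.grp w := by
  unfold fn
  rw [AlgHom.comp_apply, grp_mul_ofD, conj_fnD]
  rfl

theorem lat_mul_fn (b : FullReflectionSubgroup W) (f : P.RegFun) :
    P.lat b * P.fn f = P.fn f * P.lat b := P.lat_mul_ofD b _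

theorem lat_comm (b b' : FullReflectionSubgroup W) : P.lat b * P.lat b' = P.lat b' * P.lat b := by
  rw [lat_mul_lat, lat_mul_lat, sup_comm]

theorem gAlg_single (w : W) (c : ℂ) : P.gAlg (MonoidAlgebra.single w c) = c • P.grp w :=
  MonoidAlgebra.lift_single _ _ _

open Classical in
theorem gAlg_eps (H : Arrangement W) (j : ℕ) :
    P.gAlg (eps H j) = (1 / (ord H : ℂ)) •
      ∑ w ∈ (@Finset.univ W (Fintype.ofFinite W)).filter (· ∈ fixSet H), detW w ^ j • P.grp w := by
  unfold eps
  rw [map_smul, map_sum]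
  simp only [gAlg_single]
  rfl

theorem gAlg_eps_mul_lin [FiniteDimensional ℂ V] (H : Arrangement W) (j : ℕ)
    {x : Module.Dual ℂ V} (hx : x (P.v H) = 0) :
    P.gAlg (eps H j) * P.fn (P.lin x) = P.fn (P.lin x) * P.gAlg (eps H j) := by
  classical
  rw [gAlg_eps, smul_mul_assoc, mul_smul_comm, Finset.sum_mul, Finset.mul_sum]
  congr 1
  refine Finset.sum_congr rfl fun w hw => ?_
  rw [smul_mul_assoc, mul_smul_comm, grp_mul_fn, regMove_lin,
    P.dualMove_eq_self (Finset.mem_filter.1 hw).2 hx]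

/-- Moving α_H to the left across w ∈ W_H costs det(w)⁻¹, which absorbs one power of the
determinant. This shift is the source of the differences k_{H,j+1} − k_{H,j} in γ_H. -/
theorem gAlg_eps_mul_α [FiniteDimensional ℂ V] (H : Arrangement W) (j : ℕ) :
    P.gAlg (eps H (j + 1)) * P.fn (P.lin (P.α H)) =
      P.fn (P.lin (P.α H)) * P.gAlg (eps H j) := by
  classical
  rw [gAlg_eps, gAlg_eps, smul_mul_assoc, mul_smul_comm, Finset.sum_mul, Finset.mul_sum]
  congr 1
  refine Finset.sum_congr rfl fun w hw => ?_
  rw [smul_mul_assoc, mul_smul_comm, grp_mul_fn, regMove_lin,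
    P.dualMove_α (Finset.mem_filter.1 hw).2, map_smul, map_smul, smul_mul_assoc, smul_smul,
    pow_succ, mul_inv_cancel_right₀ (detW_ne_zero w)]

theorem gAlg_eps_mod (H : Arrangement W) (j : ℕ) :
    P.gAlg (eps H (j % ord H)) = P.gAlg (eps H j) := by
  classical
  rw [gAlg_eps, gAlg_eps]
  congr 1
  refine Finset.sum_congr rfl fun w hw => ?_
  rw [pow_eq_pow_mod j (detW_pow_ord (Finset.mem_filter.1 hw).2)]

theorem sum_range_add_one_mod {M : Type*} [AddCommMonoid M] (m : ℕ) (f : ℕ → M) :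
    ∑ j ∈ Finset.range m, f ((j + 1) % m) = ∑ j ∈ Finset.range m, f j := by
  cases m with
  | zero => simp
  | succ m =>
    rw [Finset.sum_range_succ, Finset.sum_range_succ' f, Nat.mod_self]
    congr 1
    refine Finset.sum_congr rfl fun j hj => ?_
    rw [Nat.mod_eq_of_lt (Nat.succ_lt_succ (Finset.mem_range.1 hj))]

theorem gAlg_a_mul_α [FiniteDimensional ℂ V] (H : Arrangement W) :
    P.gAlg (P.a H) * P.fn (P.lin (P.α H)) =
      P.fn (P.lin (P.α H)) * (P.gAlg (P.a H) + P.gAlg (P.γ H)) := by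
  have h1 : P.gAlg (P.a H) * P.fn (P.lin (P.α H)) = P.fn (P.lin (P.α H)) *
      ∑ j ∈ Finset.range (ord H), ((ord H : ℂ) * P.k H ((j + 1) % ord H)) • P.gAlg (eps H j) := by
    unfold a
    -- Reindexing cyclically by j ↦ j + 1 writes every idempotent as ε_{H,j+1}, across which α_H can
    -- be moved.
    rw [← sum_range_add_one_mod, map_sum, Finset.sum_mul, Finset.mul_sum]
    refine Finset.sum_congr rfl fun j _ => ?_
    rw [map_smul, gAlg_eps_mod, smul_mul_assoc, mul_smul_comm, gAlg_eps_mul_α]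
  rw [h1, a, γ, map_sum, map_sum, ← Finset.sum_add_distrib]
  congr 1
  refine Finset.sum_congr rfl fun j _ => ?_
  rw [map_smul, map_smul]
  module

theorem gAlg_a_mul_lin [FiniteDimensional ℂ V] (H : Arrangement W) (x : Module.Dual ℂ V) :
    P.gAlg (P.a H) * P.fn (P.lin x) = P.fn (P.lin x) * P.gAlg (P.a H) +
      (x (P.v H) / P.α H (P.v H)) • (P.fn (P.lin (P.α H)) * P.gAlg (P.γ H)) := by
  have hv := P.α_v_ne_zero H
  set c := x (P.v H) / P.α H (P.v H) with hc
  -- The part x₀ vanishing at v_H is fixed by W_H and commutes with a_H; only the component along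
  -- α_H contributes.
  obtain ⟨x₀, hx₀, hx⟩ : ∃ x₀ : Module.Dual ℂ V, x₀ (P.v H) = 0 ∧ x = x₀ + c • P.α H :=
    ⟨x - c • P.α H, by simp [hc, hv], by abel⟩
  have h0 : P.gAlg (P.a H) * P.fn (P.lin x₀) = P.fn (P.lin x₀) * P.gAlg (P.a H) := by
    unfold a
    rw [map_sum, Finset.sum_mul, Finset.mul_sum]
    refine Finset.sum_congr rfl fun j _ => ?_
    rw [map_smul, smul_mul_assoc, mul_smul_comm, P.gAlg_eps_mul_lin H j hx₀]
  rw [hx, map_add, map_add, map_smul, map_smul, mul_add, add_mul, h0, mul_smul_comm, gAlg_a_mul_α,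
    mul_add, smul_add, smul_mul_assoc]
  abel

theorem ord_move (w : W) (H : Arrangement W) : ord (H.move w) = ord H := by
  rw [← card_fixSet, ← card_fixSet]
  refine Nat.card_congr (Equiv.symm ((MulAut.conj w).toEquiv.subtypeEquiv fun u => ?_))
  exact mem_fixSet_move.symm

theorem grp_mul_gAlg_eps (w : W) (H : Arrangement W) (j : ℕ) :
    P.grp w * P.gAlg (eps H j) = P.gAlg (eps (H.move w) j) * P.grp w := by
  classical
  let _ := Fintype.ofFinite W
  rw [gAlg_eps, gAlg_eps, smul_mul_assoc, mul_smul_comm, Finset.sum_mul, Finset.mul_sum, ord_move,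
    Finset.sum_filter, Finset.sum_filter]
  congr 1
  refine Fintype.sum_equiv (MulAut.conj w).toEquiv _ _ fun u => ?_
  change _ = if w * u * w⁻¹ ∈ fixSet (H.move w) then detW (w * u * w⁻¹) ^ j •
    P.grp (w * u * w⁻¹) * P.grp w else 0
  simp only [mem_fixSet_move, detW_conj, mul_smul_comm, smul_mul_assoc, ← map_mul,
    inv_mul_cancel_right]

theorem grp_mul_gAlg_a (w : W) (H : Arrangement W) :
    P.grp w * P.gAlg (P.a H) = P.gAlg (P.a (H.move w)) * P.grp w := by
  unfold a
  rw [map_sum, map_sum, Finset.sum_mul, Finset.mul_sum, ord_move]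
  refine Finset.sum_congr rfl fun j hj => ?_
  rw [map_smul, map_smul, smul_mul_assoc, mul_smul_comm, grp_mul_gAlg_eps,
    P.k_move w H j (Finset.mem_range.1 hj)]

/-- The span of the elements `w e_H`, `w ∈ W_H`. -/
def localSpan (H : Arrangement W) : Submodule ℂ P.CrossedRing :=
  Submodule.span ℂ {z | ∃ w ∈ fixSet H, z = P.grp w * P.lat (parabolic H)}

theorem gAlg_eps_mem (H : Arrangement W) (j : ℕ) :
    P.gAlg (eps H j) * P.lat (parabolic H) ∈ P.localSpan H := by
  classical
  rw [gAlg_eps, smul_mul_assoc, Finset.sum_mul]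
  refine Submodule.smul_mem _ _ (Submodule.sum_mem _ fun w hw => ?_)
  rw [smul_mul_assoc]
  exact Submodule.smul_mem _ _ (Submodule.subset_span ⟨w, (Finset.mem_filter.1 hw).2, rfl⟩)

theorem gAlg_a_mem (H : Arrangement W) :
    P.gAlg (P.a H) * P.lat (parabolic H) ∈ P.localSpan H := by
  unfold a
  rw [map_sum, Finset.sum_mul]
  refine Submodule.sum_mem _ fun j _ => ?_
  rw [map_smul, smul_mul_assoc]
  exact Submodule.smul_mem _ _ (P.gAlg_eps_mem H j)

theorem gAlg_γ_mem (H : Arrangement W) :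
    P.gAlg (P.γ H) * P.lat (parabolic H) ∈ P.localSpan H := by
  unfold γ
  rw [map_sum, Finset.sum_mul]
  refine Submodule.sum_mem _ fun j _ => ?_
  rw [map_smul, smul_mul_assoc]
  exact Submodule.smul_mem _ _ (P.gAlg_eps_mem H j)

/-- An element w ∈ W_H normalizes W_H and W_H ∨ b, since it lies in both; so e_b w e_H and w e_H e_b
both equal e_{W_H ∨ b} w. The factor e_H is what replaces b by a subgroup containing w. -/
theorem lat_mul_localSpan (b : FullReflectionSubgroup W) {H : Arrangement W} {z : P.CrossedRing}
    (hz : z ∈ P.localSpan H) : P.lat b * z = z * P.lat b := by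
  induction hz using Submodule.span_induction with
  | mem z hz =>
    obtain ⟨w, hw, rfl⟩ := hz
    have h1 : (parabolic H).conj w = parabolic H := conj_eq_self (mem_fixSet.1 hw)
    have h2 : (parabolic H ⊔ b).conj w = parabolic H ⊔ b :=
      conj_eq_self ((le_sup_left : parabolic H ≤ parabolic H ⊔ b) (mem_fixSet.1 hw))
    rw [grp_mul_lat, h1, ← mul_assoc, lat_mul_lat, sup_comm, mul_assoc, grp_mul_lat,
      ← mul_assoc, lat_mul_lat, ← h2]
    conv_rhs => rw [← h1]
    congr 2
    exact map_mul (FullReflectionSubgroup.conjAut w) (parabolic H) b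
  | zero => simp
  | add z z' _ _ h h' => rw [mul_add, add_mul, h, h']
  | smul c z _ h => rw [mul_smul_comm, smul_mul_assoc, h]

end Data
end LatticeCherednik
end

/-! ### Dunkl operators and their commutation -/

noncomputable section
namespace LatticeCherednik
namespace Data

variable {V : Type*} [AddCommGroup V] [Module ℂ V] {W : Subgroup (V ≃ₗ[ℂ] V)} [Finite W]
  (P : Data W)

/-- The regular function `1 / α_H`. -/
def invα (H : Arrangement W) : P.RegFun := ((P.isUnit_lin_α H).unit⁻¹ : P.RegFunˣ)

theorem invα_mul (H : Arrangement W) : P.invα H * P.lin (P.α H) = 1 :=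
  (P.isUnit_lin_α H).val_inv_mul

theorem quot_eq (y : V) (H : Arrangement W) : P.quot y H = P.α H y • P.invα H := rfl

theorem deriv_invα (y : V) (H : Arrangement W) :
    P.deriv y (P.invα H) = -(P.α H y • (P.invα H * P.invα H)) := by
  have h := P.deriv_mul y (P.invα H) (P.lin (P.α H))
  rw [invα_mul, deriv_one, deriv_lin] at h
  have h1 := congrArg (· * P.invα H) h
  simp only [zero_mul, add_mul, mul_assoc] at h1
  rw [mul_comm (P.lin _), invα_mul, mul_one, mul_left_comm, ← Algebra.smul_def] at h1
  exact (neg_eq_of_add_eq_zero_right h1.symm).symm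

/-- If w(α_H) = c α_{w(H)}, the scalar c enters once through the value at y and once, inverted,
through 1/α_H. Keeping the factor α_H(y) makes it cancel. -/
theorem regMove_invα (w : W) (H : Arrangement W) (y : V) :
    P.α H y • P.regMove w (P.invα H) =
      P.α (H.move w) ((w : V ≃ₗ[ℂ] V) y) • P.invα (H.move w) := by
  obtain ⟨c, hc, h⟩ := P.exists_dualMove_α w H
  have h1 := congrArg (P.regMove w) (P.invα_mul H)
  rw [map_mul, map_one, regMove_lin, h, map_smul, mul_smul_comm] at h1
  have h2 : P.regMove w (P.invα H) = c⁻¹ • P.invα (H.move w) := by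
    calc P.regMove w (P.invα H)
        = c⁻¹ • ((c • (P.regMove w (P.invα H) * P.lin (P.α (H.move w)))) * P.invα (H.move w)) := by
          rw [smul_mul_assoc, inv_smul_smul₀ hc, mul_assoc, mul_comm (P.lin _), invα_mul, mul_one]
      _ = _ := by rw [h1, one_mul]
  have h3 : P.α H y = c * P.α (H.move w) ((w : V ≃ₗ[ℂ] V) y) := by
    have := LinearMap.congr_fun h ((w : V ≃ₗ[ℂ] V) y)
    rwa [dualMove_apply, LinearEquiv.symm_apply_apply] at this
  rw [h2, h3, smul_smul]
  congr 1
  field_simp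

/-- The summand of the Dunkl operators at `H`, up to the factor `α_H(y)`. -/
def dunklPart (H : Arrangement W) : P.CrossedRing :=
  P.fn (P.invα H) * P.gAlg (P.a H) * P.lat (parabolic H)

/-- The derivative `∂_y`, in the crossed product. -/
def der (y : V) : P.CrossedRing := P.ofD (P.pd y)

/-- The Dunkl operator `T_y`, in the crossed product. -/
def dk (y : V) : P.CrossedRing := P.der y + ∑ H : Arrangement W, P.α H y • P.dunklPart H

theorem dk_eq (y : V) : P.dk y = P.dunkl y := by
  have h : P.dk y = P.der y + ∑ H : Arrangement W,
      P.fn (P.quot y H) * P.gAlg (P.a H) * P.lat (parabolic H) := by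
    unfold dk dunklPart
    simp only [quot_eq, map_smul, smul_mul_assoc]
  exact h

theorem dk_add (y y' : V) : P.dk (y + y') = P.dk y + P.dk y' := by
  unfold dk der
  rw [pd_add, map_add]
  simp only [map_add, add_smul, Finset.sum_add_distrib]
  abel

theorem dk_smul (c : ℂ) (y : V) : P.dk (c • y) = c • P.dk y := by
  unfold dk der
  rw [pd_smul, map_smul]
  simp only [map_smul, smul_eq_mul, smul_add, Finset.smul_sum, mul_smul]

theorem der_mul_fn (y : V) (f : P.RegFun) :
    P.der y * P.fn f = P.fn f * P.der y + P.fn (P.deriv y f) := by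
  unfold der fn
  rw [AlgHom.comp_apply, AlgHom.comp_apply, ← map_mul, pd_fnD, map_add, map_mul]

theorem grp_mul_der (w : W) (y : V) :
    P.grp w * P.der y = P.der ((w : V ≃ₗ[ℂ] V) y) * P.grp w := by
  unfold der
  rw [grp_mul_ofD, conj_pd]

theorem lat_mul_der (b : FullReflectionSubgroup W) (y : V) :
    P.lat b * P.der y = P.der y * P.lat b := P.lat_mul_ofD b _

theorem grp_mul_dunklPart (w : W) (H : Arrangement W) (y : V) :
    P.grp w * (P.α H y • P.dunklPart H) =
      (P.α (H.move w) ((w : V ≃ₗ[ℂ] V) y) • P.dunklPart (H.move w)) * P.grp w := by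
  unfold dunklPart
  rw [← smul_mul_assoc, ← smul_mul_assoc, ← map_smul, ← mul_assoc, ← mul_assoc, grp_mul_fn,
    map_smul, regMove_invα, mul_assoc _ (P.grp w), grp_mul_gAlg_a, ← mul_assoc, mul_assoc _ (P.grp w),
    grp_mul_lat, ← parabolic_move, map_smul]
  simp only [smul_mul_assoc, mul_assoc]

theorem grp_mul_dk (w : W) (y : V) :
    P.grp w * P.dk y = P.dk ((w : V ≃ₗ[ℂ] V) y) * P.grp w := by
  unfold dk
  rw [mul_add, add_mul, grp_mul_der, Finset.mul_sum, Finset.sum_mul]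
  congr 1
  exact Fintype.sum_equiv (moveEquiv w) _ _ fun H => P.grp_mul_dunklPart w H y

theorem lat_mul_dk (b : FullReflectionSubgroup W) (y : V) :
    P.lat b * P.dk y = P.dk y * P.lat b := by
  unfold dk
  rw [mul_add, add_mul, lat_mul_der, Finset.mul_sum, Finset.sum_mul]
  congr 1
  refine Finset.sum_congr rfl fun H _ => ?_
  rw [mul_smul_comm, smul_mul_assoc]
  unfold dunklPart
  rw [mul_assoc, ← mul_assoc, lat_mul_fn, mul_assoc, P.lat_mul_localSpan b (P.gAlg_a_mem H),
    ← mul_assoc]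

/-- The right-hand side of the formula for `[y, x]`. -/
def bracket (y : V) (x : Module.Dual ℂ V) : P.CrossedRing :=
  algebraMap ℂ _ (x y) + ∑ H : Arrangement W,
    (P.α H y * x (P.v H) / P.α H (P.v H)) • (P.gAlg (P.γ H) * P.lat (parabolic H))

/-- The commutator of a_H with x has a factor α_H on the left, which cancels the denominator: the
result has no pole along H. -/
theorem dunklPart_mul_lin [FiniteDimensional ℂ V] (H : Arrangement W) (x : Module.Dual ℂ V) :
    P.dunklPart H * P.fn (P.lin x) = P.fn (P.lin x) * P.dunklPart H +
      (x (P.v H) / P.α H (P.v H)) • (P.gAlg (P.γ H) * P.lat (parabolic H)) := by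
  unfold dunklPart
  rw [mul_assoc, lat_mul_fn, ← mul_assoc, mul_assoc _ (P.gAlg _), gAlg_a_mul_lin, mul_add, add_mul,
    ← mul_assoc, fn_comm, mul_smul_comm, ← mul_assoc (P.fn (P.invα H)), ← map_mul P.fn (P.invα H), invα_mul, map_one,
    one_mul, smul_mul_assoc]
  simp only [mul_assoc]

theorem dk_mul_lin [FiniteDimensional ℂ V] (y : V) (x : Module.Dual ℂ V) :
    P.dk y * P.fn (P.lin x) - P.fn (P.lin x) * P.dk y = P.bracket y x := by
  unfold dk bracket
  rw [add_mul, mul_add, der_mul_fn, deriv_lin, AlgHom.commutes, Finset.sum_mul, Finset.mul_sum,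
    add_assoc, add_sub_add_left_eq_sub, add_sub_assoc, ← Finset.sum_sub_distrib]
  congr 1
  refine Finset.sum_congr rfl fun H _ => ?_
  rw [smul_mul_assoc, mul_smul_comm, dunklPart_mul_lin, smul_add, add_sub_cancel_left, smul_smul,
    mul_div_assoc]

/-- For w ∈ W_H, [T_y, w e_H] = (T_y − T_{w(y)}) w e_H, and w(y) − y is α_H(y) times a fixed
multiple of v_H. The point is that Z is independent of y. -/
theorem exists_dk_commutator [FiniteDimensional ℂ V] {H : Arrangement W} {z : P.CrossedRing}
    (hz : z ∈ P.localSpan H) : ∃ Z, ∀ y, P.dk y * z - z * P.dk y = P.α H y • Z := by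
  induction hz using Submodule.span_induction with
  | mem z hz =>
    obtain ⟨w, hw, rfl⟩ := hz
    refine ⟨-(((detW w - 1) / P.α H (P.v H)) • (P.dk (P.v H) * (P.grp w * P.lat (parabolic H)))),
      fun y => ?_⟩
    rw [mul_assoc (P.grp w), lat_mul_dk, ← mul_assoc (P.grp w), grp_mul_dk, P.fixSet_apply hw,
      dk_add, dk_smul, add_mul, add_mul, mul_assoc, sub_add_cancel_left, smul_mul_assoc,
      smul_mul_assoc, mul_assoc]
    module
  | zero => exact ⟨0, fun y => by simp⟩
  | add z z' _ _ h h' =>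
    obtain ⟨Z, hZ⟩ := h
    obtain ⟨Z', hZ'⟩ := h'
    refine ⟨Z + Z', fun y => ?_⟩
    rw [smul_add, ← hZ, ← hZ']
    noncomm_ring
  | smul c z _ h =>
    obtain ⟨Z, hZ⟩ := h
    refine ⟨c • Z, fun y => ?_⟩
    rw [smul_comm, ← hZ, mul_smul_comm, smul_mul_assoc, smul_sub]

/-- The summand of [y', x] at H carries the factor α_H(y'), and its commutator with T_y the factor
α_H(y); the product is symmetric. By the Jacobi identity this is the commutation of [T_y, T_y'] with
x. -/
theorem dk_bracket_symm [FiniteDimensional ℂ V] (y y' : V) (x : Module.Dual ℂ V) :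
    P.dk y * P.bracket y' x - P.bracket y' x * P.dk y =
      P.dk y' * P.bracket y x - P.bracket y x * P.dk y' := by
  choose Z hZ using fun H => P.exists_dk_commutator (P.gAlg_γ_mem H)
  have key : ∀ a b : V, P.dk a * P.bracket b x - P.bracket b x * P.dk a =
      ∑ H : Arrangement W, (P.α H b * x (P.v H) / P.α H (P.v H)) • (P.α H a • Z H) := by
    intro a b
    unfold bracket
    rw [mul_add, add_mul, Algebra.commutes, add_sub_add_left_eq_sub, Finset.mul_sum, Finset.sum_mul,
      ← Finset.sum_sub_distrib]
    refine Finset.sum_congr rfl fun H _ => ?_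
    rw [← hZ, mul_smul_comm, smul_mul_assoc, smul_sub]
  rw [key, key]
  refine Finset.sum_congr rfl fun H _ => ?_
  rw [smul_smul, smul_smul]
  congr 1
  ring

theorem dk_commutator_mul_lin [FiniteDimensional ℂ V] (y y' : V) (x : Module.Dual ℂ V) :
    (P.dk y * P.dk y' - P.dk y' * P.dk y) * P.fn (P.lin x) =
      P.fn (P.lin x) * (P.dk y * P.dk y' - P.dk y' * P.dk y) := by
  have h := P.dk_bracket_symm y y' x
  rw [← dk_mul_lin, ← dk_mul_lin, ← sub_eq_zero] at h
  rw [← sub_eq_zero, ← h]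
  noncomm_ring

/-- Moving x to the left across w turns it into w(x). With `coef_ofD_mul`, commutation with V*
becomes an intertwining property of each coefficient. -/
theorem coef_mul_lin (w : W) (b : FullReflectionSubgroup W) (z : P.CrossedRing)
    (x : Module.Dual ℂ V) : P.coef w b (z * P.fn (P.lin x)) =
      P.coef w b z * P.fnD (P.lin (dualMove (w : V ≃ₗ[ℂ] V) x)) := by
  classical
  refine P.crossed_induction (p := fun z => P.coef w b (z * P.fn (P.lin x)) =
    P.coef w b z * P.fnD (P.lin (dualMove (w : V ≃ₗ[ℂ] V) x))) z ?_ (fun z z' h h' => ?_)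
    fun D b' w' => ?_
  · rw [zero_mul, map_zero, zero_mul]
  · rw [add_mul, map_add, map_add, add_mul, h, h']
  · have e : P.ofD D * P.lat b' * P.grp w' * P.fn (P.lin x) =
        P.ofD (D * P.fnD (P.lin (dualMove (w' : V ≃ₗ[ℂ] V) x))) * P.lat b' * P.grp w' := by
      rw [mul_assoc, grp_mul_fn, regMove_lin, ← mul_assoc, mul_assoc (P.ofD D), lat_mul_fn, map_mul,
        ← mul_assoc]
      rfl
    rw [e, coef_mon, coef_mon]
    by_cases h : w' = w ∧ b' = b
    · rw [if_pos h, if_pos h, h.1]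
    · rw [if_neg h, if_neg h, zero_mul]

theorem coef_ofD_mul (w : W) (b : FullReflectionSubgroup W) (D : P.DiffRing) (z : P.CrossedRing) :
    P.coef w b (P.ofD D * z) = D * P.coef w b z := by
  classical
  refine P.crossed_induction (p := fun z => P.coef w b (P.ofD D * z) = D * P.coef w b z) z ?_
    (fun z z' h h' => ?_) fun D' b' w' => ?_
  · rw [mul_zero, map_zero, mul_zero]
  · rw [mul_add, map_add, map_add, mul_add, h, h']
  · rw [← mul_assoc, ← mul_assoc, ← map_mul, coef_mon, coef_mon, mul_ite, mul_zero]

/-- An element of the crossed product that commutes with `V*` is concentrated at `1 ∈ W`. -/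
theorem coef_eq_zero_of_commute [FiniteDimensional ℂ V] {z : P.CrossedRing}
    (hz : ∀ x, z * P.fn (P.lin x) = P.fn (P.lin x) * z) {w : W} (hw : w ≠ 1)
    (b : FullReflectionSubgroup W) : P.coef w b z = 0 := by
  -- W acts faithfully on V, hence on V*, because linear forms separate vectors.
  obtain ⟨x, hx⟩ : ∃ x : Module.Dual ℂ V, dualMove (w : V ≃ₗ[ℂ] V) x ≠ x := by
    by_contra! h
    refine hw (Subtype.ext (LinearEquiv.ext fun v => ?_))
    change (w : V ≃ₗ[ℂ] V) v = v
    refine (Module.forall_dual_apply_eq_zero_iff ℂ _).1 ?_ |> sub_eq_zero.1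
    intro x
    have h1 := LinearMap.congr_fun (h x) ((w : V ≃ₗ[ℂ] V) v)
    rw [dualMove_apply, LinearEquiv.symm_apply_apply] at h1
    rw [map_sub, h1, sub_self]
  have h1 := congrArg (P.coef w b) (hz x)
  rw [coef_mul_lin] at h1
  have h2 : P.coef w b (P.fn (P.lin x) * z) = P.fnD (P.lin x) * P.coef w b z :=
    P.coef_ofD_mul w b _ z
  rw [h2] at h1
  obtain ⟨n, hn⟩ := P.isDiffOp_toEnd (P.coef w b z)
  have h3 := congrArg P.toEnd h1
  rw [map_mul, map_mul, toEnd_fnD, toEnd_fnD] at h3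
  refine P.toEnd_injective ((hn.eq_zero_of_intertwining (x := P.lin x) ?_ h3.symm).trans
    (map_zero _).symm)
  exact fun h => hx (P.lin_injective h).symm

theorem coef_mon_ne {w w' : W} (hw : w' ≠ w) (b b' : FullReflectionSubgroup W) (D : P.DiffRing) :
    P.coef w b (P.ofD D * P.lat b' * P.grp w') = 0 := by
  classical
  rw [coef_mon, if_neg fun h => hw h.1]

theorem fn_grp_lat_eq (f : P.RegFun) (w : W) (b : FullReflectionSubgroup W) :
    P.fn f * (P.grp w * P.lat b) = P.ofD (P.fnD f) * P.lat (b.conj w) * P.grp w := by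
  rw [grp_mul_lat, ← mul_assoc]
  rfl

theorem coef_one_mul_eq_zero {w w' : W} (h : w * w' ≠ 1) (f f' : P.RegFun)
    (b b' c : FullReflectionSubgroup W) :
    P.coef 1 c (P.fn f * (P.grp w * P.lat b) * (P.fn f' * (P.grp w' * P.lat b'))) = 0 := by
  have e : P.fn f * (P.grp w * P.lat b) * (P.fn f' * (P.grp w' * P.lat b')) =
      P.ofD (P.fnD (f * P.regMove w f')) * P.lat (b.conj w ⊔ (b'.conj w').conj w) *
        P.grp (w * w') := by
    rw [grp_mul_lat, grp_mul_lat, ← lat_mul_lat, map_mul, map_mul, map_mul]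
    change _ = P.fn f * P.fn _ * _ * _
    calc _ = P.fn f * P.lat (b.conj w) * (P.grp w * P.fn f') * P.lat (b'.conj w') * P.grp w' := by
          simp only [mul_assoc]
      _ = P.fn f * (P.lat (b.conj w) * P.fn (P.regMove w f')) *
            (P.grp w * P.lat (b'.conj w')) * P.grp w' := by
          rw [grp_mul_fn]; simp only [mul_assoc]
      _ = _ := by rw [lat_mul_fn, grp_mul_lat]; simp only [mul_assoc]
  rw [e]
  exact P.coef_mon_ne h _ _ _

/-- Take w ∈ W_H and w' ∈ W_H'. If w w' = 1, then w lies in both stabilizers, so w = w' = 1 and the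
two factors commute; otherwise neither order of the product reaches the component at 1. -/
theorem coef_one_commutator_localSpan {H H' : Arrangement W} (hne : H ≠ H') {z z' : P.CrossedRing}
    (hz : z ∈ P.localSpan H) (hz' : z' ∈ P.localSpan H') (f f' : P.RegFun)
    (c : FullReflectionSubgroup W) :
    P.coef 1 c (P.fn f * z * (P.fn f' * z') - P.fn f' * z' * (P.fn f * z)) = 0 := by
  induction hz using Submodule.span_induction with
  | mem z hz =>
    obtain ⟨w, hw, rfl⟩ := hz
    induction hz' using Submodule.span_induction with
    | mem z' hz' =>
      obtain ⟨w', hw', rfl⟩ := hz'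
      by_cases h : w * w' = 1
      · have hw1 : w = 1 := eq_one_of_mem_fixSet hne hw (by
          rw [eq_inv_of_mul_eq_one_left h]
          exact inv_mem hw')
        have hw1' : w' = 1 := by rwa [hw1, one_mul] at h
        rw [hw1, hw1', map_one, one_mul, one_mul]
        have e : ∀ (g g' : P.RegFun) (b b' : FullReflectionSubgroup W),
            P.fn g * P.lat b * (P.fn g' * P.lat b') = P.fn g * P.fn g' * (P.lat b * P.lat b') := by
          intro g g' b b'
          rw [mul_assoc, ← mul_assoc (P.lat b), lat_mul_fn]
          simp only [mul_assoc]
        rw [e, e, fn_comm, lat_comm, sub_self, map_zero]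
      · rw [map_sub, P.coef_one_mul_eq_zero h, P.coef_one_mul_eq_zero fun h' => h
          (mul_eq_one_comm.1 h'), sub_zero]
    | zero => simp
    | add z z' _ _ h h' =>
      rw [mul_add (P.fn f'), mul_add, add_mul, add_sub_add_comm, map_add, h, h', add_zero]
    | smul a z _ h =>
      rw [mul_smul_comm, mul_smul_comm, smul_mul_assoc, ← smul_sub, map_smul, h, smul_zero]
  | zero => simp
  | add z z' _ _ h h' =>
    rw [mul_add (P.fn f), mul_add, add_mul, add_sub_add_comm, map_add, h, h', add_zero]
  | smul a z _ h =>
    rw [mul_smul_comm, mul_smul_comm, smul_mul_assoc, ← smul_sub, map_smul, h, smul_zero]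

/-- Only w = 1 contributes at 1, and there [∂_y, f e_H] = (∂_y f) e_H. -/
theorem coef_one_der_localSpan {H : Arrangement W} {z : P.CrossedRing}
    (hz : z ∈ P.localSpan H) (f : P.RegFun) (y : V) (c : FullReflectionSubgroup W) :
    P.coef 1 c (P.der y * (P.fn f * z) - P.fn f * z * P.der y) =
      P.coef 1 c (P.fn (P.deriv y f) * z) := by
  induction hz using Submodule.span_induction with
  | mem z hz =>
    obtain ⟨w, hw, rfl⟩ := hz
    have e1 : P.der y * (P.fn f * (P.grp w * P.lat (parabolic H))) =
        P.ofD (P.pd y * P.fnD f) * P.lat ((parabolic H).conj w) * P.grp w := by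
      rw [fn_grp_lat_eq, ← mul_assoc, ← mul_assoc, der, ← map_mul]
    have e2 : P.fn f * (P.grp w * P.lat (parabolic H)) * P.der y =
        P.ofD (P.fnD f * P.pd ((w : V ≃ₗ[ℂ] V) y)) * P.lat ((parabolic H).conj w) * P.grp w := by
      rw [mul_assoc, mul_assoc, lat_mul_der, ← mul_assoc (P.grp w), grp_mul_der, mul_assoc,
        grp_mul_lat, map_mul]
      simp only [← mul_assoc]
      rfl
    by_cases h : w = 1
    · subst h
      congr 1
      rw [map_one, one_mul, mul_assoc, lat_mul_der, ← mul_assoc, der_mul_fn, ← mul_assoc, add_mul,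
        add_sub_cancel_left]
    · rw [map_sub, e1, e2, fn_grp_lat_eq, P.coef_mon_ne h, P.coef_mon_ne h, P.coef_mon_ne h,
        sub_zero]
  | zero => simp
  | add z z' _ _ h h' =>
    rw [mul_add (P.fn (P.deriv y f)), map_add, ← h, ← h', ← map_add]
    congr 1
    noncomm_ring
  | smul a z _ h =>
    rw [mul_smul_comm, mul_smul_comm, mul_smul_comm, smul_mul_assoc, ← smul_sub, map_smul, map_smul,
      h]

theorem der_comm (y y' : V) : P.der y * P.der y' = P.der y' * P.der y := by
  unfold der
  rw [← map_mul, pd_comm, map_mul]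

theorem coef_one_commutator_dk (y y' : V) (c : FullReflectionSubgroup W) :
    P.coef 1 c (P.dk y * P.dk y' - P.dk y' * P.dk y) = 0 := by
  set S : V → P.CrossedRing := fun y => ∑ H : Arrangement W, P.α H y • P.dunklPart H with hS
  have hpart : ∀ H, P.dunklPart H = P.fn (P.invα H) * (P.gAlg (P.a H) * P.lat (parabolic H)) :=
    fun H => mul_assoc _ _ _
  -- Differentiating 1/α_H along a gives −α_H(a)/α_H², so the result is symmetric in a and b and the
  -- cross terms of the commutator cancel.
  have h1 : ∀ a b : V, P.coef 1 c (P.der a * S b - S b * P.der a) =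
      ∑ H : Arrangement W, -((P.α H b * P.α H a) • P.coef 1 c
        (P.fn (P.invα H * P.invα H) * (P.gAlg (P.a H) * P.lat (parabolic H)))) := by
    intro a b
    simp only [hS]
    rw [Finset.mul_sum, Finset.sum_mul, ← Finset.sum_sub_distrib, map_sum]
    refine Finset.sum_congr rfl fun H _ => ?_
    rw [mul_smul_comm, smul_mul_assoc, ← smul_sub, map_smul, hpart,
      P.coef_one_der_localSpan (P.gAlg_a_mem H), deriv_invα, map_neg, map_smul, neg_mul,
      smul_mul_assoc, map_neg, map_smul, smul_neg, smul_smul]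
  have h2 : P.coef 1 c (S y * S y' - S y' * S y) = 0 := by
    have e : S y * S y' - S y' * S y = ∑ H : Arrangement W, ∑ H' : Arrangement W,
        (P.α H y * P.α H' y') • (P.dunklPart H * P.dunklPart H' - P.dunklPart H' * P.dunklPart H) := by
      have e' : ∀ a b : V, S a * S b = ∑ H : Arrangement W, ∑ H' : Arrangement W,
          (P.α H a * P.α H' b) • (P.dunklPart H * P.dunklPart H') := fun a b => by
        simp only [hS, Finset.sum_mul_sum, smul_mul_smul_comm]
      simp only [smul_sub, Finset.sum_sub_distrib]
      rw [e', e', Finset.sum_comm (f := fun H H' => (P.α H y' * P.α H' y) • _)]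
      simp only [mul_comm (P.α _ y')]
    rw [e, map_sum]
    refine Finset.sum_eq_zero fun H _ => ?_
    rw [map_sum]
    refine Finset.sum_eq_zero fun H' _ => ?_
    by_cases hH : H = H'
    · rw [hH, sub_self, smul_zero, map_zero]
    · rw [map_smul, hpart, hpart,
        P.coef_one_commutator_localSpan hH (P.gAlg_a_mem H) (P.gAlg_a_mem H'), smul_zero]
  have h3 : P.dk y * P.dk y' - P.dk y' * P.dk y = (P.der y * S y' - S y' * P.der y) -
      (P.der y' * S y - S y * P.der y') + (S y * S y' - S y' * S y) := by
    change (P.der y + S y) * (P.der y' + S y') - (P.der y' + S y') * (P.der y + S y) = _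
    rw [add_mul, mul_add, mul_add, add_mul, mul_add, mul_add, der_comm]
    abel
  rw [h3, map_add, map_sub, h1, h1, h2, add_zero, sub_eq_zero]
  refine Finset.sum_congr rfl fun H _ => ?_
  rw [mul_comm]

/-- The Dunkl operators commute. -/
theorem dk_comm [FiniteDimensional ℂ V] (y y' : V) : P.dk y * P.dk y' = P.dk y' * P.dk y := by
  rw [← sub_eq_zero]
  refine P.crossed_ext fun w c => ?_
  by_cases hw : w = 1
  · rw [hw, coef_one_commutator_dk]
  · exact P.coef_eq_zero_of_commute (P.dk_commutator_mul_lin y y') hw c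

end Data
end LatticeCherednik
end

/-! ### The morphism Φ and the spanning half of PBW -/

noncomputable section
namespace LatticeCherednik

namespace Cherednik

variable {V : Type*} [AddCommGroup V] [Module ℂ V] {W : Subgroup (V ≃ₗ[ℂ] V)} [Finite W]
  (P : Data W)

/-- The value on the generators of the morphism to the crossed product. -/
def genMap : Gen W → P.CrossedRing
  | .x x => P.fn (P.lin x)
  | .y y => P.dk y
  | .e b => P.lat b
  | .w w => P.grp w

theorem lift_gen (g : Gen W) : FreeAlgebra.lift ℂ (genMap P) (gen g) = genMap P g :=
  FreeAlgebra.lift_ι_apply _ _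

theorem lift_groupLift (u : MonoidAlgebra ℂ W) :
    FreeAlgebra.lift ℂ (genMap P) (groupLift u) = P.gAlg u := by
  unfold groupLift Data.gAlg
  rw [MonoidAlgebra.lift_apply, map_finsuppSum]
  refine Finsupp.sum_congr fun w _ => ?_
  rw [map_smul, lift_gen]
  rfl

theorem lift_rel [FiniteDimensional ℂ V] {a b : FreeAlgebra ℂ (Gen W)} (h : Rel P a b) :
    FreeAlgebra.lift ℂ (genMap P) a = FreeAlgebra.lift ℂ (genMap P) b := by
  cases h with
  | x_add x x' => simp only [map_add, lift_gen, genMap]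
  | x_smul c x => simp only [map_smul, lift_gen, genMap]
  | x_comm x x' => simp only [map_mul, lift_gen, genMap]; exact P.fn_comm _ _
  | y_add y y' => simp only [map_add, lift_gen, genMap]; exact P.dk_add _ _
  | y_smul c y => simp only [map_smul, lift_gen, genMap]; exact P.dk_smul _ _
  | y_comm y y' => simp only [map_mul, lift_gen, genMap]; exact P.dk_comm _ _
  | e_bot => simp only [map_one, lift_gen, genMap]; exact P.lat_bot
  | e_mul b b' => simp only [map_mul, lift_gen, genMap]; exact P.lat_mul_lat _ _
  | w_one => simp only [map_one, lift_gen, genMap]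
  | w_mul w w' => simp only [map_mul, lift_gen, genMap]
  | w_e w b => simp only [map_mul, lift_gen, genMap]; exact P.grp_mul_lat _ _
  | w_x w x => simp only [map_mul, lift_gen, genMap]; rw [P.grp_mul_fn, P.regMove_lin]
  | w_y w y => simp only [map_mul, lift_gen, genMap]; exact P.grp_mul_dk _ _
  | e_x b x => simp only [map_mul, lift_gen, genMap]; exact P.lat_mul_fn _ _
  | e_y b y => simp only [map_mul, lift_gen, genMap]; exact P.lat_mul_dk _ _
  | y_x y x =>
    simp only [map_mul, map_sub, map_add, map_sum, map_smul, lift_gen, lift_groupLift,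
      AlgHom.commutes, genMap]
    exact P.dk_mul_lin y x

/-- The morphism from the Cherednik algebra to the crossed product. -/
def toCrossed [FiniteDimensional ℂ V] : Cherednik P →ₐ[ℂ] P.CrossedRing :=
  RingQuot.liftAlgHom ℂ ⟨FreeAlgebra.lift ℂ (genMap P), fun _ _ h => lift_rel P h⟩

theorem toCrossed_mk [FiniteDimensional ℂ V] (g : Gen W) :
    toCrossed P (mk P (gen g)) = genMap P g :=
  (RingQuot.liftAlgHom_mkAlgHom_apply ℂ _ _ _).trans (lift_gen P g)

theorem toCrossed_x [FiniteDimensional ℂ V] (x : Module.Dual ℂ V) :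
    toCrossed P (Cherednik.x P x) = P.fn (P.lin x) := toCrossed_mk P _

theorem toCrossed_y [FiniteDimensional ℂ V] (y : V) :
    toCrossed P (Cherednik.y P y) = P.dk y := toCrossed_mk P _

theorem toCrossed_e [FiniteDimensional ℂ V] (b : FullReflectionSubgroup W) :
    toCrossed P (Cherednik.e P b) = P.lat b := toCrossed_mk P _

theorem toCrossed_w [FiniteDimensional ℂ V] (w : W) :
    toCrossed P (Cherednik.w P w) = P.grp w := toCrossed_mk P _

/-- A subalgebra that contains the generators is everything. -/
theorem subalgebra_eq_top (S : Subalgebra ℂ (Cherednik P)) (hx : ∀ a, x P a ∈ S)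
    (hy : ∀ a, y P a ∈ S) (he : ∀ b, e P b ∈ S) (hw : ∀ u, w P u ∈ S) : S = ⊤ := by
  refine eq_top_iff.2 fun a _ => ?_
  obtain ⟨f, rfl⟩ := RingQuot.mkAlgHom_surjective ℂ (Rel P) a
  change mk P f ∈ S
  clear * - hx hy he hw
  induction f using FreeAlgebra.induction with
  | grade0 c => rw [AlgHom.commutes]; exact S.algebraMap_mem c
  | grade1 g =>
    cases g with
    | x a => exact hx a
    | y a => exact hy a
    | e b => exact he b
    | w u => exact hw u
  | mul a b ha hb => rw [map_mul]; exact S.mul_mem ha hb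
  | add a b ha hb => rw [map_add]; exact S.add_mem ha hb

theorem e_bot : e P ⊥ = 1 := (mk_rel P Rel.e_bot).trans (map_one _)

theorem e_mul_e (b b' : FullReflectionSubgroup W) : e P b * e P b' = e P (b ⊔ b') :=
  (map_mul (mk P) _ _).symm.trans (mk_rel P (Rel.e_mul b b'))

theorem w_one : w P 1 = 1 := (mk_rel P Rel.w_one).trans (map_one _)

theorem w_mul_w (u u' : W) : w P u * w P u' = w P (u * u') :=
  (map_mul (mk P) _ _).symm.trans (mk_rel P (Rel.w_mul u u'))

theorem w_mul_e (u : W) (b : FullReflectionSubgroup W) :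
    w P u * e P b = e P (b.conj u) * w P u :=
  (map_mul (mk P) _ _).symm.trans ((mk_rel P (Rel.w_e u b)).trans (map_mul (mk P) _ _))

theorem w_mul_x (u : W) (a : Module.Dual ℂ V) :
    w P u * x P a = x P (dualMove (u : V ≃ₗ[ℂ] V) a) * w P u :=
  (map_mul (mk P) _ _).symm.trans ((mk_rel P (Rel.w_x u a)).trans (map_mul (mk P) _ _))

theorem w_mul_y (u : W) (a : V) : w P u * y P a = y P ((u : V ≃ₗ[ℂ] V) a) * w P u :=
  (map_mul (mk P) _ _).symm.trans ((mk_rel P (Rel.w_y u a)).trans (map_mul (mk P) _ _))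

theorem e_mul_x (b : FullReflectionSubgroup W) (a : Module.Dual ℂ V) :
    e P b * x P a = x P a * e P b :=
  (map_mul (mk P) _ _).symm.trans ((mk_rel P (Rel.e_x b a)).trans (map_mul (mk P) _ _))

theorem e_mul_y (b : FullReflectionSubgroup W) (a : V) : e P b * y P a = y P a * e P b :=
  (map_mul (mk P) _ _).symm.trans ((mk_rel P (Rel.e_y b a)).trans (map_mul (mk P) _ _))

theorem ofPoly_ι (a : Module.Dual ℂ V) : ofPoly P (SymmetricAlgebra.ι ℂ _ a) = x P a :=
  symLift_ι _ _ a

theorem ofPolyDual_ι (a : V) : ofPolyDual P (SymmetricAlgebra.ι ℂ _ a) = y P a :=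
  symLift_ι _ _ a

theorem w_mul_ofPoly (u : W) (p : Poly V) :
    w P u * ofPoly P p = ofPoly P (polyMove (u : V ≃ₗ[ℂ] V) p) * w P u := by
  induction p using SymmetricAlgebra.induction with
  | algebraMap c => rw [AlgHom.commutes, AlgHom.commutes, AlgHom.commutes, Algebra.commutes]
  | ι a => rw [polyMove_ι, ofPoly_ι, ofPoly_ι, w_mul_x]
  | mul p q hp hq =>
    rw [map_mul, map_mul, map_mul, ← mul_assoc, hp, mul_assoc, hq, mul_assoc]
  | add p q hp hq => rw [map_add, map_add, map_add, mul_add, add_mul, hp, hq]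

theorem e_mul_ofPoly (b : FullReflectionSubgroup W) (p : Poly V) :
    e P b * ofPoly P p = ofPoly P p * e P b := by
  induction p using SymmetricAlgebra.induction with
  | algebraMap c => rw [AlgHom.commutes, Algebra.commutes]
  | ι a => rw [ofPoly_ι, e_mul_x]
  | mul p q hp hq => rw [map_mul, ← mul_assoc, hp, mul_assoc, hq, mul_assoc]
  | add p q hp hq => rw [map_add, mul_add, add_mul, hp, hq]

/-- The subalgebra generated by `V*`, `ℂ𝓛` and `W`. -/
def degreeZero : Subalgebra ℂ (Cherednik P) :=
  Algebra.adjoin ℂ (Set.range (x P) ∪ Set.range (e P) ∪ Set.range (w P))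

theorem x_mem_degreeZero (a : Module.Dual ℂ V) : x P a ∈ degreeZero P :=
  Algebra.subset_adjoin (Or.inl (Or.inl ⟨a, rfl⟩))

theorem e_mem_degreeZero (b : FullReflectionSubgroup W) : e P b ∈ degreeZero P :=
  Algebra.subset_adjoin (Or.inl (Or.inr ⟨b, rfl⟩))

theorem w_mem_degreeZero (u : W) : w P u ∈ degreeZero P :=
  Algebra.subset_adjoin (Or.inr ⟨u, rfl⟩)

theorem degreeZero_le {S : Subalgebra ℂ (Cherednik P)} (hx : ∀ a, x P a ∈ S)
    (he : ∀ b, e P b ∈ S) (hw : ∀ u, w P u ∈ S) : degreeZero P ≤ S := by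
  refine Algebra.adjoin_le ?_
  rintro _ ((⟨a, rfl⟩ | ⟨a, rfl⟩) | ⟨a, rfl⟩)
  exacts [hx a, he a, hw a]

theorem ofPoly_mem_degreeZero (p : Poly V) : ofPoly P p ∈ degreeZero P := by
  induction p using SymmetricAlgebra.induction with
  | algebraMap c => rw [AlgHom.commutes]; exact Subalgebra.algebraMap_mem _ c
  | ι a => rw [ofPoly_ι]; exact x_mem_degreeZero P a
  | mul p q hp hq => rw [map_mul]; exact Subalgebra.mul_mem _ hp hq
  | add p q hp hq => rw [map_add]; exact Subalgebra.add_mem _ hp hq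

theorem mk_groupLift_mem (u : MonoidAlgebra ℂ W) : mk P (groupLift u) ∈ degreeZero P := by
  unfold groupLift Finsupp.sum
  rw [map_sum]
  refine Subalgebra.sum_mem _ fun w _ => ?_
  rw [map_smul]
  exact Subalgebra.smul_mem _ (w_mem_degreeZero P w) _

theorem y_x_mem (b : V) (a : Module.Dual ℂ V) :
    y P b * x P a - x P a * y P b ∈ degreeZero P := by
  have h := mk_rel P (Rel.y_x b a)
  rw [map_sub, map_mul, map_mul, map_add, AlgHom.commutes, map_sum] at h
  change y P b * x P a - x P a * y P b = _ at h
  rw [h]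
  refine Subalgebra.add_mem _ (Subalgebra.algebraMap_mem _ _) (Subalgebra.sum_mem _ fun H _ => ?_)
  rw [map_smul, map_mul]
  exact Subalgebra.smul_mem _ (Subalgebra.mul_mem _ (mk_groupLift_mem P _) (e_mem_degreeZero P _)) _

/-- The commutator with y is a derivation, and it maps V* into the subalgebra generated by V*, ℂ𝓛
and W. Hence moving y to the right across a polynomial creates no further y. -/
theorem y_ofPoly_mem (b : V) (p : Poly V) :
    y P b * ofPoly P p - ofPoly P p * y P b ∈ degreeZero P := by
  induction p using SymmetricAlgebra.induction with
  | algebraMap c =>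
    rw [AlgHom.commutes, Algebra.commutes, sub_self]
    exact Subalgebra.zero_mem _
  | ι a => rw [ofPoly_ι]; exact y_x_mem P b a
  | mul p q hp hq =>
    have e : y P b * ofPoly P (p * q) - ofPoly P (p * q) * y P b =
        (y P b * ofPoly P p - ofPoly P p * y P b) * ofPoly P q +
          ofPoly P p * (y P b * ofPoly P q - ofPoly P q * y P b) := by
      rw [map_mul]
      noncomm_ring
    rw [e]
    exact Subalgebra.add_mem _ (Subalgebra.mul_mem _ hp (ofPoly_mem_degreeZero P q))
      (Subalgebra.mul_mem _ (ofPoly_mem_degreeZero P p) hq)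
  | add p q hp hq =>
    rw [map_add, mul_add, add_mul, add_sub_add_comm]
    exact Subalgebra.add_mem _ hp hq

/-- The span of the products `p e_b w q`. -/
def ordered : Submodule ℂ (Cherednik P) :=
  Submodule.span ℂ {z | ∃ p b u q, z = ofPoly P p * (e P b * (w P u * ofPolyDual P q))}

/-- The left multipliers of `ordered P`. -/
def multipliers : Subalgebra ℂ (Cherednik P) where
  carrier := {a | ∀ z ∈ ordered P, a * z ∈ ordered P}
  mul_mem' := fun {a b} ha hb z hz => by rw [mul_assoc]; exact ha _ (hb _ hz)
  add_mem' := fun {a b} ha hb z hz => by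
    rw [add_mul]
    exact (ordered P).add_mem (ha _ hz) (hb _ hz)
  algebraMap_mem' := fun c z hz => by
    rw [← Algebra.smul_def]
    exact (ordered P).smul_mem c hz

theorem mem_multipliers {a : Cherednik P}
    (h : ∀ p b u q, a * (ofPoly P p * (e P b * (w P u * ofPolyDual P q))) ∈ ordered P) :
    a ∈ multipliers P := by
  intro z hz
  induction hz using Submodule.span_induction with
  | mem z hz =>
    obtain ⟨p, b, u, q, rfl⟩ := hz
    exact h p b u q
  | zero => rw [mul_zero]; exact (ordered P).zero_mem
  | add z z' _ _ hz hz' => rw [mul_add]; exact (ordered P).add_mem hz hz'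
  | smul c z _ hz => rw [mul_smul_comm]; exact (ordered P).smul_mem c hz

/-- For x, e_λ and w the exchange rules suffice. For y, write y p = [y, p] + p y: the commutator
lies in `degreeZero P`, already known to consist of multipliers, and in p y the y moves past e_b and
w to join the last factor. -/
theorem multipliers_eq_top : multipliers P = ⊤ := by
  have hx : ∀ a, x P a ∈ multipliers P := fun a => mem_multipliers P fun p b u q => by
    rw [← ofPoly_ι, ← mul_assoc, ← map_mul]
    exact Submodule.subset_span ⟨_, b, u, q, rfl⟩
  have he : ∀ b, e P b ∈ multipliers P := fun b' => mem_multipliers P fun p b u q => by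
    rw [← mul_assoc, e_mul_ofPoly, mul_assoc, ← mul_assoc (e P b'), e_mul_e]
    exact Submodule.subset_span ⟨p, _, u, q, rfl⟩
  have hw : ∀ u, w P u ∈ multipliers P := fun u' => mem_multipliers P fun p b u q => by
    rw [← mul_assoc, w_mul_ofPoly, mul_assoc, ← mul_assoc (w P u'), w_mul_e, mul_assoc (e P _),
      ← mul_assoc (w P u'), w_mul_w]
    exact Submodule.subset_span ⟨_, _, _, q, rfl⟩
  refine subalgebra_eq_top P _ hx (fun a => mem_multipliers P fun p b u q => ?_) he hw
  have h1 := degreeZero_le P hx he hw (y_ofPoly_mem P a p) (e P b * (w P u * ofPolyDual P q))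
    (Submodule.subset_span ⟨1, b, u, q, by rw [map_one, one_mul]⟩)
  have h2 : ofPoly P p * (y P a * (e P b * (w P u * ofPolyDual P q))) ∈ ordered P := by
    have h3 : y P a * w P u = w P u * y P ((u : V ≃ₗ[ℂ] V).symm a) := by
      rw [w_mul_y, LinearEquiv.apply_symm_apply]
    rw [← mul_assoc (y P a), ← e_mul_y, mul_assoc (e P b), ← mul_assoc (y P a), h3,
      mul_assoc (w P u), ← ofPolyDual_ι, ← map_mul]
    exact Submodule.subset_span ⟨p, b, u, _, rfl⟩
  have h3 := (ordered P).add_mem h1 h2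
  rwa [sub_mul, mul_assoc, mul_assoc, sub_add_cancel] at h3

theorem triangular_tmul (p : Poly V) (m : MobiusAlgebra W) (u : MonoidAlgebra ℂ W)
    (q : SymmetricAlgebra ℂ V) : triangular P (p ⊗ₜ (m ⊗ₜ (u ⊗ₜ q))) =
      ofPoly P p * (ofMobius P m * (ofGroupAlgebra P u * ofPolyDual P q)) := rfl

theorem ofMobius_single (b : FullReflectionSubgroup W) :
    ofMobius P (MonoidAlgebra.single b 1) = e P b :=
  (MonoidAlgebra.lift_single _ _ _).trans (one_smul _ _)

theorem ofGroupAlgebra_single (u : W) :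
    ofGroupAlgebra P (MonoidAlgebra.single u 1) = w P u :=
  (MonoidAlgebra.lift_single _ _ _).trans (one_smul _ _)

theorem triangular_surjective : Function.Surjective (triangular P) := by
  have hle : ordered P ≤ LinearMap.range (triangular P) := by
    refine Submodule.span_le.2 ?_
    rintro _ ⟨p, b, u, q, rfl⟩
    exact ⟨p ⊗ₜ (MonoidAlgebra.single b 1 ⊗ₜ (MonoidAlgebra.single u 1 ⊗ₜ q)), by
      rw [triangular_tmul, ofMobius_single, ofGroupAlgebra_single]⟩
  intro a
  have h1 : (1 : Cherednik P) ∈ ordered P := Submodule.subset_span ⟨1, ⊥, 1, 1, by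
    simp [e_bot, w_one]⟩
  have h2 : a ∈ multipliers P := by rw [multipliers_eq_top]; exact Algebra.mem_top
  have h3 := h2 1 h1
  rw [mul_one] at h3
  exact hle h3

end Cherednik
end LatticeCherednik
end

/-! ### Symbols and the filtration by order -/

noncomputable section
namespace LatticeCherednik

section OrderLT

variable {k R : Type*} [CommRing k] [CommRing R] [Algebra k R]

/-- Differential operators of order less than `n`. -/
def OrderLT : ℕ → Module.End k R → Prop
  | 0, D => D = 0
  | n + 1, D => IsDiffOp n D

/-- With the strict bound, index 0 means the zero operator, so a commutator lowers the index even
for operators of order zero; `IsDiffOp` alone has no index for this. -/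
theorem OrderLT.commutator {n : ℕ} {D : Module.End k R} (hD : OrderLT (n + 1) D) (f : R) :
    OrderLT n (D * mulOp k R f - mulOp k R f * D) := by
  cases n with
  | zero => exact hD f
  | succ n => exact hD f

theorem OrderLT.mono {m n : ℕ} (h : m ≤ n) {D : Module.End k R} (hD : OrderLT m D) :
    OrderLT n D := by
  cases n with
  | zero => rwa [Nat.le_zero.1 h] at hD
  | succ n =>
    cases m with
    | zero => exact (show D = 0 from hD) ▸ isDiffOp_zero n
    | succ m => exact IsDiffOp.mono (Nat.le_of_succ_le_succ h) hD

theorem orderLT_zero (n : ℕ) : OrderLT n (0 : Module.End k R) :=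
  OrderLT.mono (Nat.zero_le n) rfl

theorem OrderLT.add {n : ℕ} {D D' : Module.End k R} (hD : OrderLT n D) (hD' : OrderLT n D') :
    OrderLT n (D + D') := by
  cases n with
  | zero => exact (congrArg₂ (· + ·) hD hD').trans (add_zero 0)
  | succ n => exact IsDiffOp.add hD hD'

theorem OrderLT.smul {n : ℕ} (c : k) {D : Module.End k R} (hD : OrderLT n D) :
    OrderLT n (c • D) := by
  cases n with
  | zero => exact (congrArg (c • ·) hD).trans (smul_zero c)
  | succ n => exact IsDiffOp.smul c hD

theorem OrderLT.mul_left {m n : ℕ} {E D : Module.End k R} (hE : IsDiffOp m E)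
    (hD : OrderLT n D) : OrderLT (n + m) (E * D) := by
  cases n with
  | zero =>
    rw [show D = 0 from hD, mul_zero]
    exact orderLT_zero _
  | succ n =>
    rw [Nat.succ_add, Nat.add_comm]
    exact IsDiffOp.mul hE hD

theorem OrderLT.conj (φ : R ≃ₐ[k] R) {n : ℕ} {D : Module.End k R} (hD : OrderLT n D) :
    OrderLT n (φ.toLinearEquiv.conjAlgEquiv k D) := by
  cases n with
  | zero =>
    rw [show D = 0 from hD, map_zero]
    rfl
  | succ n => exact IsDiffOp.conj φ hD

end OrderLT

namespace Data

variable {V : Type*} [AddCommGroup V] [Module ℂ V] {W : Subgroup (V ≃ₗ[ℂ] V)} [Finite W]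
  (P : Data W)

/-- Differential operators with constant coefficients. -/
def constD : SymmetricAlgebra ℂ V →ₐ[ℂ] P.DiffRing :=
  symLift { toFun := P.pd, map_add' := P.pd_add, map_smul' := P.pd_smul } P.pd_comm

theorem constD_ι (y : V) : P.constD (SymmetricAlgebra.ι ℂ V y) = P.pd y := symLift_ι _ _ y

/-- The polynomials in the derivatives along the vectors `v i`. -/
def polyD {ι : Type*} (v : ι → V) : MvPolynomial ι ℂ →ₐ[ℂ] P.DiffRing :=
  P.constD.comp (MvPolynomial.aeval fun i => SymmetricAlgebra.ι ℂ V (v i))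

theorem polyD_X {ι : Type*} (v : ι → V) (i : ι) : P.polyD v (MvPolynomial.X i) = P.pd (v i) := by
  unfold polyD
  rw [AlgHom.comp_apply, MvPolynomial.aeval_X, constD_ι]

theorem conjD_polyD {ι : Type*} (v : ι → V) (w : W) (p : MvPolynomial ι ℂ) :
    P.conjD w (P.polyD v p) = P.polyD (fun i => (w : V ≃ₗ[ℂ] V) (v i)) p := by
  induction p using MvPolynomial.induction_on with
  | C c => rw [← MvPolynomial.algebraMap_eq, AlgHom.commutes, AlgHom.commutes, AlgHom.commutes]
  | add p q hp hq => rw [map_add, map_add, map_add, hp, hq]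
  | mul_X p i hp => rw [map_mul, map_mul, map_mul, hp, polyD_X, polyD_X, conj_pd]

theorem polyD_mul_lin {ι : Type*} (b : Module.Basis ι ℂ V) (i : ι) (p : MvPolynomial ι ℂ) :
    P.polyD b p * P.fnD (P.lin (b.coord i)) - P.fnD (P.lin (b.coord i)) * P.polyD b p =
      P.polyD b (MvPolynomial.pderiv i p) := by
  induction p using MvPolynomial.induction_on with
  | C c =>
    rw [MvPolynomial.pderiv_C, map_zero, ← MvPolynomial.algebraMap_eq, AlgHom.commutes,
      Algebra.commutes, sub_self]
  | add p q hp hq => rw [map_add, map_add, map_add, add_mul, mul_add, add_sub_add_comm, hp, hq]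
  | mul_X p j hp =>
    rw [MvPolynomial.pderiv_mul, map_add, map_mul, map_mul, map_mul, ← hp, polyD_X]
    have h : P.pd (b j) * P.fnD (P.lin (b.coord i)) = P.fnD (P.lin (b.coord i)) * P.pd (b j) +
        P.polyD b (MvPolynomial.pderiv i (MvPolynomial.X j)) := by
      rw [pd_lin]
      congr 1
      classical
      rw [MvPolynomial.pderiv_X, Module.Basis.coord_apply, Module.Basis.repr_self,
        Finsupp.single_apply, Pi.single_apply]
      split_ifs <;> simp
    rw [mul_assoc, h]
    noncomm_ring

theorem polyD_apply_one {ι : Type*} (v : ι → V) (p : MvPolynomial ι ℂ) :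
    P.toEnd (P.polyD v p) 1 = algebraMap ℂ P.RegFun (MvPolynomial.constantCoeff p) := by
  induction p using MvPolynomial.induction_on with
  | C c =>
    rw [← MvPolynomial.algebraMap_eq, AlgHom.commutes, AlgHom.commutes, MvPolynomial.algebraMap_eq,
      MvPolynomial.constantCoeff_C, Module.algebraMap_end_apply, Algebra.algebraMap_eq_smul_one]
  | add p q hp hq => rw [map_add, map_add, LinearMap.add_apply, hp, hq, map_add, map_add]
  | mul_X p j hp =>
    rw [map_mul, map_mul, Module.End.mul_apply, polyD_X, pd_one, map_zero, map_mul,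
      MvPolynomial.constantCoeff_X, mul_zero, map_zero]

/-- The differential operator `∑ f_α ∂^α`. -/
def symbolD {ι : Type*} (v : ι → V) : MvPolynomial ι P.RegFun →+ P.DiffRing :=
  (Finsupp.liftAddHom fun α : ι →₀ ℕ =>
    (AddMonoidHom.mulRight (P.polyD v (MvPolynomial.monomial α 1))).comp
      (P.fnD : P.RegFun →+ P.DiffRing)).comp
    (AddMonoidAlgebra.coeffAddEquiv.toAddMonoidHom)

theorem symbolD_monomial {ι : Type*} (v : ι → V) (α : ι →₀ ℕ) (f : P.RegFun) :
    P.symbolD v (MvPolynomial.monomial α f) =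
      P.fnD f * P.polyD v (MvPolynomial.monomial α 1) :=
  Finsupp.liftAddHom_apply_single _ _ _

/-- Functions commute with the coordinate, and on constant coefficient operators the commutator is
the formal derivative in the i-th variable. Iterating it extracts the coefficients of the symbol. -/
theorem symbolD_mul_lin {ι : Type*} (b : Module.Basis ι ℂ V) (i : ι)
    (Q : MvPolynomial ι P.RegFun) :
    P.symbolD b Q * P.fnD (P.lin (b.coord i)) - P.fnD (P.lin (b.coord i)) * P.symbolD b Q =
      P.symbolD b (MvPolynomial.pderiv i Q) := by
  induction Q using MvPolynomial.induction_on' with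
  | monomial α f =>
    have h := P.polyD_mul_lin b i (MvPolynomial.monomial α 1)
    rw [MvPolynomial.pderiv_monomial, one_mul] at h
    have h' : P.polyD b (MvPolynomial.monomial (α - Finsupp.single i 1) (α i : ℂ)) =
        P.fnD (α i : P.RegFun) *
          P.polyD b (MvPolynomial.monomial (α - Finsupp.single i 1) 1) := by
      rw [map_natCast P.fnD, ← map_natCast (P.polyD b), ← map_mul,
        ← map_natCast (MvPolynomial.C : ℂ →+* MvPolynomial ι ℂ), MvPolynomial.C_mul_monomial,
        mul_one]
    rw [MvPolynomial.pderiv_monomial, symbolD_monomial, symbolD_monomial, map_mul,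
      mul_assoc (P.fnD f) (P.fnD _), ← h', ← h, mul_sub, mul_assoc, ← mul_assoc (P.fnD (P.lin _)),
      fnD_comm P (P.lin _) f, mul_assoc (P.fnD f)]
  | add p q hp hq => rw [map_add, map_add, map_add, add_mul, mul_add, add_sub_add_comm, hp, hq]

theorem symbolD_apply_one {ι : Type*} (v : ι → V) (Q : MvPolynomial ι P.RegFun) :
    P.toEnd (P.symbolD v Q) 1 = MvPolynomial.constantCoeff Q := by
  induction Q using MvPolynomial.induction_on' with
  | monomial α f =>
    rw [symbolD_monomial, map_mul, Module.End.mul_apply, polyD_apply_one, toEnd_fnD]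
    classical
    rw [MvPolynomial.constantCoeff_monomial, MvPolynomial.constantCoeff_monomial]
    split_ifs <;> simp
  | add p q hp hq => rw [map_add, map_add, LinearMap.add_apply, hp, hq, map_add]

/-- The order of `∑ f_α ∂^α` is the degree of the symbol. -/
theorem coeff_eq_zero_of_orderLT {ι : Type*} (b : Module.Basis ι ℂ V) (N : ℕ) :
    ∀ (n : ℕ) (Q : MvPolynomial ι P.RegFun), OrderLT n (P.toEnd (P.symbolD b Q)) → n ≤ N →
      ∀ α : ι →₀ ℕ, α.degree = N → MvPolynomial.coeff α Q = 0 := by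
  induction N with
  | zero =>
    intro n Q hQ hn α hα
    rw [Nat.le_zero.1 hn] at hQ
    rw [(Finsupp.degree_eq_zero_iff α).1 hα, ← MvPolynomial.constantCoeff_eq,
      ← P.symbolD_apply_one b, show P.toEnd (P.symbolD b Q) = 0 from hQ, LinearMap.zero_apply]
  | succ N ih =>
    intro n Q hQ hn α hα
    obtain ⟨i, hi⟩ : ∃ i, α i ≠ 0 := by
      by_contra! h
      rw [show α = 0 from Finsupp.ext h, map_zero] at hα
      exact Nat.succ_ne_zero N hα.symm
    obtain ⟨β, rfl⟩ : ∃ β, α = β + Finsupp.single i 1 :=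
      ⟨α - Finsupp.single i 1, (tsub_add_cancel_of_le (Finsupp.single_le_iff.2
        (Nat.one_le_iff_ne_zero.2 hi))).symm⟩
    rw [map_add, Finsupp.degree_single] at hα
    -- The subtraction is truncated: for n = 0 the bound is first weakened to 1.
    have h1 : OrderLT (n - 1) (P.toEnd (P.symbolD b (MvPolynomial.pderiv i Q))) := by
      rw [← symbolD_mul_lin, map_sub, map_mul, map_mul, toEnd_fnD]
      exact (hQ.mono (by omega : n ≤ n - 1 + 1)).commutator _
    have h2 := ih (n - 1) _ h1 (by omega) β (by omega)
    -- The derivative multiplies the wanted coefficient by β_i + 1, nonzero in characteristic zero.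
    rw [MvPolynomial.coeff_pderiv] at h2
    refine (mul_eq_zero.1 h2).resolve_right ?_
    rw [← Nat.cast_succ, ← map_natCast (algebraMap ℂ P.RegFun)]
    exact (map_ne_zero _).2 (Nat.cast_ne_zero.2 (Nat.succ_ne_zero _))

/-- The filtration of the crossed product by the order of differential operators: the elements
of order less than `n`. -/
def fil (n : ℕ) : Submodule ℂ P.CrossedRing :=
  Submodule.span ℂ {z | ∃ D b w, OrderLT n (P.toEnd D) ∧ z = P.ofD D * P.lat b * P.grp w}

theorem fil_mono {m n : ℕ} (h : m ≤ n) : P.fil m ≤ P.fil n := by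
  refine Submodule.span_mono ?_
  rintro _ ⟨D, b, w, hD, rfl⟩
  exact ⟨D, b, w, hD.mono h, rfl⟩

theorem orderLT_coef {n : ℕ} {z : P.CrossedRing} (hz : z ∈ P.fil n) (w : W)
    (b : FullReflectionSubgroup W) : OrderLT n (P.toEnd (P.coef w b z)) := by
  classical
  induction hz using Submodule.span_induction with
  | mem z hz =>
    obtain ⟨D, b', w', hD, rfl⟩ := hz
    rw [coef_mon]
    split_ifs
    · exact hD
    · rw [map_zero]; exact orderLT_zero n
  | zero => rw [map_zero, map_zero]; exact orderLT_zero n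
  | add z z' _ _ h h' => rw [map_add, map_add]; exact h.add h'
  | smul c z _ h => rw [map_smul, map_smul]; exact h.smul c

theorem mul_mem_fil {m n : ℕ} {t : P.CrossedRing}
    (h : ∀ D b w, OrderLT m (P.toEnd D) → t * (P.ofD D * P.lat b * P.grp w) ∈ P.fil n)
    {z : P.CrossedRing} (hz : z ∈ P.fil m) : t * z ∈ P.fil n := by
  induction hz using Submodule.span_induction with
  | mem z hz =>
    obtain ⟨D, b, w, hD, rfl⟩ := hz
    exact h D b w hD
  | zero => rw [mul_zero]; exact Submodule.zero_mem _
  | add z z' _ _ h h' => rw [mul_add]; exact Submodule.add_mem _ h h'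
  | smul c z _ h => rw [mul_smul_comm]; exact Submodule.smul_mem _ c h

theorem ofD_mul_mem_fil {m n : ℕ} {E : P.DiffRing} (hE : IsDiffOp m (P.toEnd E))
    {z : P.CrossedRing} (hz : z ∈ P.fil n) : P.ofD E * z ∈ P.fil (n + m) := by
  refine P.mul_mem_fil (fun D b w hD => ?_) hz
  rw [← mul_assoc, ← mul_assoc, ← map_mul]
  refine Submodule.subset_span ⟨_, b, w, ?_, rfl⟩
  rw [map_mul]
  exact hD.mul_left hE

theorem fn_mul_mem_fil {n : ℕ} (f : P.RegFun) {z : P.CrossedRing} (hz : z ∈ P.fil n) :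
    P.fn f * z ∈ P.fil n :=
  P.ofD_mul_mem_fil (m := 0) (isDiffOp_mulOp f) hz

theorem der_mul_mem_fil {n : ℕ} (y : V) {z : P.CrossedRing} (hz : z ∈ P.fil n) :
    P.der y * z ∈ P.fil (n + 1) :=
  P.ofD_mul_mem_fil (m := 1) (isDiffOp_one_of_leibniz _ (P.deriv_mul y)) hz

theorem lat_mul_mem_fil {n : ℕ} (c : FullReflectionSubgroup W) {z : P.CrossedRing}
    (hz : z ∈ P.fil n) : P.lat c * z ∈ P.fil n := by
  refine P.mul_mem_fil (fun D b w hD => Submodule.subset_span ⟨D, c ⊔ b, w, hD, ?_⟩) hz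
  rw [← mul_assoc, ← mul_assoc, lat_mul_ofD, mul_assoc (P.ofD D), lat_mul_lat]

theorem grp_mul_mem_fil {n : ℕ} (u : W) {z : P.CrossedRing}
    (hz : z ∈ P.fil n) : P.grp u * z ∈ P.fil n := by
  refine P.mul_mem_fil (fun D b w hD => Submodule.subset_span
    ⟨P.conjD u D, b.conj u, u * w, hD.conj (P.regAut u), ?_⟩) hz
  rw [← mul_assoc, ← mul_assoc, grp_mul_ofD, mul_assoc (P.ofD _), grp_mul_lat, map_mul]
  simp only [mul_assoc]

theorem gAlg_mul_mem_fil {n : ℕ} (u : MonoidAlgebra ℂ W) {z : P.CrossedRing}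
    (hz : z ∈ P.fil n) : P.gAlg u * z ∈ P.fil n := by
  induction u using MonoidAlgebra.induction_linear with
  | zero => rw [map_zero, zero_mul]; exact Submodule.zero_mem _
  | add u u' h h' => rw [map_add, add_mul]; exact Submodule.add_mem _ h h'
  | single w c =>
    rw [gAlg_single, smul_mul_assoc]
    exact Submodule.smul_mem _ c (P.grp_mul_mem_fil w hz)

/-- T_y − ∂_y involves only functions, group elements and lattice elements, none of which raises the
order. -/
theorem dk_sub_der_mul_mem_fil {n : ℕ} (y : V) {z : P.CrossedRing} (hz : z ∈ P.fil n) :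
    (P.dk y - P.der y) * z ∈ P.fil n := by
  unfold dk dunklPart
  rw [add_sub_cancel_left, Finset.sum_mul]
  refine Submodule.sum_mem _ fun H _ => ?_
  rw [smul_mul_assoc, mul_assoc, mul_assoc]
  exact Submodule.smul_mem _ _ (P.fn_mul_mem_fil _ (P.gAlg_mul_mem_fil _ (P.lat_mul_mem_fil _ hz)))

theorem dk_mul_mem_fil {n : ℕ} (y : V) {z : P.CrossedRing} (hz : z ∈ P.fil n) :
    P.dk y * z ∈ P.fil (n + 1) := by
  have h : P.dk y * z = (P.dk y - P.der y) * z + P.der y * z := by noncomm_ring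
  rw [h]
  exact Submodule.add_mem _ (P.fil_mono n.le_succ (P.dk_sub_der_mul_mem_fil y hz))
    (P.der_mul_mem_fil y hz)

theorem one_mem_fil : (1 : P.CrossedRing) ∈ P.fil 1 := by
  refine Submodule.subset_span ⟨1, ⊥, 1, ?_, by rw [map_one, map_one, lat_bot, one_mul, one_mul]⟩
  rw [map_one, ← map_one (mulOp ℂ P.RegFun)]
  exact isDiffOp_mulOp 1

end Data
end LatticeCherednik
end

/-! ### Independence of Dunkl monomials, PBW and injectivity of Φ -/

noncomputable section
namespace LatticeCherednik

namespace Cherednik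

variable {V : Type*} [AddCommGroup V] [Module ℂ V] {W : Subgroup (V ≃ₗ[ℂ] V)} [Finite W]
  [FiniteDimensional ℂ V] (P : Data W)

theorem toCrossed_ofPoly (p : Poly V) :
    toCrossed P (ofPoly P p) = P.fn (algebraMap (Poly V) P.RegFun p) := by
  induction p using SymmetricAlgebra.induction with
  | algebraMap c =>
    rw [AlgHom.commutes, AlgHom.commutes, ← IsScalarTower.algebraMap_apply, AlgHom.commutes]
  | ι a => rw [ofPoly_ι]; exact toCrossed_x P a
  | mul p q hp hq => rw [map_mul, map_mul, map_mul, map_mul, hp, hq]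
  | add p q hp hq => rw [map_add, map_add, map_add, map_add, hp, hq]

/-- The polynomials in the Dunkl operators along the vectors `v i`. -/
def dunklPoly {ι : Type*} (v : ι → V) : MvPolynomial ι ℂ →ₐ[ℂ] P.CrossedRing :=
  (toCrossed P).comp ((ofPolyDual P).comp
    (MvPolynomial.aeval fun i => SymmetricAlgebra.ι ℂ V (v i)))

theorem dunklPoly_X {ι : Type*} (v : ι → V) (i : ι) :
    dunklPoly P v (MvPolynomial.X i) = P.dk (v i) := by
  unfold dunklPoly
  rw [AlgHom.comp_apply, AlgHom.comp_apply, MvPolynomial.aeval_X, ofPolyDual_ι, toCrossed_y]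

/-- The principal symbol of a monomial in the Dunkl operators is that of the corresponding
monomial in the derivatives. -/
theorem dunklPoly_monomial {ι : Type*} (v : ι → V) (N : ℕ) : ∀ α : ι →₀ ℕ, α.degree = N →
    dunklPoly P v (MvPolynomial.monomial α 1) ∈ P.fil (N + 1) ∧
    dunklPoly P v (MvPolynomial.monomial α 1) - P.ofD (P.polyD v (MvPolynomial.monomial α 1)) ∈
      P.fil N := by
  induction N with
  | zero =>
    intro α hα
    rw [(Finsupp.degree_eq_zero_iff α).1 hα, show MvPolynomial.monomial 0 (1 : ℂ) = 1 from rfl,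
      map_one, map_one, map_one, sub_self]
    exact ⟨P.one_mem_fil, Submodule.zero_mem _⟩
  | succ N ih =>
    intro α hα
    obtain ⟨i, hi⟩ : ∃ i, α i ≠ 0 := by
      by_contra! h
      rw [show α = 0 from Finsupp.ext h, map_zero] at hα
      exact Nat.succ_ne_zero N hα.symm
    obtain ⟨β, rfl⟩ : ∃ β, α = Finsupp.single i 1 + β :=
      ⟨α - Finsupp.single i 1, (add_tsub_cancel_of_le (Finsupp.single_le_iff.2
        (Nat.one_le_iff_ne_zero.2 hi))).symm⟩
    rw [map_add, Finsupp.degree_single] at hα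
    obtain ⟨h1, h2⟩ := ih β (by omega)
    have hX : MvPolynomial.monomial (Finsupp.single i 1 + β) (1 : ℂ) =
        MvPolynomial.X i * MvPolynomial.monomial β 1 := by
      rw [MvPolynomial.X, MvPolynomial.monomial_mul, one_mul]
    rw [hX, map_mul, map_mul, map_mul, dunklPoly_X, Data.polyD_X]
    refine ⟨P.dk_mul_mem_fil _ h1, ?_⟩
    -- In the first term T − ∂ does not raise the order of T^β; in the second, ∂ raises by one the
    -- order of a difference already small by induction.
    have e : P.dk (v i) * dunklPoly P v (MvPolynomial.monomial β 1) -
        P.ofD (P.pd (v i)) * P.ofD (P.polyD v (MvPolynomial.monomial β 1)) =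
        (P.dk (v i) - P.der (v i)) * dunklPoly P v (MvPolynomial.monomial β 1) +
        P.der (v i) * (dunklPoly P v (MvPolynomial.monomial β 1) -
          P.ofD (P.polyD v (MvPolynomial.monomial β 1))) := by
      rw [show P.ofD (P.pd (v i)) = P.der (v i) from rfl]
      noncomm_ring
    rw [e]
    exact Submodule.add_mem _ (P.dk_sub_der_mul_mem_fil _ h1) (P.der_mul_mem_fil _ h2)

/-- The products `f e_λ w T^α` with monomials in the Dunkl operators are linearly independent over
the regular functions. -/
theorem eq_zero_of_sum_dunklPoly {ι : Type*} (b : Module.Basis ι ℂ V)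
    (s : Finset (FullReflectionSubgroup W × W × (ι →₀ ℕ)))
    (f : FullReflectionSubgroup W × W × (ι →₀ ℕ) → P.RegFun)
    (h : ∑ k ∈ s, P.fn (f k) * (P.lat k.1 * (P.grp k.2.1 *
      dunklPoly P b (MvPolynomial.monomial k.2.2 1))) = 0) : ∀ k ∈ s, f k = 0 := by
  classical
  by_contra! hne
  obtain ⟨k₁, hk₁, hf₁⟩ := hne
  -- Take a nonzero term of maximal degree N. Replacing every T^α by ∂^α then changes the sum only
  -- by terms of order less than N.
  obtain ⟨k₀, hk₀, hmax⟩ := Finset.exists_max_image (s.filter fun k => f k ≠ 0)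
    (fun k => k.2.2.degree) ⟨k₁, Finset.mem_filter.2 ⟨hk₁, hf₁⟩⟩
  obtain ⟨hk₀s, hf₀⟩ := Finset.mem_filter.1 hk₀
  set N := k₀.2.2.degree with hN
  have hfil : ∑ k ∈ s, P.fn (f k) * (P.lat k.1 * (P.grp k.2.1 *
      P.ofD (P.polyD b (MvPolynomial.monomial k.2.2 1)))) ∈ P.fil N := by
    have e : ∑ k ∈ s, P.fn (f k) * (P.lat k.1 * (P.grp k.2.1 *
        P.ofD (P.polyD b (MvPolynomial.monomial k.2.2 1)))) =
        - ∑ k ∈ s, P.fn (f k) * (P.lat k.1 * (P.grp k.2.1 *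
          (dunklPoly P b (MvPolynomial.monomial k.2.2 1) -
            P.ofD (P.polyD b (MvPolynomial.monomial k.2.2 1))))) := by
      simp only [mul_sub, Finset.sum_sub_distrib]
      rw [h, zero_sub, neg_neg]
    rw [e]
    refine Submodule.neg_mem _ (Submodule.sum_mem _ fun k hk => ?_)
    by_cases hfk : f k = 0
    · rw [hfk, map_zero, zero_mul]
      exact Submodule.zero_mem _
    · exact P.fn_mul_mem_fil _ (P.lat_mul_mem_fil _ (P.grp_mul_mem_fil _
        (P.fil_mono (hmax k (Finset.mem_filter.2 ⟨hk, hfk⟩))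
          (dunklPoly_monomial P b _ k.2.2 rfl).2)))
  -- In normal form the group element stands to the right of the derivatives; moving it there turns
  -- them into derivatives along the translated basis.
  set b' := b.map ((k₀.2.1 : W) : V ≃ₗ[ℂ] V) with hb'
  set Q : MvPolynomial ι P.RegFun :=
    ∑ k ∈ s, if k.2.1 = k₀.2.1 ∧ k.1 = k₀.1 then MvPolynomial.monomial k.2.2 (f k) else 0 with hQ
  have hcoef : P.coef k₀.2.1 k₀.1 (∑ k ∈ s, P.fn (f k) * (P.lat k.1 * (P.grp k.2.1 *
      P.ofD (P.polyD b (MvPolynomial.monomial k.2.2 1))))) = P.symbolD b' Q := by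
    rw [hQ, map_sum, map_sum]
    refine Finset.sum_congr rfl fun k _ => ?_
    have e : P.fn (f k) * (P.lat k.1 * (P.grp k.2.1 *
        P.ofD (P.polyD b (MvPolynomial.monomial k.2.2 1)))) =
        P.ofD (P.fnD (f k) * P.polyD (fun i => ((k.2.1 : W) : V ≃ₗ[ℂ] V) (b i))
          (MvPolynomial.monomial k.2.2 1)) * P.lat k.1 * P.grp k.2.1 := by
      rw [P.grp_mul_ofD, P.conjD_polyD, ← mul_assoc (P.lat _), P.lat_mul_ofD, map_mul]
      simp only [mul_assoc]
      rfl
    rw [e, P.coef_mon]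
    by_cases hk : k.2.1 = k₀.2.1 ∧ k.1 = k₀.1
    · rw [if_pos hk, if_pos hk, P.symbolD_monomial, hk.1]
      rfl
    · rw [if_neg hk, if_neg hk, map_zero]
  have hz := P.coeff_eq_zero_of_orderLT b' N N Q
    (hcoef ▸ P.orderLT_coef hfil k₀.2.1 k₀.1) le_rfl k₀.2.2 rfl
  apply hf₀
  rw [← hz, hQ, MvPolynomial.coeff_sum, Finset.sum_eq_single k₀]
  · rw [if_pos ⟨rfl, rfl⟩, MvPolynomial.coeff_monomial, if_pos rfl]
  · intro k _ hk
    by_cases hk' : k.2.1 = k₀.2.1 ∧ k.1 = k₀.1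
    · rw [if_pos hk', MvPolynomial.coeff_monomial, if_neg]
      intro h3
      exact hk (Prod.ext hk'.2 (Prod.ext hk'.1 h3))
    · rw [if_neg hk', MvPolynomial.coeff_zero]
  · exact fun h => (h hk₀s).elim

theorem toCrossed_comp_triangular_injective :
    Function.Injective ((toCrossed P).toLinearMap ∘ₗ triangular P) := by
  classical
  refine (injective_iff_map_eq_zero _).2 fun z hz => ?_
  let b := Module.finBasis ℂ V
  -- A basis of the last three factors turns an element of the tensor product into a finite family
  -- of polynomials, and ℂ[V] embeds in ℂ[X], over which independence is known.
  let B := (MonoidAlgebra.basis (FullReflectionSubgroup W) ℂ).tensorProduct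
    ((MonoidAlgebra.basis W ℂ).tensorProduct b.symmetricAlgebra)
  obtain ⟨c, rfl⟩ := (TensorProduct.equivFinsuppOfBasisRight (M := Poly V) B).symm.surjective z
  have hB : ∀ k, B k = MonoidAlgebra.single k.1 1 ⊗ₜ[ℂ] (MonoidAlgebra.single k.2.1 1 ⊗ₜ[ℂ]
      MvPolynomial.aeval (fun i => SymmetricAlgebra.ι ℂ V (b i))
        (MvPolynomial.monomial k.2.2 (1 : ℂ))) := fun k => by
    rw [Module.Basis.tensorProduct_apply', Module.Basis.tensorProduct_apply',
      MonoidAlgebra.basis_apply, MonoidAlgebra.basis_apply]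
    rfl
  suffices hc : c = 0 by rw [hc, map_zero]
  rw [TensorProduct.equivFinsuppOfBasisRight_symm_apply, map_finsuppSum] at hz
  have h := eq_zero_of_sum_dunklPoly P b c.support
    (fun k => algebraMap (Poly V) P.RegFun (c k)) (by
      rw [← hz]
      refine Finset.sum_congr rfl fun k _ => ?_
      change _ = toCrossed P (triangular P (c k ⊗ₜ[ℂ] B k))
      rw [hB, triangular_tmul, ofMobius_single, ofGroupAlgebra_single, map_mul,
        map_mul, map_mul, toCrossed_ofPoly, toCrossed_e, toCrossed_w]
      rfl)
  ext k
  by_contra hk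
  exact hk (P.algebraMap_injective ((h k (Finsupp.mem_support_iff.2 hk)).trans (map_zero _).symm))

theorem triangular_bijective : Function.Bijective (triangular P) :=
  ⟨Function.Injective.of_comp (toCrossed_comp_triangular_injective P), triangular_surjective P⟩

theorem toCrossed_injective : Function.Injective (toCrossed P) :=
  Function.Injective.of_comp_right (toCrossed_comp_triangular_injective P)
    (triangular_surjective P)

end Cherednik
end LatticeCherednik
end

/-! ### Ore localization at the powers of δ -/

noncomputable section
namespace LatticeCherednik

namespace AdjoinInv

variable {A : Type*} [Ring A] [Algebra ℂ A] {d : A}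

variable (d) in
/-- The adjoined inverse. -/
def inv : AdjoinInv A d := RingQuot.mkAlgHom ℂ (InvRel A d) (FreeAlgebra.ι ℂ none)

theorem of_mul_inv : of A d d * inv d = 1 :=
  (map_mul _ _ _).symm.trans ((RingQuot.mkAlgHom_rel ℂ InvRel.mul_inv).trans (map_one _))

theorem inv_mul_of : inv d * of A d d = 1 :=
  (map_mul _ _ _).symm.trans ((RingQuot.mkAlgHom_rel ℂ InvRel.inv_mul).trans (map_one _))

variable (d) in
theorem isUnit_of : IsUnit (of A d d) := ⟨⟨_, _, of_mul_inv, inv_mul_of⟩, rfl⟩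

/-- The universal property of the localization. -/
def lift {B : Type*} [Ring B] [Algebra ℂ B] (f : A →ₐ[ℂ] B) (v : B) (h : f d * v = 1)
    (h' : v * f d = 1) : AdjoinInv A d →ₐ[ℂ] B :=
  RingQuot.liftAlgHom ℂ ⟨FreeAlgebra.lift ℂ fun o => o.elim v f, fun a b hab => by
    cases hab with
    | add a b => simp only [map_add, FreeAlgebra.lift_ι_apply, Option.elim]
    | mul a b => simp only [map_mul, FreeAlgebra.lift_ι_apply, Option.elim]
    | algebraMap c => simp only [FreeAlgebra.lift_ι_apply, Option.elim, AlgHom.commutes]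
    | mul_inv => simpa only [map_mul, map_one, FreeAlgebra.lift_ι_apply, Option.elim] using h
    | inv_mul => simpa only [map_mul, map_one, FreeAlgebra.lift_ι_apply, Option.elim] using h'⟩

section Lift

variable {B : Type*} [Ring B] [Algebra ℂ B] (f : A →ₐ[ℂ] B) (v : B) (h : f d * v = 1)
    (h' : v * f d = 1)

theorem lift_of (a : A) : lift f v h h' (of A d a) = f a :=
  (RingQuot.liftAlgHom_mkAlgHom_apply ℂ _ _ _).trans (FreeAlgebra.lift_ι_apply _ _)

theorem lift_inv : lift f v h h' (inv d) = v :=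
  (RingQuot.liftAlgHom_mkAlgHom_apply ℂ _ _ _).trans (FreeAlgebra.lift_ι_apply _ _)

end Lift

/-- A subalgebra that contains `A` and the inverse is everything. -/
theorem subalgebra_eq_top (S : Subalgebra ℂ (AdjoinInv A d)) (hof : ∀ a, of A d a ∈ S)
    (hinv : inv d ∈ S) : S = ⊤ := by
  refine eq_top_iff.2 fun z _ => ?_
  obtain ⟨t, rfl⟩ := RingQuot.mkAlgHom_surjective ℂ (InvRel A d) z
  induction t using FreeAlgebra.induction with
  | grade0 c => rw [AlgHom.commutes]; exact S.algebraMap_mem c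
  | grade1 o =>
    cases o with
    | none => exact hinv
    | some a => exact hof a
  | mul a b ha hb => rw [map_mul]; exact S.mul_mem (ha trivial) (hb trivial)
  | add a b ha hb => rw [map_add]; exact S.add_mem (ha trivial) (hb trivial)

/-- Under the Ore condition, every element of the localization is a left fraction. -/
theorem exists_of_pow_mul (hd : ∀ (a : A) (n : ℕ), ∃ m b, d ^ m * a = b * d ^ n)
    (z : AdjoinInv A d) : ∃ n a, of A d d ^ n * z = of A d a := by
  -- T consists of the left multipliers of the set of left fractions. Closure under products is then
  -- immediate, and the Ore condition serves only to put A inside T.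
  let T : Subalgebra ℂ (AdjoinInv A d) :=
    { carrier := {z | ∀ t, (∃ n a, of A d d ^ n * t = of A d a) →
        ∃ n a, of A d d ^ n * (z * t) = of A d a}
      mul_mem' := fun {z z'} hz hz' t ht => by rw [mul_assoc]; exact hz _ (hz' t ht)
      add_mem' := fun {z z'} hz hz' t ht => by
        obtain ⟨n, a, h⟩ := hz t ht
        obtain ⟨n', a', h'⟩ := hz' t ht
        refine ⟨n' + n, d ^ n' * a + d ^ n * a', ?_⟩
        rw [add_mul, mul_add, map_add, map_mul, map_mul, map_pow, map_pow, ← h, ← h',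
          ← mul_assoc (_ ^ n') (_ ^ n), ← mul_assoc (_ ^ n) (_ ^ n'), ← pow_add, ← pow_add,
          Nat.add_comm n]
      algebraMap_mem' := fun c t ⟨n, a, h⟩ => by
        refine ⟨n, c • a, ?_⟩
        rw [← Algebra.smul_def, mul_smul_comm, h, map_smul] }
  have hT : T = ⊤ := by
    refine subalgebra_eq_top T (fun a t ⟨n, a', h⟩ => ?_) (fun t ⟨n, a, h⟩ => ?_)
    · obtain ⟨m, b, hb⟩ := hd a n
      refine ⟨m, b * a', ?_⟩
      rw [← mul_assoc, ← map_pow, ← map_mul, hb, map_mul, map_pow, mul_assoc, h, map_mul]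
    · refine ⟨n + 1, a, ?_⟩
      rw [pow_succ, mul_assoc, ← mul_assoc (of A d d), of_mul_inv, one_mul, h]
  have h1 : z ∈ T := by rw [hT]; exact Algebra.mem_top
  obtain ⟨n, a, h⟩ := h1 1 ⟨0, 1, by rw [pow_zero, one_mul, map_one]⟩
  exact ⟨n, a, by rwa [mul_one] at h⟩

/-- A morphism that is injective on `A` is injective on the localization. -/
theorem lift_injective (hd : ∀ (a : A) (n : ℕ), ∃ m b, d ^ m * a = b * d ^ n) {B : Type*} [Ring B]
    [Algebra ℂ B] {f : A →ₐ[ℂ] B} (hf : Function.Injective f) (v : B) (h : f d * v = 1)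
    (h' : v * f d = 1) : Function.Injective (lift f v h h') := by
  refine (injective_iff_map_eq_zero _).2 fun z hz => ?_
  obtain ⟨n, a, hna⟩ := exists_of_pow_mul hd z
  have h2 : f a = 0 := by rw [← lift_of f v h h', ← hna, map_mul, hz, mul_zero]
  rw [(map_eq_zero_iff f hf).1 h2, map_zero] at hna
  exact ((isUnit_of d).pow n).mul_right_eq_zero.1 hna

end AdjoinInv

namespace Data

variable {V : Type*} [AddCommGroup V] [Module ℂ V] {W : Subgroup (V ≃ₗ[ℂ] V)} [Finite W]
  (P : Data W)

theorem exists_polyMove_δ (w : W) :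
    ∃ c : ℂ, c ≠ 0 ∧ polyMove (w : V ≃ₗ[ℂ] V) P.δ = c • P.δ := by
  choose c hc h using P.exists_dualMove_α w
  refine ⟨∏ H, c H, Finset.prod_ne_zero_iff.2 fun H _ => hc H, ?_⟩
  rw [δ, map_prod]
  simp only [polyMove_ι, h, map_smul]
  rw [Finset.prod_smul]
  congr 1
  exact (moveEquiv w).prod_comp fun H => SymmetricAlgebra.ι ℂ _ (P.α H)

end Data

namespace Cherednik

variable {V : Type*} [AddCommGroup V] [Module ℂ V] {W : Subgroup (V ≃ₗ[ℂ] V)} [Finite W]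
  (P : Data W)

/-- δ commutes with V* and ℂ𝓛, and with w up to a nonzero scalar, so the same exponent serves on
both sides. -/
theorem exists_δ_pow_mul_of_mem_degreeZero {a : Cherednik P} (ha : a ∈ degreeZero P) (n : ℕ) :
    ∃ b, ofPoly P P.δ ^ n * a = b * ofPoly P P.δ ^ n := by
  let T : Subalgebra ℂ (Cherednik P) :=
    { carrier := {a | ∃ b, ofPoly P P.δ ^ n * a = b * ofPoly P P.δ ^ n}
      mul_mem' := fun {a a'} ⟨b, h⟩ ⟨b', h'⟩ =>
        ⟨b * b', by rw [← mul_assoc, h, mul_assoc, h', mul_assoc]⟩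
      add_mem' := fun {a a'} ⟨b, h⟩ ⟨b', h'⟩ => ⟨b + b', by rw [mul_add, h, h', add_mul]⟩
      algebraMap_mem' := fun c => ⟨algebraMap ℂ _ c, (Algebra.commutes _ _).symm⟩ }
  refine degreeZero_le P (S := T) (fun x => ⟨Cherednik.x P x, ?_⟩)
    (fun b => ⟨e P b, ?_⟩) (fun u => ?_) ha
  · rw [← ofPoly_ι, ← map_pow, ← map_mul, mul_comm, map_mul]
  · rw [← map_pow, e_mul_ofPoly]
  · obtain ⟨c, hc, h⟩ := P.exists_polyMove_δ u
    refine ⟨(c ^ n)⁻¹ • w P u, ?_⟩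
    rw [← map_pow, smul_mul_assoc, w_mul_ofPoly, map_pow (polyMove _), h, smul_pow, map_smul, smul_mul_assoc,
      smul_smul, inv_mul_cancel₀ (pow_ne_zero n hc), one_smul]

/-- The Ore condition for the powers of `δ`. -/
theorem exists_δ_pow_mul (a : Cherednik P) (n : ℕ) :
    ∃ m b, ofPoly P P.δ ^ m * a = b * ofPoly P P.δ ^ n := by
  let T : Subalgebra ℂ (Cherednik P) :=
    { carrier := {a | ∀ n, ∃ m b, ofPoly P P.δ ^ m * a = b * ofPoly P P.δ ^ n}
      mul_mem' := fun {a a'} h h' n => by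
        obtain ⟨m', b', h'⟩ := h' n
        obtain ⟨m, b, h⟩ := h m'
        exact ⟨m, b * b', by rw [← mul_assoc, h, mul_assoc, h', mul_assoc]⟩
      add_mem' := fun {a a'} h h' n => by
        obtain ⟨m', b', h'⟩ := h' n
        obtain ⟨m, b, h⟩ := h n
        refine ⟨m + m', ofPoly P P.δ ^ m' * b + ofPoly P P.δ ^ m * b', ?_⟩
        rw [mul_add, add_mul, mul_assoc, mul_assoc, ← h, ← h', ← mul_assoc, ← mul_assoc, ← pow_add,
          ← pow_add, Nat.add_comm m]
      algebraMap_mem' := fun c n => ⟨n, algebraMap ℂ _ c, (Algebra.commutes _ _).symm⟩ }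
  have h0 : degreeZero P ≤ T := fun a ha n => ⟨n, exists_δ_pow_mul_of_mem_degreeZero P ha n⟩
  have hT : T = ⊤ := by
    refine subalgebra_eq_top P T (fun x => h0 (x_mem_degreeZero P x)) (fun y n => ?_)
      (fun b => h0 (e_mem_degreeZero P b)) (fun u => h0 (w_mem_degreeZero P u))
    have h1 := y_ofPoly_mem P y (P.δ ^ n)
    rw [map_pow] at h1
    obtain ⟨b, hb⟩ := exists_δ_pow_mul_of_mem_degreeZero P h1 n
    -- With r = [y, δⁿ] and δⁿ r = b δⁿ, one has δ²ⁿ y = δⁿ (y δⁿ − r) = (δⁿ y − b) δⁿ.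
    refine ⟨n + n, ofPoly P P.δ ^ n * Cherednik.y P y - b, ?_⟩
    rw [sub_mul, ← hb, pow_add]
    noncomm_ring
  have h1 : a ∈ T := by rw [hT]; exact Algebra.mem_top
  exact h1 n

end Cherednik

namespace CherednikReg

variable {V : Type*} [AddCommGroup V] [Module ℂ V] {W : Subgroup (V ≃ₗ[ℂ] V)} [Finite W]
  (P : Data W)

/-- The inverse of `δ` in `ℂ[X]`. -/
def invδ : P.RegFun := ((IsLocalization.Away.algebraMap_isUnit P.δ).unit⁻¹ : P.RegFunˣ)

theorem mul_invδ : algebraMap (Poly V) P.RegFun P.δ * invδ P = 1 :=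
  (IsLocalization.Away.algebraMap_isUnit P.δ).mul_val_inv

variable [FiniteDimensional ℂ V]

theorem toCrossed_mul_invδ :
    Cherednik.toCrossed P (Cherednik.ofPoly P P.δ) * P.fn (invδ P) = 1 := by
  rw [Cherednik.toCrossed_ofPoly, ← map_mul, mul_invδ, map_one]

theorem invδ_mul_toCrossed :
    P.fn (invδ P) * Cherednik.toCrossed P (Cherednik.ofPoly P P.δ) = 1 := by
  rw [Cherednik.toCrossed_ofPoly, ← map_mul, mul_comm, mul_invδ, map_one]

/-- The extension to the localization of the morphism to the crossed product. -/
def toCrossed : CherednikReg P →ₐ[ℂ] P.CrossedRing :=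
  AdjoinInv.lift (Cherednik.toCrossed P) (P.fn (invδ P)) (toCrossed_mul_invδ P)
    (invδ_mul_toCrossed P)

theorem toCrossed_loc (a : Cherednik P) :
    toCrossed P (loc P a) = Cherednik.toCrossed P a := AdjoinInv.lift_of _ _ _ _ a

theorem toCrossed_injective : Function.Injective (toCrossed P) :=
  AdjoinInv.lift_injective (Cherednik.exists_δ_pow_mul P) (Cherednik.toCrossed_injective P) _ _ _

/-- The range contains 1/δ, hence ℂ[X], together with W and 𝓛; subtracting the reflection terms from
T_y puts ∂_y in it, and functions and derivatives generate 𝒟(X). -/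
theorem toCrossed_surjective : Function.Surjective (toCrossed P) := by
  let R := (toCrossed P).range
  have hloc : ∀ a, Cherednik.toCrossed P a ∈ R := fun a => ⟨loc P a, toCrossed_loc P a⟩
  have hfn : ∀ f, P.fn f ∈ R := fun f => by
    obtain ⟨n, a, h⟩ := IsLocalization.Away.surj P.δ f
    have h2 : f = algebraMap (Poly V) P.RegFun a * invδ P ^ n := by
      rw [← h, mul_assoc, ← mul_pow, mul_invδ, one_pow, mul_one]
    rw [h2, map_mul, map_pow, ← Cherednik.toCrossed_ofPoly]
    exact R.mul_mem (hloc _) (R.pow_mem ⟨AdjoinInv.inv _, AdjoinInv.lift_inv _ _ _ _⟩ n)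
  have hlat : ∀ b, P.lat b ∈ R := fun b => Cherednik.toCrossed_e P b ▸ hloc _
  have hgrp : ∀ w, P.grp w ∈ R := fun w => Cherednik.toCrossed_w P w ▸ hloc _
  have hgAlg : ∀ u, P.gAlg u ∈ R := fun u => by
    induction u using MonoidAlgebra.induction_linear with
    | zero => rw [map_zero]; exact R.zero_mem
    | add u u' h h' => rw [map_add]; exact R.add_mem h h'
    | single w c => rw [P.gAlg_single]; exact R.smul_mem (hgrp w) c
  have hder : ∀ y, P.der y ∈ R := fun y => by
    have h : P.der y = P.dk y - ∑ H : Arrangement W, P.α H y • P.dunklPart H := by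
      unfold Data.dk
      rw [add_sub_cancel_right]
    rw [h]
    exact R.sub_mem (Cherednik.toCrossed_y P y ▸ hloc _) (R.sum_mem fun H _ =>
      R.smul_mem (R.mul_mem (R.mul_mem (hfn _) (hgAlg _)) (hlat _)) _)
  have hD : R.comap P.ofD = ⊤ := P.DX_subalgebra_eq_top _ hfn hder
  intro z
  change z ∈ R
  refine P.crossed_induction z R.zero_mem (fun _ _ => R.add_mem) fun D b w =>
    R.mul_mem (R.mul_mem ?_ (hlat b)) (hgrp w)
  have h : D ∈ R.comap P.ofD := by rw [hD]; exact Algebra.mem_top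
  exact h

theorem isLocalizedModule_locLin :
    IsLocalizedModule (Submonoid.powers P.δ) (locLin P) where
  map_units := by
    rintro ⟨_, n, rfl⟩
    have hu : IsUnit (loc P (Cherednik.ofPoly P (P.δ ^ n))) := by
      rw [map_pow, map_pow]
      exact (AdjoinInv.isUnit_of _).pow n
    refine (Module.End.isUnit_iff _).2 ⟨fun z z' h => hu.mul_left_cancel h, fun z => ?_⟩
    refine ⟨↑hu.unit⁻¹ * z, ?_⟩
    change loc P (Cherednik.ofPoly P (P.δ ^ n)) * (↑hu.unit⁻¹ * z) = z
    rw [← mul_assoc, hu.mul_val_inv, one_mul]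
  surj z := by
    obtain ⟨n, a, h⟩ := AdjoinInv.exists_of_pow_mul (Cherednik.exists_δ_pow_mul P) z
    refine ⟨(a, ⟨P.δ ^ n, n, rfl⟩), ?_⟩
    change loc P (Cherednik.ofPoly P (P.δ ^ n)) * z = _
    rw [map_pow, map_pow]
    exact h
  exists_of_eq {a a'} h := by
    -- The injective map Φ factors through the localization morphism, which is therefore injective:
    -- no power of δ is needed.
    refine ⟨1, congrArg _ (Cherednik.toCrossed_injective P ?_)⟩
    rw [← toCrossed_loc, ← toCrossed_loc]
    exact congrArg (toCrossed P) h

end CherednikReg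
end LatticeCherednik
end

theorem mainTheorem7 {V : Type*} [AddCommGroup V] [Module ℂ V] [FiniteDimensional ℂ V]
    (W : Subgroup (V ≃ₗ[ℂ] V)) [Finite W] (hW : LatticeCherednik.IsReflectionGroup W)
    (P : LatticeCherednik.Data W) :
    Function.Bijective (LatticeCherednik.Cherednik.triangular P) ∧
    IsLocalizedModule (Submonoid.powers P.δ) (LatticeCherednik.CherednikReg.locLin P) ∧
    ∃ Φ : LatticeCherednik.Cherednik P →ₐ[ℂ] P.Crossed,
      (∀ x : Module.Dual ℂ V, Φ (LatticeCherednik.Cherednik.x P x) = P.ofLin x) ∧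
      (∀ y : V, Φ (LatticeCherednik.Cherednik.y P y) = P.dunkl y) ∧
      (∀ w : W, Φ (LatticeCherednik.Cherednik.w P w) = P.ofGroup w) ∧
      (∀ b : LatticeCherednik.FullReflectionSubgroup W,
        Φ (LatticeCherednik.Cherednik.e P b) = P.ofLattice b) ∧
      Function.Injective Φ ∧
      ∃ Φreg : LatticeCherednik.CherednikReg P ≃ₐ[ℂ] P.Crossed,
        ∀ a : LatticeCherednik.Cherednik P,
          Φreg (LatticeCherednik.CherednikReg.loc P a) = Φ a := by
  refine ⟨LatticeCherednik.Cherednik.triangular_bijective P,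
    LatticeCherednik.CherednikReg.isLocalizedModule_locLin P,
    -- `P.CrossedRing` is `P.Crossed` itself, equipped with subtraction, so morphisms to one serve
    -- for the other.
    LatticeCherednik.Cherednik.toCrossed P,
    fun x => LatticeCherednik.Cherednik.toCrossed_x P x,
    fun y => (LatticeCherednik.Cherednik.toCrossed_y P y).trans (P.dk_eq y),
    fun w => LatticeCherednik.Cherednik.toCrossed_w P w,
    fun b => LatticeCherednik.Cherednik.toCrossed_e P b,
    LatticeCherednik.Cherednik.toCrossed_injective P,
    AlgEquiv.ofBijective (LatticeCherednik.CherednikReg.toCrossed P :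
      LatticeCherednik.CherednikReg P →ₐ[ℂ] P.CrossedRing)
      ⟨LatticeCherednik.CherednikReg.toCrossed_injective P,
        LatticeCherednik.CherednikReg.toCrossed_surjective P⟩,
    fun a => LatticeCherednik.CherednikReg.toCrossed_loc P a⟩
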